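/- **Definitions.** A *ribbon graph* $R$ is a finite nonempty set $X$ of half-edges with permutations $s_0,s_1$ generating a transitive group, $s_1$ being an involution without fixed points; put $s_2=s_1s_0^{-1}$. The cycles of $s_0,s_1,s_2$ are the vertices, edges and boundaries; the degree of a vertex is the length of its cycle. The genus $g$ is defined by $\#\text{vertices}-\#\text{edges}+\#\text{boundaries}=2-2g$. An *orientation* is a map $\varepsilon:X\to\{\pm1\}$ with $\varepsilon\circ s_2=\varepsilon$ and $\varepsilon\circ s_1=-\varepsilon$; it gives a sign to each boundary. The $n^+$ positive and the $n^-$ negative boundaries are labelled; isomorphisms and automorphisms preserve $s_0,s_1,\varepsilon$ and the labels. $R$ has type $(g,n^+,n^-,\mu)$ if moreover it has genus $g$ and $\mu(i)$ vertices of degree $i$ for all $i$; it is *generic* if all vertices have degree $4$. A *dessin d'enfant* is a continuous map $f:S\to\mathbb C\cup\{\infty\}$, with $S$ a compact connected surface, which near every point $p$ is $z\mapsto z^{k}$ in suitable local coordinates centred at $p$ and $f(p)$ ($k\ge1$ is the ramification index of $p$), with $k=1$ if $f(p)\notin\{0,1,\infty\}$. The points over $0$ and over $\infty$ are labelled; isomorphisms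 are the homeomorphisms that commute with the maps to the sphere and preserve the labels. **Lemma.** (1) Let $g\ge0$, $n^\pm\ge1$, and let $\mu$ satisfy $\sum_i i\mu(i)-2\sum_i\mu(i)=4g-4+2(n^++n^-)$. The isomorphism classes of oriented ribbon graphs with labelled boundaries of type $(g,n^+,n^-,\mu)$ are in bijection with the isomorphism classes of dessins d'enfants with $n^+$ labelled points over $0$, $n^-$ labelled points over $\infty$, and, for every $i$, exactly $\mu(i)$ points over $1$ whose ramification index is $i/2$ (ramification order $(i-2)/2$). The bijection is the following one: $R$ corresponds to $f$ if and only if $R$ is the preimage under $f$ of the unit circle, with the counterclockwise orientation, the vertices being the points over $1$, and the $i$-th positive (resp. negative) boundary surrounding the $i$-th point over $0$ (resp. $\infty$). If $R$ corresponds to $f$, then the number of edges on each labelled boundary is the ramification index of the corresponding point over $0$ or $\infty$, and the automorphism groups of $R$ and $f$ are isomorphic. (2) Let $R$ be an oriented ribbon graph with $n$ labelled positive boundaries and one negative boundary, with $\alpha_i$ edges on the $i$-th positive boundary, and let $x\in\mathbb R_{>0}^n$. Let $\mathrm{Met}(R,x)$ be the set of maps $m$ from the edges to $\mathbb R_{>0}$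 for which the $i$-th positive boundary has length $x_i$ and the negative one has length $\sum_i x_i$, with the Lebesgue measure of the affine space of solutions of these length equations, normalised by the lattice of integral points of its direction. Then $$\mathrm{Vol}(\mathrm{Met}(R,x))=\prod_{i=1}^n\mathrm{Vol}\Big\{y\in\mathbb R_{>0}^{\alpha_i}:\sum_j y_j=x_i\Big\}=\prod_{i=1}^n\frac{x_i^{\alpha_i-1}}{(\alpha_i-1)!},$$ and for all $k\ge1$, $t>0$ the simplex $\{y\in\mathbb R_{>0}^{k}:\sum_j y_j=t\}$, with its measure normalised in the same way, has volume $t^{k-1}/(k-1)!$. (3) Let $g\ge0$, $n\ge1$ with $2g-2+(n+1)>0$. For $x\in\mathbb R_{>0}^n$ let $$F_{g,n}(x)=\sum_{R}\frac{\mathrm{Vol}(\mathrm{Met}(R,x))}{\#\mathrm{Aut}(R)},$$ the volume of the moduli space of metric ribbon graphs, where $R$ runs over the isomorphism classes of generic oriented ribbon graphs of genus $g$ with $n$ labelled positive boundaries and one negative boundary. For $\alpha\in\mathbb Z_{\ge1}^n$ let $\tilde h_\alpha$ be the Hurwitz number $\sum_f 1/\#\mathrm{Aut}(f)$, where $f$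 runs over the isomorphism classes of dessins d'enfants with $n$ labelled points over $0$, of ramification indices $\alpha_1,\dots,\alpha_n$, with exactly $2g-1+n$ points over $1$, all of ramification index $2$, and with a single point over $\infty$, of ramification index $4g-2+2n$. These two sets of isomorphism classes are finite, and, for all $x\in\mathbb R_{>0}^n$, $$F_{g,n}(x)=\sum_{\substack{\alpha\in\mathbb Z_{\ge1}^n\\ \alpha_1+\dots+\alpha_n=4g-2+2n}}\tilde h_\alpha\prod_{i=1}^n\frac{x_i^{\alpha_i-1}}{(\alpha_i-1)!}.$$ In particular $F_{g,n}$ is a homogeneous polynomial of degree $4g-2+n$. -/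

import Mathlib

open Filter Topology MeasureTheory
open scoped ENNReal

noncomputable section

namespace OrientedRibbon

/-! ## Ribbon graphs -/

/-- The set of cycles of a permutation. -/
abbrev Cell {X : Type*} (s : Equiv.Perm X) : Type _ := Quotient (Equiv.Perm.SameCycle.setoid s)

/-- The cycle `[e]` of `s` through `e`. -/
def cell {X : Type*} (s : Equiv.Perm X) (e : X) : Cell s :=
  Quotient.mk (Equiv.Perm.SameCycle.setoid s) e

/-- The number of elements of a cycle. -/
def cellSize {X : Type*} (s : Equiv.Perm X) (c : Cell s) : ℕ := Nat.card {e : X // cell s e = c}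

/-- A (finite, connected) combinatorial ribbon graph: a set `X` of half-edges, an involution `s1`
without fixed points (whose cycles are the edges), and a permutation `s0` (whose cycles are the
vertices). -/
structure RibbonGraph where
  X : Type
  [fintypeX : Fintype X]
  [nonemptyX : Nonempty X]
  s0 : Equiv.Perm X
  s1 : Equiv.Perm X
  s1_invol : ∀ e, s1 (s1 e) = e
  s1_ne : ∀ e, s1 e ≠ e
  connected : ∀ e e' : X, ∃ σ ∈ Subgroup.closure ({s0, s1} : Set (Equiv.Perm X)), σ e = e'

attribute [instance] RibbonGraph.fintypeX RibbonGraph.nonemptyX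

namespace RibbonGraph

variable (R : RibbonGraph)

/-- The boundary permutation, so that `s0 * s1 * s2 = 1`. -/
def s2 : Equiv.Perm R.X := R.s1 * R.s0⁻¹

theorem s0_mul_s1_mul_s2 : R.s0 * R.s1 * R.s2 = 1 := by
  ext e
  simp [s2, R.s1_invol]

abbrev Vertex := Cell R.s0
abbrev Edge := Cell R.s1
abbrev Face := Cell R.s2

def vertex (e : R.X) : R.Vertex := cell R.s0 e
def edge (e : R.X) : R.Edge := cell R.s1 e
def face (e : R.X) : R.Face := cell R.s2 e

instance : Fintype R.Edge := Fintype.ofFinite _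

/-- The number of vertices of degree `i`. -/
def vertexCount (i : ℕ) : ℕ := Nat.card {v : R.Vertex // cellSize R.s0 v = i}

/-- The genus of the surface obtained by capping off the boundaries (via the Euler
characteristic). -/
def HasGenus (g : ℕ) : Prop :=
  (Nat.card R.Vertex : ℤ) - Nat.card R.Edge + Nat.card R.Face = 2 - 2 * g

/-- All the vertices have degree four. -/
def IsGeneric : Prop := ∀ v : R.Vertex, cellSize R.s0 v = 4

/-- The length of a boundary, for the edge lengths `m`. -/
def boundaryLength (b : R.Face) (m : R.Edge → ℝ) : ℝ :=
  open Classical in ∑ e : R.X with R.face e = b, m (R.edge e)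

/-- The space `K_R` of variations of the edge lengths which preserve all the boundary lengths. -/
def K : Submodule ℝ (R.Edge → ℝ) where
  carrier := {u | ∀ b, R.boundaryLength b u = 0}
  add_mem' := by
    intro u v hu hv b
    have h1 := hu b
    have h2 := hv b
    simp only [boundaryLength] at h1 h2 ⊢
    simp [Finset.sum_add_distrib, h1, h2]
  zero_mem' := by intro b; simp [boundaryLength]
  smul_mem' := by
    intro c u hu b
    have h1 := hu b
    simp only [boundaryLength] at h1 ⊢
    simp [← Finset.mul_sum, h1]

end RibbonGraph

/-- An oriented ribbon graph with labelled boundaries: a sign `ε` on half-edges, constant on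
boundaries and reversed by `s1`, together with labels `1, …, np` of the positive boundaries and
labels `1, …, nm` of the negative ones. -/
structure OrientedRibbonGraph (np nm : ℕ) extends RibbonGraph where
  ε : X → ℤˣ
  ε_s2 : ∀ e, ε (toRibbonGraph.s2 e) = ε e
  ε_s1 : ∀ e, ε (s1 e) = - ε e
  posLabel : Fin np ≃ {b : toRibbonGraph.Face // ∀ e, toRibbonGraph.face e = b → ε e = 1}
  negLabel : Fin nm ≃ {b : toRibbonGraph.Face // ∀ e, toRibbonGraph.face e = b → ε e = -1}

namespace OrientedRibbonGraph

variable {np nm : ℕ}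

/-- A bijection between half-edges preserves all the data (including the labels of the
boundaries). -/
def IsIso (R R' : OrientedRibbonGraph np nm) (φ : R.X ≃ R'.X) : Prop :=
  (∀ e, φ (R.s0 e) = R'.s0 (φ e)) ∧ (∀ e, φ (R.s1 e) = R'.s1 (φ e)) ∧
  (∀ e, R'.ε (φ e) = R.ε e) ∧
  (∀ i e, R.face e = R.posLabel i ↔ R'.face (φ e) = R'.posLabel i) ∧
  (∀ j e, R.face e = R.negLabel j ↔ R'.face (φ e) = R'.negLabel j)

theorem IsIso.refl (R : OrientedRibbonGraph np nm) : IsIso R R (Equiv.refl _) := by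
  simp [IsIso]

theorem IsIso.symm {R R' : OrientedRibbonGraph np nm} {φ : R.X ≃ R'.X} (h : IsIso R R' φ) :
    IsIso R' R φ.symm := by
  obtain ⟨h0, h1, h2, h3, h4⟩ := h
  refine ⟨fun e => ?_, fun e => ?_, fun e => ?_, fun i e => ?_, fun i e => ?_⟩
  · rw [Equiv.symm_apply_eq, h0, Equiv.apply_symm_apply]
  · rw [Equiv.symm_apply_eq, h1, Equiv.apply_symm_apply]
  · rw [← h2, Equiv.apply_symm_apply]
  · rw [h3, Equiv.apply_symm_apply]
  · rw [h4, Equiv.apply_symm_apply]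

theorem IsIso.trans {R R' R'' : OrientedRibbonGraph np nm} {φ : R.X ≃ R'.X} {ψ : R'.X ≃ R''.X}
    (h : IsIso R R' φ) (h' : IsIso R' R'' ψ) : IsIso R R'' (φ.trans ψ) := by
  obtain ⟨h0, h1, h2, h3, h4⟩ := h
  obtain ⟨h0', h1', h2', h3', h4'⟩ := h'
  refine ⟨fun e => ?_, fun e => ?_, fun e => ?_, fun i e => ?_, fun i e => ?_⟩
  · simp [h0, h0']
  · simp [h1, h1']
  · simp [h2, h2']
  · rw [h3, h3', Equiv.trans_apply]
  · rw [h4, h4', Equiv.trans_apply]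

instance isoSetoid (np nm : ℕ) : Setoid (OrientedRibbonGraph np nm) where
  r R R' := ∃ φ, IsIso R R' φ
  iseqv := ⟨fun R => ⟨_, IsIso.refl R⟩, fun ⟨_, h⟩ => ⟨_, h.symm⟩,
    fun ⟨_, h⟩ ⟨_, h'⟩ => ⟨_, h.trans h'⟩⟩

/-- The automorphisms: the permutations of the half-edges which preserve all the data and fix each
boundary. -/
def aut (R : OrientedRibbonGraph np nm) : Subgroup (Equiv.Perm R.X) where
  carrier := {φ | IsIso R R φ}
  mul_mem' := fun h h' => IsIso.trans h' h
  one_mem' := IsIso.refl R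
  inv_mem' := fun h => IsIso.symm h

/-- The number of (half-)edges on the `i`-th positive boundary. -/
def posDegree (R : OrientedRibbonGraph np nm) (i : Fin np) : ℕ := cellSize R.s2 (R.posLabel i).1

/-- The number of (half-)edges on the `j`-th negative boundary. -/
def negDegree (R : OrientedRibbonGraph np nm) (j : Fin nm) : ℕ := cellSize R.s2 (R.negLabel j).1

/-- The cell `Met(R, L)`: metrics (positive lengths of the edges) with boundary lengths `Lp, Lm`. -/
def Met (R : OrientedRibbonGraph np nm) (Lp : Fin np → ℝ) (Lm : Fin nm → ℝ) :
    Set (R.Edge → ℝ) :=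
  {m | (∀ a, 0 < m a) ∧ (∀ i, R.boundaryLength (R.posLabel i) m = Lp i) ∧
    (∀ j, R.boundaryLength (R.negLabel j) m = Lm j)}

end OrientedRibbonGraph

/-- Isomorphism classes of oriented ribbon graphs with labelled boundaries, of type
`(g, np, nm, μ)`: genus `g`, and `μ i` vertices of degree `i` for every `i`. -/
abbrev RibbonType (g np nm : ℕ) (μ : ℕ →₀ ℕ) : Type 1 :=
  {R : OrientedRibbonGraph np nm // R.HasGenus g ∧ ∀ i, R.vertexCount i = μ i}

abbrev RibbonClass (g np nm : ℕ) (μ : ℕ →₀ ℕ) : Type 1 :=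
  Quotient ((OrientedRibbonGraph.isoSetoid np nm).comap
    (Subtype.val : RibbonType g np nm μ → OrientedRibbonGraph np nm))

/-- Generic (four-valent) oriented ribbon graphs of genus `g` with labelled boundaries. -/
abbrev GenericRibbon (g np nm : ℕ) : Type 1 :=
  {R : OrientedRibbonGraph np nm // R.HasGenus g ∧ R.IsGeneric}

/-- The isomorphism classes of generic ribbon graphs: they index the cells of the moduli space. -/
abbrev GenericRibbonClass (g np nm : ℕ) : Type 1 :=
  Quotient ((OrientedRibbonGraph.isoSetoid np nm).comap
    (Subtype.val : GenericRibbon g np nm → OrientedRibbonGraph np nm))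

/-! ## Volumes -/

section Volume

variable {ι : Type*} [Fintype ι]

/-- The lattice of integral points of a subspace of `ℝ^ι`. -/
def integralPoints (K : Submodule ℝ (ι → ℝ)) : Submodule ℤ K where
  carrier := {u | ∀ i, ∃ z : ℤ, (u : ι → ℝ) i = z}
  add_mem' := by
    intro u v hu hv i
    obtain ⟨a, ha⟩ := hu i
    obtain ⟨b, hb⟩ := hv i
    exact ⟨a + b, by simp [ha, hb]⟩
  zero_mem' := fun i => ⟨0, by simp⟩
  smul_mem' := by
    intro c u hu i
    obtain ⟨a, ha⟩ := hu i
    exact ⟨c * a, by simp [ha]⟩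

/-- The Lebesgue measure on a (rational) subspace of `ℝ^ι`, normalised by its lattice of integral
points: the lattice has covolume `1`. -/
def latticeMeasure (K : Submodule ℝ (ι → ℝ)) : Measure K :=
  (ENNReal.ofReal (ZLattice.covolume (integralPoints K) Measure.addHaar))⁻¹ • Measure.addHaar

/-- The volume of a subset `A` of a translate of `K`, for the translate of `latticeMeasure K`.
The value does not depend on the base point `a ∈ A`, so that the supremum is the common value (and
`0` when `A` is empty). -/
def affineVolume (K : Submodule ℝ (ι → ℝ)) (A : Set (ι → ℝ)) : ℝ≥0∞ :=
  ⨆ a ∈ A, latticeMeasure K {u : K | a + (u : ι → ℝ) ∈ A}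

end Volume

/-- The affine volume of the open simplex `{y ∈ ℝ_{>0}^k | ∑ y = x}`. -/
def simplexVolume (k : ℕ) (x : ℝ) : ℝ≥0∞ :=
  affineVolume (LinearMap.ker (∑ i : Fin k, LinearMap.proj i : (Fin k → ℝ) →ₗ[ℝ] ℝ))
    {y | (∀ i, 0 < y i) ∧ ∑ i, y i = x}

/-- The volume of the cell `Met(R, L)`. -/
def OrientedRibbonGraph.cellVolume {np nm : ℕ} (R : OrientedRibbonGraph np nm)
    (Lp : Fin np → ℝ) (Lm : Fin nm → ℝ) : ℝ≥0∞ :=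
  affineVolume R.K (R.Met Lp Lm)

/-- The volume `Z_{g,np,nm}(Lp | Lm)` of the moduli space of generic oriented metric ribbon graphs:
this space is the disjoint union of the orbifolds `Aut(R) \ Met(R, L)`, over the isomorphism classes
of generic `R`. Each summand depends only on the class of `R`. -/
def moduliVolume (g np nm : ℕ) (Lp : Fin np → ℝ) (Lm : Fin nm → ℝ) : ℝ≥0∞ :=
  ∑' q : GenericRibbonClass g np nm,
    q.out.1.cellVolume Lp Lm / (Nat.card q.out.1.aut : ℝ≥0∞)

/-- The volume `F_{g,n}(x)`: there is one negative boundary, whose length is the sum of the lengths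
of the positive ones. -/
def F (g n : ℕ) (x : Fin n → ℝ) : ℝ≥0∞ := moduliVolume g n 1 x (fun _ => ∑ i, x i)

/-! ## Coverings of the sphere -/

/-- The map `f` has ramification index `k` at `p`: in suitable local coordinates centred at `p` and
at `f p` it is `z ↦ z ^ k`. -/
def HasRamificationIndex {S T : Type*} [TopologicalSpace S] [TopologicalSpace T] (f : S → T)
    (p : S) (k : ℕ) : Prop :=
  0 < k ∧ ∃ (φ : OpenPartialHomeomorph S ℂ) (ψ : OpenPartialHomeomorph T ℂ),
    p ∈ φ.source ∧ φ p = 0 ∧ f p ∈ ψ.source ∧ ψ (f p) = 0 ∧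
    ∀ y ∈ φ.source, f y ∈ ψ.source ∧ ψ (f y) = φ y ^ k

/-- A dessin d'enfant: a connected (finite) covering `f : S → ℂ ∪ {∞}` of the sphere by a compact
surface, ramified over `0`, `1`, `∞` only, whose `np` points over `0` and `nm` points over `∞` are
labelled. -/
structure Dessin (np nm : ℕ) where
  S : Type
  [top : TopologicalSpace S]
  [compact : CompactSpace S]
  [t2 : T2Space S]
  [conn : ConnectedSpace S]
  f : S → OnePoint ℂ
  continuous_f : Continuous f
  ramified : ∀ p, ∃ k, HasRamificationIndex f p k
  unramified : ∀ p, f p ≠ ((0 : ℂ) : OnePoint ℂ) → f p ≠ ((1 : ℂ) : OnePoint ℂ) → f p ≠ OnePoint.infty →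
    HasRamificationIndex f p 1
  zeroLabel : Fin np ≃ {p : S // f p = ((0 : ℂ) : OnePoint ℂ)}
  poleLabel : Fin nm ≃ {p : S // f p = OnePoint.infty}

attribute [instance] Dessin.top Dessin.compact Dessin.t2 Dessin.conn

namespace Dessin

variable {np nm : ℕ}

/-- Isomorphisms of coverings (which respect the labels). -/
def IsIso (D D' : Dessin np nm) (h : D.S ≃ₜ D'.S) : Prop :=
  (∀ p, D'.f (h p) = D.f p) ∧ (∀ i, h (D.zeroLabel i) = D'.zeroLabel i) ∧
  (∀ j, h (D.poleLabel j) = D'.poleLabel j)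

theorem IsIso.refl (D : Dessin np nm) : IsIso D D (Homeomorph.refl _) := by
  simp [IsIso]

theorem IsIso.symm {D D' : Dessin np nm} {h : D.S ≃ₜ D'.S} (H : IsIso D D' h) :
    IsIso D' D h.symm := by
  obtain ⟨h0, h1, h2⟩ := H
  refine ⟨fun p => ?_, fun i => ?_, fun j => ?_⟩
  · rw [← h0, Homeomorph.apply_symm_apply]
  · rw [← h1, Homeomorph.symm_apply_apply]
  · rw [← h2, Homeomorph.symm_apply_apply]

theorem IsIso.trans {D D' D'' : Dessin np nm} {h : D.S ≃ₜ D'.S} {h' : D'.S ≃ₜ D''.S}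
    (H : IsIso D D' h) (H' : IsIso D' D'' h') : IsIso D D'' (h.trans h') := by
  obtain ⟨h0, h1, h2⟩ := H
  obtain ⟨h0', h1', h2'⟩ := H'
  exact ⟨fun p => by simp [h0, h0'], fun i => by simp [h1, h1'], fun j => by simp [h2, h2']⟩

instance isoSetoid (np nm : ℕ) : Setoid (Dessin np nm) where
  r D D' := ∃ h, IsIso D D' h
  iseqv := ⟨fun D => ⟨_, IsIso.refl D⟩, fun ⟨_, h⟩ => ⟨_, h.symm⟩,
    fun ⟨_, h⟩ ⟨_, h'⟩ => ⟨_, h.trans h'⟩⟩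

/-- The automorphisms of a dessin (which fix the labelled points). -/
def aut (D : Dessin np nm) : Subgroup (D.S ≃ₜ D.S) where
  carrier := {h | IsIso D D h}
  mul_mem' := fun h h' => IsIso.trans h' h
  one_mem' := IsIso.refl D
  inv_mem' := fun h => IsIso.symm h

/-- The number of points over `1` with ramification index `k`. -/
def ramificationCount (D : Dessin np nm) (k : ℕ) : ℕ :=
  Nat.card {p : D.S // D.f p = ((1 : ℂ) : OnePoint ℂ) ∧ HasRamificationIndex D.f p k}

/-- There are `μ i` points over `1` whose ramification order (the index minus one) is
`(i - 2) / 2`, for every `i`. In particular `μ i = 0` for odd `i`. -/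
def HasProfile (D : Dessin np nm) (μ : ℕ →₀ ℕ) : Prop :=
  ∀ i, Nat.card {p : D.S // D.f p = ((1 : ℂ) : OnePoint ℂ) ∧
    ∃ k, HasRamificationIndex D.f p k ∧ 2 * k = i} = μ i

/-- The oriented ribbon graph `R` is the preimage by `f` of the unit circle, oriented
counterclockwise, its vertices being the points over `1`. More precisely, the surface is
decomposed in the rectangles of the positive half-edges: the rectangle `r e` of `e` is a lift of
`z ↦ exp (2πiz)` on the strip `[0, 1] × ℝ`; the upper part of its right side is glued to the left
side of the rectangle of `s2 e`, and the lower part of its left side to the right side of the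
rectangle of `s1 s2 s1 e`; its upper end is the point over `0` with the label of the positive
boundary through `e`, and its lower end is the point over `∞` with the label of the negative
boundary through `s1 e`. -/
def IsPreimageOfCircle (R : OrientedRibbonGraph np nm) (D : Dessin np nm) : Prop :=
  ∃ r : R.X → ℝ × ℝ → D.S,
    (∀ e, R.ε e = 1 → ContinuousOn (r e) (Set.Icc 0 1 ×ˢ Set.univ)) ∧
    (∀ e, R.ε e = 1 → ∀ t ∈ Set.Icc (0 : ℝ) 1, ∀ y : ℝ,
      D.f (r e (t, y)) =
        ((Complex.exp (2 * Real.pi * Complex.I * (t + y * Complex.I)) : ℂ) : OnePoint ℂ)) ∧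
    (∀ p : D.S, ∀ t ∈ Set.Ioo (0 : ℝ) 1, ∀ y : ℝ,
      D.f p = ((Complex.exp (2 * Real.pi * Complex.I * (t + y * Complex.I)) : ℂ) : OnePoint ℂ) →
      ∃! e : R.X, R.ε e = 1 ∧ r e (t, y) = p) ∧
    (∀ e, R.ε e = 1 → ∀ y : ℝ, 0 ≤ y → r e (1, y) = r (R.s2 e) (0, y)) ∧
    (∀ e, R.ε e = 1 → ∀ y : ℝ, y ≤ 0 → r e (0, y) = r (R.s1 (R.s2 (R.s1 e))) (1, y)) ∧
    (∀ e, R.ε e = 1 → ∀ i, R.face e = R.posLabel i → ∀ t ∈ Set.Icc (0 : ℝ) 1,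
      Tendsto (fun y => r e (t, y)) atTop (𝓝 (D.zeroLabel i).1)) ∧
    (∀ e, R.ε e = 1 → ∀ j, R.face (R.s1 e) = R.negLabel j → ∀ t ∈ Set.Icc (0 : ℝ) 1,
      Tendsto (fun y => r e (t, y)) atBot (𝓝 (D.poleLabel j).1))

end Dessin

abbrev DessinType (np nm : ℕ) (μ : ℕ →₀ ℕ) : Type 1 := {D : Dessin np nm // D.HasProfile μ}

/-- Isomorphism classes of dessins with `np` labelled points over `0`, `nm` labelled points over `∞`
and profile `μ` over `1`. -/
abbrev DessinClass (np nm : ℕ) (μ : ℕ →₀ ℕ) : Type 1 :=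
  Quotient ((Dessin.isoSetoid np nm).comap (Subtype.val : DessinType np nm μ → Dessin np nm))

/-- Dessins with ramification indices `α` at the labelled points over `0`, `ρ k` points with
ramification index `k` over `1` for every `k`, and ramification indices `δ` at the labelled points
over `∞`. -/
abbrev HurwitzDessin {np nm : ℕ} (α : Fin np → ℕ) (ρ : ℕ →₀ ℕ) (δ : Fin nm → ℕ) : Type 1 :=
  {D : Dessin np nm // (∀ i, HasRamificationIndex D.f (D.zeroLabel i).1 (α i)) ∧
    (∀ k, D.ramificationCount k = ρ k) ∧
    (∀ j, HasRamificationIndex D.f (D.poleLabel j).1 (δ j))}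

abbrev HurwitzClass {np nm : ℕ} (α : Fin np → ℕ) (ρ : ℕ →₀ ℕ) (δ : Fin nm → ℕ) : Type 1 :=
  Quotient ((Dessin.isoSetoid np nm).comap
    (Subtype.val : HurwitzDessin α ρ δ → Dessin np nm))

/-- The Hurwitz number: the number of isomorphism classes, each weighted by the inverse of the order
of its automorphism group. Each summand depends only on the class. -/
def hurwitzNumber {np nm : ℕ} (α : Fin np → ℕ) (ρ : ℕ →₀ ℕ) (δ : Fin nm → ℕ) : ℚ :=
  ∑ᶠ q : HurwitzClass α ρ δ, (1 : ℚ) / Nat.card q.out.1.aut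

/-- The number `h̃_α`: the points over `0` are labelled and have ramification indices `α`, there
are `2g - 1 + n` points over `1`, all with a simple ramification, and one point over `∞`, with
maximal ramification `4g - 2 + 2n`. -/
def maximalHurwitzNumber (g : ℕ) {n : ℕ} (α : Fin n → ℕ) : ℚ :=
  hurwitzNumber α (Finsupp.single 2 (2 * g + n - 1)) (fun _ : Fin 1 => 4 * g + 2 * n - 2)

end OrientedRibbon

end

noncomputable section

namespace OrientedRibbon

/-! ## The sphere, its hemispheres and the three arcs of the real circle -/

/-! The real circle passes through 0, 1 and ∞ and cuts the sphere into two closed hemispheres, which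
meet along the arcs [∞, 0], [0, 1], [1, ∞]. All the branching of a dessin lies over this circle, so
its surface is a stack of copies of the hemispheres ("sheets"), determined by three permutations
that say which upper sheet meets which lower sheet along each arc; this is a `Sheeting`. Naming each
lower sheet after its upper neighbour across [∞, 0] normalises `n 0 = 1`. The monodromy around a
branch point is a quotient of two consecutive gluing permutations: its cycles are the points above,
and their lengths are the ramification indices.

The unit circle meets the real circle only at 1 and -1, so each edge of its preimage crosses exactly
one lift of the arc (∞, 0). Hence the edges, or equivalently the positive half-edges of the ribbon
graph, index the sheets. For the gluing `![1, posNext, negNext⁻¹]` the monodromies around 0 and ∞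
run along the positive and the negative boundaries, while the monodromy around 1 is two turns about
a vertex, so that the degree of a vertex is twice the ramification index.

The relation `IsModel R D σ` says that `σ` is a sheeting of `D` by the positive half-edges of `R`
with the right labels. Part (1) rests on four facts. Every dessin has a model, by lifting the
hemispheres (`exists_sheeting`). Every ribbon graph has one, by gluing hemispheres and constructing
charts with roots (`exists_dessin`). Isomorphisms on the two sides are the same bijections of
sheets, because `sheet_eq_iff` recovers the surface from its permutations (`equiv_iff`,
`nonempty_aut_mulEquiv`). Finally, to have a model is to be the preimage of the circle
(`isPreimageOfCircle_iff`). The genus is not an independent datum: the degrees and the number of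
boundaries determine it.

For part (2), every edge has one positive and one negative side. A single negative boundary contains
all edges, so its length equation follows from the others, which involve disjoint sets of edges: the
cell is a product of simplices. Eliminating one coordinate per boundary preserves integrality, and
slicing gives the volume.

For part (3), the correspondence of part (1) is restricted to four-valent graphs with one negative
boundary, and the sum over classes is grouped by the degrees of the positive boundaries. -/

abbrev Sphere := OnePoint ℂ

/-- The sign of a hemisphere. -/
def side (s : Bool) : ℝ := if s then 1 else -1

theorem side_not (s : Bool) : side (!s) = - side s := by cases s <;> simp [side]

theorem side_mul_self (s : Bool) : side s * side s = 1 := by cases s <;> simp [side]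

/-- The open upper (`s = true`) or lower hemisphere. -/
def openHemi (s : Bool) : Set Sphere := (↑) '' {w : ℂ | 0 < side s * w.im}

/-- The closed upper or lower hemisphere. -/
def hemi (s : Bool) : Set Sphere := (openHemi (!s))ᶜ

@[simp] theorem coe_mem_openHemi {s : Bool} {w : ℂ} :
    (w : Sphere) ∈ openHemi s ↔ 0 < side s * w.im := by
  simp [openHemi]

@[simp] theorem infty_notMem_openHemi {s : Bool} : (OnePoint.infty : Sphere) ∉ openHemi s := by
  simp [openHemi]

@[simp] theorem coe_mem_hemi {s : Bool} {w : ℂ} :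
    (w : Sphere) ∈ hemi s ↔ 0 ≤ side s * w.im := by
  simp [hemi, side_not]

@[simp] theorem infty_mem_hemi {s : Bool} : (OnePoint.infty : Sphere) ∈ hemi s := by
  simp [hemi]

theorem isOpen_half (s : Bool) : IsOpen {w : ℂ | 0 < side s * w.im} :=
  isOpen_lt continuous_const (by fun_prop)

theorem isOpen_openHemi (s : Bool) : IsOpen (openHemi s) :=
  OnePoint.isOpen_image_coe.2 (isOpen_half s)

theorem isClosed_hemi (s : Bool) : IsClosed (hemi s) := (isOpen_openHemi _).isClosed_compl

theorem openHemi_subset_hemi (s : Bool) : openHemi s ⊆ hemi s := by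
  rintro _ ⟨w, hw, rfl⟩
  simpa using le_of_lt hw

theorem mem_hemi_or (z : Sphere) : z ∈ hemi true ∨ z ∈ hemi false := by
  induction z using OnePoint.rec with
  | infty => simp
  | coe w => simpa [side] using le_total 0 w.im

theorem notMem_hemi_not {s : Bool} {z : Sphere} (hz : z ∈ openHemi s) : z ∉ hemi (!s) := by
  simpa [hemi] using hz

theorem convex_half (s : Bool) : Convex ℝ {w : ℂ | 0 < side s * w.im} := by
  intro x hx y hy a b ha hb hab
  simp only [Set.mem_ofPred_eq, Complex.add_im, Complex.smul_im, smul_eq_mul] at *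
  rcases ha.eq_or_lt with rfl | ha
  · have : b = 1 := by linarith
    subst this; simpa using hy
  · nlinarith [mul_pos ha hx, mul_nonneg hb hy.le]

theorem isPreconnected_openHemi (s : Bool) : IsPreconnected (openHemi s) :=
  (convex_half s).isPreconnected.image _ OnePoint.continuous_coe.continuousOn

/-- The points `0`, `1`, `∞`. -/
def branchPt : Fin 3 → Sphere := ![((0 : ℂ) : Sphere), ((1 : ℂ) : Sphere), OnePoint.infty]

@[simp] theorem branchPt_zero : branchPt 0 = ((0 : ℂ) : Sphere) := rfl
@[simp] theorem branchPt_one : branchPt 1 = ((1 : ℂ) : Sphere) := rfl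
@[simp] theorem branchPt_two : branchPt 2 = OnePoint.infty := rfl

theorem branchPt_injective : Function.Injective branchPt := by
  intro i j h
  fin_cases i <;> fin_cases j <;> first | rfl | (exfalso; revert h; simp)

/-- The open arcs `(∞, 0)`, `(0, 1)`, `(1, ∞)` of the real line. -/
def openArcSet : Fin 3 → Set ℝ := ![Set.Iio 0, Set.Ioo 0 1, Set.Ioi 1]

/-- The closed arcs of the real line. -/
def arcSet : Fin 3 → Set ℝ := ![Set.Iic 0, Set.Icc 0 1, Set.Ici 1]

/-- The point of the sphere with a given real coordinate. -/
def realPt (x : ℝ) : Sphere := ((x : ℂ) : Sphere)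

theorem continuous_realPt : Continuous realPt :=
  OnePoint.continuous_coe.comp Complex.continuous_ofReal

theorem realPt_injective : Function.Injective realPt := fun x y h => by
  simpa [realPt] using h

@[simp] theorem realPt_ne_infty (x : ℝ) : realPt x ≠ OnePoint.infty := OnePoint.coe_ne_infty _

/-- The open arcs `(∞, 0)`, `(0, 1)`, `(1, ∞)` of the real circle. -/
def openArc (i : Fin 3) : Set Sphere := realPt '' openArcSet i

/-- The closed arcs `[∞, 0]`, `[0, 1]`, `[1, ∞]` of the real circle. -/
def arc (i : Fin 3) : Set Sphere := realPt '' arcSet i ∪ {z | z = OnePoint.infty ∧ i ≠ 1}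

@[simp] theorem realPt_mem_arc {i : Fin 3} {x : ℝ} : realPt x ∈ arc i ↔ x ∈ arcSet i := by
  simp [arc, realPt_injective.mem_set_image]

@[simp] theorem infty_mem_arc {i : Fin 3} : OnePoint.infty ∈ arc i ↔ i ≠ 1 := by
  simp [arc]

@[simp] theorem realPt_mem_hemi {s : Bool} {x : ℝ} : realPt x ∈ hemi s := by
  simp [realPt]

theorem arc_subset_hemi (i : Fin 3) (s : Bool) : arc i ⊆ hemi s := by
  rintro z (⟨x, -, rfl⟩ | ⟨rfl, -⟩) <;> simp

theorem openArcSet_subset (i : Fin 3) : openArcSet i ⊆ arcSet i := by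
  fin_cases i
  · exact Set.Iio_subset_Iic_self
  · exact Set.Ioo_subset_Icc_self
  · exact Set.Ioi_subset_Ici_self

theorem closure_openArcSet (i : Fin 3) : closure (openArcSet i) = arcSet i := by
  fin_cases i
  · exact closure_Iio 0
  · exact closure_Ioo zero_ne_one
  · exact closure_Ioi 1

theorem openArc_subset_arc (i : Fin 3) : openArc i ⊆ arc i := by
  rintro _ ⟨x, hx, rfl⟩
  exact realPt_mem_arc.2 (openArcSet_subset i hx)

theorem openArc_nonempty (i : Fin 3) : (openArc i).Nonempty := by
  refine Set.Nonempty.image _ ?_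
  fin_cases i
  · exact ⟨-1, by simp [openArcSet]⟩
  · exact ⟨1 / 2, by norm_num [openArcSet]⟩
  · exact ⟨2, by simp [openArcSet]⟩

theorem isPreconnected_openArc (i : Fin 3) : IsPreconnected (openArc i) := by
  refine IsPreconnected.image ?_ _ continuous_realPt.continuousOn
  fin_cases i
  · exact isPreconnected_Iio
  · exact isPreconnected_Ioo
  · exact isPreconnected_Ioi

theorem isClosed_arc (i : Fin 3) : IsClosed (arc i) := by
  have hcl : IsClosed (arcSet i) := closure_openArcSet i ▸ isClosed_closure
  have hpre : ((↑) ⁻¹' arc i : Set ℂ) = Complex.ofReal '' arcSet i := by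
    ext w
    simp [arc, realPt]
  have hcl' : IsClosed (Complex.ofReal '' arcSet i) :=
    Complex.isometry_ofReal.isClosedEmbedding.isClosedMap _ hcl
  by_cases hi : i = 1
  · subst hi
    rw [OnePoint.isClosed_iff_of_notMem (by simp), hpre]
    exact ⟨hcl', isCompact_Icc.image Complex.continuous_ofReal⟩
  · rw [OnePoint.isClosed_iff_of_mem (by simpa using hi), hpre]
    exact hcl'

theorem arc_subset_closure (i : Fin 3) : arc i ⊆ closure (openArc i) := by
  rintro z (⟨x, hx, rfl⟩ | ⟨rfl, hi⟩)
  · rw [← closure_openArcSet] at hx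
    exact image_closure_subset_closure_image continuous_realPt ⟨x, hx, rfl⟩
  · have key : ∀ (l : Filter ℝ) [l.NeBot], Tendsto (fun x : ℝ => |x|) l atTop → openArcSet i ∈ l →
        OnePoint.infty ∈ closure (openArc i) := by
      intro l _ hl hi
      refine mem_closure_of_tendsto (b := l) (f := realPt) ?_
        (mem_of_superset hi fun x hx => ⟨x, hx, rfl⟩)
      refine OnePoint.tendsto_coe_infty.comp ?_
      rw [coclosedCompact_eq_cocompact, ← Metric.cobounded_eq_cocompact,
        ← tendsto_norm_atTop_iff_cobounded]
      simpa using hl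
    fin_cases i
    · exact key atBot tendsto_abs_atBot_atTop (Iio_mem_atBot _)
    · simp at hi
    · exact key atTop tendsto_abs_atTop_atTop (Ioi_mem_atTop _)

theorem mem_arc_of_mem_hemi {z : Sphere} (h : z ∈ hemi true) (h' : z ∈ hemi false) :
    ∃ i, z ∈ arc i := by
  induction z using OnePoint.rec with
  | infty => exact ⟨0, by simp⟩
  | coe w =>
    have hw : w.im = 0 := by
      simp only [coe_mem_hemi, side] at h h'
      norm_num at h h'
      linarith
    obtain ⟨x, rfl⟩ : ∃ x : ℝ, (x : ℂ) = w := ⟨w.re, by apply Complex.ext <;> simp [hw]⟩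
    change ∃ i, realPt x ∈ arc i
    simp only [realPt_mem_arc]
    rcases le_total x 0 with h0 | h0
    · exact ⟨0, h0⟩
    · rcases le_total x 1 with h1 | h1
      · exact ⟨1, h0, h1⟩
      · exact ⟨2, h1⟩

theorem branchPt_zero' : branchPt 0 = realPt 0 := by simp [realPt]
theorem branchPt_one' : branchPt 1 = realPt 1 := by simp [realPt]

/-- The indexing is cyclic: branch point `i` is the common end of the arcs `i` and `i + 1`, and the
arc `i + 2` is opposite to it. This convention is what makes the monodromy `n (i + 1) * (n i)⁻¹`. -/
theorem branchPt_mem_arc (i j : Fin 3) : branchPt i ∈ arc j ↔ j ≠ i + 2 := by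
  fin_cases i <;> fin_cases j <;>
    simp [branchPt_zero', branchPt_one', -branchPt_zero, -branchPt_one, arcSet]

theorem branchPt_mem_hemi (i : Fin 3) (s : Bool) : branchPt i ∈ hemi s :=
  arc_subset_hemi i s ((branchPt_mem_arc i i).2 (by fin_cases i <;> decide))

theorem eq_branchPt_of_mem_arc {i j : Fin 3} {z : Sphere} (hij : i ≠ j) (hi : z ∈ arc i)
    (hj : z ∈ arc j) : z ∈ Set.range branchPt := by
  rcases hi with ⟨x, hx, rfl⟩ | ⟨rfl, hi⟩
  · rw [realPt_mem_arc] at hj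
    suffices h : x = 0 ∨ x = 1 by
      rcases h with rfl | rfl
      · exact ⟨0, branchPt_zero'⟩
      · exact ⟨1, branchPt_one'⟩
    fin_cases i <;> fin_cases j <;> simp [arcSet] at * <;>
      first | (left; linarith) | (right; linarith)
  · exact ⟨2, rfl⟩

theorem mem_openArc_iff {i : Fin 3} {z : Sphere} :
    z ∈ openArc i ↔ z ∈ arc i ∧ z ∉ Set.range branchPt := by
  constructor
  · intro h
    refine ⟨openArc_subset_arc i h, ?_⟩
    rintro ⟨j, rfl⟩
    obtain ⟨x, hx, h⟩ := h
    fin_cases j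
    · rw [show ((⟨0, by omega⟩ : Fin 3)) = 0 from rfl, branchPt_zero'] at h
      obtain rfl := realPt_injective h
      fin_cases i <;> norm_num [openArcSet] at hx
    · rw [show ((⟨1, by omega⟩ : Fin 3)) = 1 from rfl, branchPt_one'] at h
      obtain rfl := realPt_injective h
      fin_cases i <;> norm_num [openArcSet] at hx
    · simp at h
  · rintro ⟨⟨x, hx, rfl⟩ | ⟨rfl, hi⟩, h⟩
    · refine ⟨x, ?_, rfl⟩
      have h0 : x ≠ 0 := by rintro rfl; exact h ⟨0, branchPt_zero'⟩
      have h1 : x ≠ 1 := by rintro rfl; exact h ⟨1, branchPt_one'⟩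
      fin_cases i
      · exact lt_of_le_of_ne hx h0
      · exact ⟨lt_of_le_of_ne hx.1 h0.symm, lt_of_le_of_ne hx.2 h1⟩
      · exact lt_of_le_of_ne hx h1.symm
    · exact absurd ⟨2, rfl⟩ h

theorem notMem_arc_of_mem_openHemi {s : Bool} {z : Sphere} (hz : z ∈ openHemi s) (i : Fin 3) :
    z ∉ arc i := fun h => notMem_hemi_not hz (arc_subset_hemi i _ h)

theorem notMem_branchPt_of_mem_openHemi {s : Bool} {z : Sphere} (hz : z ∈ openHemi s) :
    z ∉ Set.range branchPt := by
  rintro ⟨i, rfl⟩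
  exact notMem_hemi_not hz (branchPt_mem_hemi i _)

theorem mem_openHemi_or_arc {s : Bool} {z : Sphere} (hz : z ∈ hemi s) :
    z ∈ openHemi s ∨ ∃ i, z ∈ arc i := by
  by_cases h : z ∈ openHemi s
  · exact Or.inl h
  · have h' : z ∈ hemi (!s) := by simpa [hemi] using h
    right
    cases s
    · exact mem_arc_of_mem_hemi h' hz
    · exact mem_arc_of_mem_hemi hz h'

/-! ## The involution `z ↦ -1 / z` -/

/-- The map `z ↦ -1 / z` of the sphere. -/
def negInvFun (z : Sphere) : Sphere :=
  open Classical in z.elim ((0 : ℂ) : Sphere) fun w => if w = 0 then OnePoint.infty else ((-w⁻¹ : ℂ) : Sphere)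

@[simp] theorem negInvFun_infty : negInvFun OnePoint.infty = ((0 : ℂ) : Sphere) := rfl

@[simp] theorem negInvFun_zero : negInvFun ((0 : ℂ) : Sphere) = OnePoint.infty := by
  simp [negInvFun]

theorem negInvFun_coe {w : ℂ} (hw : w ≠ 0) : negInvFun (w : Sphere) = ((-w⁻¹ : ℂ) : Sphere) := by
  change (if w = 0 then _ else _) = _
  simp [hw]

theorem negInvFun_negInvFun (z : Sphere) : negInvFun (negInvFun z) = z := by
  induction z using OnePoint.rec with
  | infty => simp
  | coe w =>
    by_cases hw : w = 0
    · subst hw; simp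
    · rw [negInvFun_coe hw, negInvFun_coe (by simpa using hw)]
      simp

theorem continuous_negInvFun : Continuous negInvFun := by
  rw [continuous_iff_continuousAt]
  intro z
  induction z using OnePoint.rec with
  | infty =>
    rw [OnePoint.continuousAt_infty']
    have h : Tendsto (fun w : ℂ => ((-w⁻¹ : ℂ) : Sphere)) (coclosedCompact ℂ)
        (𝓝 ((0 : ℂ) : Sphere)) := by
      refine (OnePoint.continuous_coe.tendsto _).comp ?_
      rw [coclosedCompact_eq_cocompact, ← Metric.cobounded_eq_cocompact]
      simpa using (tendsto_inv₀_cobounded (α := ℂ)).neg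
    refine h.congr' ?_
    rw [coclosedCompact_eq_cocompact]
    filter_upwards [(isCompact_singleton (x := (0 : ℂ))).compl_mem_cocompact] with w hw
    exact (negInvFun_coe hw).symm
  | coe w =>
    rw [OnePoint.continuousAt_coe]
    by_cases hw : w = 0
    · subst hw
      rw [continuousAt_iff_punctured_nhds]
      simp only [Function.comp_apply, negInvFun_zero]
      have h : Tendsto (fun w : ℂ => ((-w⁻¹ : ℂ) : Sphere)) (𝓝[≠] 0) (𝓝 OnePoint.infty) := by
        refine OnePoint.tendsto_coe_infty.comp ?_
        rw [coclosedCompact_eq_cocompact, ← Metric.cobounded_eq_cocompact]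
        exact tendsto_neg_cobounded.comp tendsto_inv₀_nhdsNE_zero
      exact h.congr' (eventually_nhdsWithin_of_forall fun w hw => (negInvFun_coe hw).symm)
    · have h : ContinuousAt (fun w : ℂ => ((-w⁻¹ : ℂ) : Sphere)) w :=
        OnePoint.continuous_coe.continuousAt.comp (continuousAt_inv₀ hw).neg
      refine h.congr ?_
      filter_upwards [isOpen_ne.mem_nhds hw] with w hw
      exact (negInvFun_coe hw).symm

/-- The homeomorphism `z ↦ -1 / z` of the sphere. -/
def negInv : Sphere ≃ₜ Sphere where
  toFun := negInvFun
  invFun := negInvFun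
  left_inv := negInvFun_negInvFun
  right_inv := negInvFun_negInvFun
  continuous_toFun := continuous_negInvFun
  continuous_invFun := continuous_negInvFun

@[simp] theorem negInv_infty : negInv OnePoint.infty = ((0 : ℂ) : Sphere) := rfl

@[simp] theorem negInv_zero : negInv ((0 : ℂ) : Sphere) = OnePoint.infty := negInvFun_zero

theorem negInv_coe {w : ℂ} (hw : w ≠ 0) : negInv (w : Sphere) = ((-w⁻¹ : ℂ) : Sphere) :=
  negInvFun_coe hw

@[simp] theorem negInv_negInv (z : Sphere) : negInv (negInv z) = z := negInvFun_negInvFun z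

theorem negInv_mem_openHemi {s : Bool} {z : Sphere} : negInv z ∈ openHemi s ↔ z ∈ openHemi s := by
  have key : ∀ z, z ∈ openHemi s → negInv z ∈ openHemi s := by
    rintro _ ⟨w, hw, rfl⟩
    have h0 : w ≠ 0 := by rintro rfl; simp at hw
    rw [negInv_coe h0, coe_mem_openHemi]
    simp only [Complex.neg_im, Complex.inv_im, neg_div, neg_neg, ← mul_div_assoc]
    exact div_pos hw (Complex.normSq_pos.2 h0)
  exact ⟨fun h => negInv_negInv z ▸ key _ h, key z⟩

theorem negInv_mem_hemi {s : Bool} {z : Sphere} : negInv z ∈ hemi s ↔ z ∈ hemi s := by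
  simp [hemi, negInv_mem_openHemi]

/-- Half-discs are convex. These connected traces of neighbourhoods are what lets sections over an
open hemisphere converge at its boundary. -/
theorem exists_isPreconnected_mem_nhdsWithin_coe {s : Bool} (w : ℂ) {A : Set Sphere}
    (hA : A ∈ 𝓝[openHemi s] (w : Sphere)) :
    ∃ B ∈ 𝓝[openHemi s] (w : Sphere), B ⊆ A ∧ B ⊆ openHemi s ∧ IsPreconnected B := by
  have hpre : ((↑) ⁻¹' openHemi s : Set ℂ) = {w : ℂ | 0 < side s * w.im} := by ext; simp
  rw [OnePoint.nhdsWithin_coe, hpre] at hA ⊢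
  obtain ⟨r, hr, hrA⟩ := Metric.mem_nhdsWithin_iff.1 (mem_map.1 hA)
  refine ⟨(↑) '' (Metric.ball w r ∩ {w : ℂ | 0 < side s * w.im}), image_mem_map ?_, ?_, ?_, ?_⟩
  · exact inter_mem (mem_nhdsWithin_of_mem_nhds (Metric.ball_mem_nhds _ hr)) self_mem_nhdsWithin
  · exact Set.image_subset_iff.2 hrA
  · exact Set.image_mono Set.inter_subset_right
  · exact (((convex_ball w r).inter (convex_half s)).isPreconnected).image _
      OnePoint.continuous_coe.continuousOn

theorem exists_isPreconnected_mem_nhdsWithin {s : Bool} (z : Sphere) {A : Set Sphere}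
    (hA : A ∈ 𝓝[openHemi s] z) :
    ∃ B ∈ 𝓝[openHemi s] z, B ⊆ A ∧ B ⊆ openHemi s ∧ IsPreconnected B := by
  induction z using OnePoint.rec with
  | coe w => exact exists_isPreconnected_mem_nhdsWithin_coe w hA
  | infty =>
    -- At ∞ the statement is transported from 0 by `z ↦ -1 / z`, which preserves both hemispheres.
    have hset : negInv ⁻¹' openHemi s = openHemi s := by ext z; exact negInv_mem_openHemi
    have hmap : ∀ z, map negInv (𝓝[openHemi s] z) = 𝓝[openHemi s] (negInv z) := by
      intro z
      rw [negInv.isEmbedding.map_nhdsWithin_eq]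
      congr 1
      ext y
      constructor
      · rintro ⟨x, hx, rfl⟩; exact negInv_mem_openHemi.2 hx
      · intro hy; exact ⟨negInv y, negInv_mem_openHemi.2 hy, negInv_negInv y⟩
    rw [← negInv_zero, ← hmap] at hA ⊢
    obtain ⟨B, hB, hBA, hBs, hBc⟩ := exists_isPreconnected_mem_nhdsWithin_coe 0 (mem_map.1 hA)
    exact ⟨negInv '' B, image_mem_map hB, Set.image_subset_iff.2 hBA,
      Set.image_subset_iff.2 (hset.symm ▸ hBs), hBc.image _ negInv.continuous.continuousOn⟩

theorem coe_mem_closure_openHemi {s : Bool} {w : ℂ} (hw : 0 ≤ side s * w.im) :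
    (w : Sphere) ∈ closure (openHemi s) := by
  have hcont : Continuous fun t : ℝ => ((w + t * (side s * Complex.I) : ℂ) : Sphere) :=
    OnePoint.continuous_coe.comp (by fun_prop)
  have h := (hcont.tendsto 0).mono_left (nhdsWithin_le_nhds (s := Set.Ioi 0))
  simp only [Complex.ofReal_zero, zero_mul, add_zero] at h
  refine mem_closure_of_tendsto h (eventually_nhdsWithin_of_forall fun t (ht : 0 < t) => ?_)
  simp only [coe_mem_openHemi, Complex.add_im, Complex.mul_im, Complex.ofReal_re,
    Complex.ofReal_im, Complex.I_im, Complex.I_re, mul_zero, zero_mul, mul_one, add_zero]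
  nlinarith [side_mul_self s]

theorem hemi_subset_closure (s : Bool) : hemi s ⊆ closure (openHemi s) := by
  intro z hz
  induction z using OnePoint.rec with
  | coe w => exact coe_mem_closure_openHemi (coe_mem_hemi.1 hz)
  | infty =>
    have h := image_closure_subset_closure_image negInv.continuous
      ⟨_, coe_mem_closure_openHemi (s := s) (w := 0) (by simp), negInv_zero⟩
    refine closure_mono ?_ h
    rintro _ ⟨y, hy, rfl⟩
    exact negInv_mem_openHemi.2 hy

/-! ## Local structure of branched coverings -/

/-- The punctured disc is the image by the exponential of a convex set, a left half plane when `r >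
0`. -/
theorem isPreconnected_ball_diff_singleton (r : ℝ) :
    IsPreconnected (Metric.ball (0 : ℂ) r \ {0}) := by
  have h : Metric.ball (0 : ℂ) r \ {0} = Complex.exp '' {z : ℂ | Real.exp z.re < r} := by
    ext w
    constructor
    · rintro ⟨hw, h0⟩
      have h0 : w ≠ 0 := h0
      refine ⟨Complex.log w, ?_, Complex.exp_log h0⟩
      change Real.exp (Complex.log w).re < r
      rw [Complex.log_re, Real.exp_log (norm_pos_iff.2 h0)]
      simpa using hw
    · rintro ⟨z, hz, rfl⟩
      exact ⟨by simpa [Complex.norm_exp] using hz, Complex.exp_ne_zero z⟩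
  rw [h]
  refine IsPreconnected.image (Convex.isPreconnected ?_) _ Complex.continuous_exp.continuousOn
  intro x hx y hy a b ha hb hab
  simp only [Set.mem_ofPred_eq, Complex.add_re, Complex.smul_re, smul_eq_mul] at *
  have h1 : a * x.re + b * y.re ≤ max x.re y.re := by
    have h2 := mul_le_mul_of_nonneg_left (le_max_left x.re y.re) ha
    have h3 := mul_le_mul_of_nonneg_left (le_max_right x.re y.re) hb
    calc _ ≤ a * max x.re y.re + b * max x.re y.re := add_le_add h2 h3
      _ = max x.re y.re := by rw [← add_mul, hab, one_mul]
  refine lt_of_le_of_lt (Real.exp_le_exp.2 h1) ?_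
  rcases max_choice x.re y.re with h | h <;> rw [h] <;> assumption

theorem card_pow_eq {k : ℕ} (hk : 0 < k) {a : ℂ} (ha : a ≠ 0) :
    Nat.card {w : ℂ // w ^ k = a} = k := by
  classical
  have hζ := Complex.isPrimitiveRoot_exp k hk.ne'
  obtain ⟨α, hα⟩ := IsAlgClosed.exists_pow_nat_eq a hk
  have h1 : (Polynomial.nthRoots k a).toFinset.card = k := by
    rw [Multiset.toFinset_card_of_nodup (hζ.nthRoots_nodup ha), hζ.card_nthRoots, if_pos ⟨α, hα⟩]
  rw [← Fintype.card_coe, ← Nat.card_eq_fintype_card] at h1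
  refine Eq.trans (Nat.card_congr (Equiv.subtypeEquivRight fun w => ?_)) h1
  rw [Multiset.mem_toFinset, Polynomial.mem_nthRoots hk]

variable {S : Type*} [TopologicalSpace S]

/-- The model `z ↦ z ^ k` on a round disc of the source chart has a connected punctured disc, only 0
over 0, and exactly `k` preimages of each nonzero value of its image. These topological consequences
of the index replace the charts in the study of sheetings. -/
theorem HasRamificationIndex.exists_nhd {T : Type*} [TopologicalSpace T] {f : S → T} {p : S}
    {k : ℕ} (h : HasRamificationIndex f p k) {V : Set S} (hV : V ∈ 𝓝 p) :
    ∃ N : Set S, IsOpen N ∧ p ∈ N ∧ N ⊆ V ∧ IsPreconnected (N \ {p}) ∧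
      (∀ y ∈ N, f y = f p → y = p) ∧ f '' N ∈ 𝓝 (f p) ∧
      ∀ q ∈ f '' N, q ≠ f p → Nat.card {y // y ∈ N ∧ f y = q} = k := by
  obtain ⟨hk, φ, ψ, hp, hφ, hfp, hψ, hf⟩ := h
  have h0 : (0 : ℂ) ∈ φ.target := hφ ▸ φ.map_source hp
  have hs0 : φ.symm 0 = p := by rw [← hφ, φ.left_inv hp]
  have hnhds : φ.target ∩ φ.symm ⁻¹' V ∈ 𝓝 (0 : ℂ) :=
    inter_mem (φ.open_target.mem_nhds h0)
      ((φ.continuousAt_symm h0).preimage_mem_nhds (hs0.symm ▸ hV))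
  obtain ⟨r, hr, hball⟩ := Metric.mem_nhds_iff.1 hnhds
  set N := φ.source ∩ φ ⁻¹' Metric.ball 0 r with hN
  have hpN : p ∈ N := ⟨hp, by simpa [hφ] using hr⟩
  have hmem : ∀ w ∈ Metric.ball (0 : ℂ) r, φ.symm w ∈ N := fun w hw =>
    ⟨φ.map_target (hball hw).1, by simpa [φ.right_inv (hball hw).1] using hw⟩
  have hval : ∀ y ∈ N, f y = f p → y = p := by
    intro y hy h
    have h1 := (hf y hy.1).2
    rw [h, hψ] at h1
    refine φ.injOn hy.1 hp ?_
    rw [hφ]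
    exact eq_zero_of_pow_eq_zero h1.symm
  have hinv : ∀ y ∈ N, φ.symm (φ y) = y := fun y hy => φ.left_inv hy.1
  have himg : N \ {p} = φ.symm '' (Metric.ball 0 r \ {0}) := by
    ext y
    constructor
    · rintro ⟨hy, hne⟩
      refine ⟨φ y, ⟨hy.2, fun h0 => hne ?_⟩, hinv y hy⟩
      exact φ.injOn hy.1 hp (by rw [hφ]; exact h0)
    · rintro ⟨w, ⟨hw, hw0⟩, rfl⟩
      refine ⟨hmem w hw, fun h => hw0 ?_⟩
      have h2 := congrArg φ (show φ.symm w = p from h)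
      rwa [φ.right_inv (hball hw).1, hφ] at h2
  have hroot : ∀ q ∈ ψ.source, ∀ w ∈ Metric.ball (0 : ℂ) r, w ^ k = ψ q → f (φ.symm w) = q := by
    intro q hq w hw h
    have h1 := hf _ (hmem w hw).1
    exact ψ.injOn h1.1 hq (by rw [h1.2, φ.right_inv (hball hw).1, h])
  refine ⟨N, φ.isOpen_inter_preimage Metric.isOpen_ball, hpN, fun y hy => ?_, ?_, hval, ?_, ?_⟩
  · rw [← hinv y hy]; exact (hball hy.2).2
  · rw [himg]
    exact (isPreconnected_ball_diff_singleton r).image _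
      (φ.continuousOn_symm.mono fun w hw => (hball hw.1).1)
  · have h1 : ψ.source ∩ ψ ⁻¹' Metric.ball 0 (r ^ k) ∈ 𝓝 (f p) :=
      (ψ.isOpen_inter_preimage Metric.isOpen_ball).mem_nhds ⟨hfp, by simp [hψ, hr]⟩
    refine mem_of_superset h1 ?_
    rintro q ⟨hq, hqr⟩
    obtain ⟨w, hw⟩ := IsAlgClosed.exists_pow_nat_eq (ψ q) hk
    have hwr : w ∈ Metric.ball (0 : ℂ) r := by
      have h2 : ‖w‖ ^ k < r ^ k := by rw [← norm_pow, hw]; simpa using hqr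
      simpa using lt_of_pow_lt_pow_left₀ k hr.le h2
    exact ⟨_, hmem w hwr, hroot q hq w hwr hw⟩
  · rintro _ ⟨y, hy, rfl⟩ hne
    have hy1 := hf y hy.1
    have hne0 : ψ (f y) ≠ 0 := fun h => hne (ψ.injOn hy1.1 hfp (h.trans hψ.symm))
    rw [← card_pow_eq hk hne0]
    refine Nat.card_congr ⟨fun x => ⟨φ x.1, ?_⟩, fun w => ⟨φ.symm w.1, ?_⟩, ?_, ?_⟩
    · rw [← (hf _ x.2.1.1).2, x.2.2]
    · have hwr : w.1 ∈ Metric.ball (0 : ℂ) r := by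
        have h2 : ‖w.1‖ ^ k < r ^ k := by
          rw [← norm_pow, w.2, hy1.2, norm_pow]
          exact pow_lt_pow_left₀ (by simpa using hy.2) (norm_nonneg _) hk.ne'
        simpa using lt_of_pow_lt_pow_left₀ k hr.le h2
      exact ⟨hmem _ hwr, hroot _ hy1.1 _ hwr w.2⟩
    · intro x; exact Subtype.ext (hinv _ x.2.1)
    · intro w
      have hwr : w.1 ∈ Metric.ball (0 : ℂ) r := by
        have h2 : ‖w.1‖ ^ k < r ^ k := by
          rw [← norm_pow, w.2, hy1.2, norm_pow]
          exact pow_lt_pow_left₀ (by simpa using hy.2) (norm_nonneg _) hk.ne'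
        simpa using lt_of_pow_lt_pow_left₀ k hr.le h2
      exact Subtype.ext (φ.right_inv (hball hwr).1)

theorem HasRamificationIndex.exists_openPartialHomeomorph {T : Type*} [TopologicalSpace T]
    {f : S → T} {p : S} (h : HasRamificationIndex f p 1) :
    ∃ e : OpenPartialHomeomorph S T, p ∈ e.source ∧ Set.EqOn f e e.source := by
  obtain ⟨-, φ, ψ, hp, hφ, hfp, hψ, hf⟩ := h
  simp only [pow_one] at hf
  refine ⟨φ.trans ψ.symm, ?_, ?_⟩
  · simp only [OpenPartialHomeomorph.trans_source, OpenPartialHomeomorph.symm_source]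
    refine ⟨hp, ?_⟩
    rw [Set.mem_preimage, ← (hf p hp).2]
    exact ψ.map_source hfp
  · intro y hy
    have hy1 : y ∈ φ.source := by
      simp only [OpenPartialHomeomorph.trans_source] at hy; exact hy.1
    simp only [OpenPartialHomeomorph.trans_apply]
    rw [← (hf y hy1).2, ψ.left_inv (hf y hy1).1]

/-! ### Topology of the covering map -/

namespace Dessin

variable {np nm : ℕ} (D : Dessin np nm)

theorem isClosedMap_f : IsClosedMap D.f := D.continuous_f.isClosedMap

theorem isOpenMap_f : IsOpenMap D.f := by
  rw [isOpenMap_iff_nhds_le]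
  intro p V hV
  obtain ⟨k, hk⟩ := D.ramified p
  obtain ⟨N, -, -, hNV, -, -, hN, -⟩ := hk.exists_nhd hV
  exact mem_of_superset hN (Set.image_subset_iff.2 hNV)

theorem hasRamificationIndex_one {p : D.S} (hp : D.f p ∉ Set.range branchPt) :
    HasRamificationIndex D.f p 1 :=
  D.unramified p (fun h => hp ⟨0, h.symm⟩) (fun h => hp ⟨1, h.symm⟩) (fun h => hp ⟨2, h.symm⟩)

theorem isLocalHomeomorphOn_f : IsLocalHomeomorphOn D.f (D.f ⁻¹' (Set.range branchPt)ᶜ) :=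
  IsLocalHomeomorphOn.mk _ _ fun _ hp => (D.hasRamificationIndex_one hp).exists_openPartialHomeomorph

theorem isCoveringMapOn_f : IsCoveringMapOn D.f (Set.range branchPt)ᶜ :=
  IsCoveringMapOn.of_isLocalHomeomorphOn D.continuous_f D.isLocalHomeomorphOn_f

/-- A fibre is compact, and discrete because the local model takes the central value at the centre
only. -/
theorem finite_fiber (z : Sphere) : (D.f ⁻¹' {z}).Finite := by
  refine IsCompact.finite (isClosed_singleton.preimage D.continuous_f).isCompact ?_
  rw [isDiscrete_iff_forall_mem_exists_isOpen]
  rintro p rfl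
  obtain ⟨k, hk⟩ := D.ramified p
  obtain ⟨N, hNo, hpN, -, -, hN, -, -⟩ := hk.exists_nhd univ_mem
  refine ⟨N, hNo, Set.Subset.antisymm (fun y hy => hN y hy.1 hy.2) ?_⟩
  rintro _ rfl
  exact ⟨hpN, rfl⟩

/-- A map whose image in the sphere converges, along a filter with a basis of sets with connected
images, converges. -/
theorem exists_tendsto {Y : Type*} {l : Filter Y} [l.NeBot] {g : Y → D.S} {z : Sphere}
    (hg : Tendsto (D.f ∘ g) l (𝓝 z))
    (hc : ∀ A ∈ l, ∃ B ∈ l, B ⊆ A ∧ IsPreconnected (g '' B)) :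
    ∃ p, D.f p = z ∧ Tendsto g l (𝓝 p) := by
  obtain ⟨p, hp⟩ := exists_clusterPt_of_compactSpace (map g l)
  have hfp : D.f p = z := by
    have h1 : ClusterPt (D.f p) (map D.f (map g l)) :=
      hp.map D.continuous_f.continuousAt tendsto_map
    rw [map_map] at h1
    exact eq_of_nhds_neBot (h1.neBot.mono (inf_le_inf_left _ hg))
  refine ⟨p, hfp, fun V hV => ?_⟩
  obtain ⟨k, hk⟩ := D.ramified p
  obtain ⟨N₀, hN₀o, hpN₀, hN₀V, -, hN₀, -, -⟩ := hk.exists_nhd hV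
  obtain ⟨C, hC, hCcl, hCN⟩ := exists_mem_nhds_isClosed_subset (hN₀o.mem_nhds hpN₀)
  -- The frontier of `C` misses the fibre over `z` and has closed image. So a connected set lying
  -- over a small neighbourhood of `z` cannot cross it, and stays in the interior of `C` as soon as
  -- it meets it; the cluster point provides the meeting.
  have hfr : (D.f '' (C \ interior C))ᶜ ∈ 𝓝 z := by
    refine (D.isClosedMap_f _ (hCcl.inter isOpen_interior.isClosed_compl)).isOpen_compl.mem_nhds ?_
    rintro ⟨y, ⟨hyC, hyi⟩, hy⟩
    rw [hN₀ y (hCN hyC) (hy.trans hfp.symm)] at hyi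
    exact hyi (mem_interior_iff_mem_nhds.2 hC)
  obtain ⟨B, hB, hBA, hBc⟩ := hc _ (hg hfr)
  have hmeet : (g '' B ∩ interior C).Nonempty := by
    have := (clusterPt_iff_nonempty.1 hp (interior_mem_nhds.2 hC) (image_mem_map hB))
    rwa [Set.inter_comm]
  have hsub : g '' B ⊆ interior C := by
    refine hBc.subset_left_of_subset_union isOpen_interior hCcl.isOpen_compl ?_ ?_ hmeet
    · exact disjoint_compl_right.mono_left interior_subset
    · rintro _ ⟨y, hy, rfl⟩
      by_cases h : g y ∈ C
      · left
        by_contra h'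
        exact hBA hy (Set.mem_image_of_mem _ ⟨h, h'⟩)
      · exact Or.inr h
  exact mem_of_superset (image_mem_map hB) fun y hy => hN₀V (hCN (interior_subset (hsub hy)))

end Dessin

/-! ## Gluing hemispheres along the arcs -/

section Gluing

variable {ι : Type*} (n : Fin 3 → Equiv.Perm ι)

/-- The monodromy of the upper sheets around the `i`-th branch point. -/
def mon (i : Fin 3) : Equiv.Perm ι := n (i + 1) * (n i)⁻¹

/-- The upper sheet which touches a given sheet along the `i`-th arc. -/
def adj (s : Bool) (i : Fin 3) : Equiv.Perm ι := if s then 1 else n i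

@[simp] theorem adj_true (i : Fin 3) : adj n true i = 1 := rfl
@[simp] theorem adj_false (i : Fin 3) : adj n false i = n i := rfl

/-- The sheets `e`, `e'` over the hemispheres `s`, `s'` have the same point over `z`. -/
def Glued (z : Sphere) (s : Bool) (e : ι) (s' : Bool) (e' : ι) : Prop :=
  (s = s' ∧ e = e') ∨ (∃ i, z ∈ arc i ∧ adj n s i e = adj n s' i e') ∨
    ∃ i, z = branchPt i ∧ (mon n i).SameCycle (adj n s i e) (adj n s' i e')

variable {n}

theorem mon_n (i : Fin 3) (e : ι) : mon n i (n i e) = n (i + 1) e := by simp [mon]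

theorem sameCycle_adj_succ (s : Bool) (i : Fin 3) (e : ι) :
    (mon n i).SameCycle (adj n s i e) (adj n s (i + 1) e) := by
  cases s
  · exact ⟨1, by simp [mon_n]⟩
  · exact Equiv.Perm.SameCycle.refl _ _

theorem fin_three_eq_or {i j : Fin 3} (h : j ≠ i + 2) : j = i ∨ j = i + 1 := by
  revert i j; decide

/-- The three clauses of `Glued` merge at a branch point: only the arcs `i` and `i + 1` end there,
and passing from one to the other moves a sheet by at most one step of the monodromy. -/
theorem glued_branchPt_iff {i : Fin 3} {s s' : Bool} {e e' : ι} :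
    Glued n (branchPt i) s e s' e' ↔ (mon n i).SameCycle (adj n s i e) (adj n s' i e') := by
  constructor
  · rintro (⟨rfl, rfl⟩ | ⟨j, hj, h⟩ | ⟨j, hj, h⟩)
    · exact Equiv.Perm.SameCycle.refl _ _
    · rcases fin_three_eq_or ((branchPt_mem_arc i j).1 hj) with rfl | rfl
      · rw [h]
      · refine (sameCycle_adj_succ s i e).trans ?_
        rw [h]
        exact (sameCycle_adj_succ s' i e').symm
    · rwa [branchPt_injective hj]
  · exact fun h => Or.inr (Or.inr ⟨i, rfl, h⟩)

theorem glued_arc_iff {i : Fin 3} {z : Sphere} (hz : z ∈ arc i) (hb : z ∉ Set.range branchPt)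
    {s s' : Bool} {e e' : ι} : Glued n z s e s' e' ↔ adj n s i e = adj n s' i e' := by
  constructor
  · rintro (⟨rfl, rfl⟩ | ⟨j, hj, h⟩ | ⟨j, rfl, h⟩)
    · rfl
    · obtain rfl : i = j := by
        by_contra hij
        exact hb (eq_branchPt_of_mem_arc hij hz hj)
      exact h
    · exact absurd ⟨j, rfl⟩ hb
  · exact fun h => Or.inr (Or.inl ⟨i, hz, h⟩)

theorem glued_iff_of_notMem_arc {z : Sphere} (hz : ∀ i, z ∉ arc i) {s s' : Bool} {e e' : ι} :
    Glued n z s e s' e' ↔ s = s' ∧ e = e' := by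
  constructor
  · rintro (h | ⟨j, hj, -⟩ | ⟨j, rfl, -⟩)
    · exact h
    · exact absurd hj (hz j)
    · exact absurd ((branchPt_mem_arc j j).2 (by clear hz; revert j; decide)) (hz j)
  · exact Or.inl

theorem branchPt_mem_arc_self (i : Fin 3) : branchPt i ∈ arc i :=
  (branchPt_mem_arc i i).2 (by revert i; decide)

theorem Glued.map {ι' : Type*} {n' : Fin 3 → Equiv.Perm ι'} (φ : ι → ι')
    (hφ : ∀ i e, φ (n i e) = n' i (φ e)) {z : Sphere} {s s' : Bool} {e e' : ι}
    (h : Glued n z s e s' e') : Glued n' z s (φ e) s' (φ e') := by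
  have hadj : ∀ s i e, φ (adj n s i e) = adj n' s i (φ e) := by
    intro s i e
    cases s <;> simp [hφ]
  have hmon : ∀ i e, φ (mon n i e) = mon n' i (φ e) := by
    intro i e
    obtain ⟨e, rfl⟩ := (n i).surjective e
    rw [mon_n, hφ, hφ, mon_n]
  rcases h with ⟨rfl, rfl⟩ | ⟨i, hi, h⟩ | ⟨i, hi, k, h⟩
  · exact Or.inl ⟨rfl, rfl⟩
  · exact Or.inr (Or.inl ⟨i, hi, by rw [← hadj, h, hadj]⟩)
  · refine Or.inr (Or.inr ⟨i, hi, k, ?_⟩)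
    rw [← hadj, ← hadj, ← h]
    have hinv : ∀ e, φ ((mon n i)⁻¹ e) = (mon n' i)⁻¹ (φ e) := by
      intro e
      rw [Equiv.Perm.eq_inv_iff_eq, ← hmon]
      simp
    generalize adj n s i e = x
    clear h
    induction k with
    | zero => simp
    | succ k ih => rw [add_comm, zpow_add, zpow_add, zpow_one, zpow_one, Equiv.Perm.mul_apply,
        Equiv.Perm.mul_apply, hmon, ih]
    | pred k ih => rw [sub_eq_neg_add, zpow_add, zpow_add, zpow_neg_one, zpow_neg_one,
        Equiv.Perm.mul_apply, Equiv.Perm.mul_apply, hinv, ih]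

theorem sameCycle_mem_iff {π : Equiv.Perm ι} {Q : Set ι} (hQ : ∀ e, π e ∈ Q ↔ e ∈ Q) {e e' : ι}
    (h : π.SameCycle e e') : e ∈ Q ↔ e' ∈ Q := by
  obtain ⟨k, rfl⟩ := h
  have hinv : ∀ e, π⁻¹ e ∈ Q ↔ e ∈ Q := fun e => by
    rw [← hQ]
    simp
  induction k with
  | zero => simp
  | succ k ih => rwa [add_comm, zpow_add, zpow_one, Equiv.Perm.mul_apply, hQ]
  | pred k ih => rwa [sub_eq_neg_add, zpow_add, zpow_neg_one, Equiv.Perm.mul_apply, hinv]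

/-- Gluing never leaves an orbit of the gluing permutations, which turns connectedness of the
surface into transitivity. -/
theorem Glued.mem_iff {Q : Set ι} (hQ : ∀ i e, n i e ∈ Q ↔ e ∈ Q) {z : Sphere} {s s' : Bool}
    {e e' : ι} (h : Glued n z s e s' e') : e ∈ Q ↔ e' ∈ Q := by
  have hadj : ∀ s i e, adj n s i e ∈ Q ↔ e ∈ Q := by
    intro s i e
    cases s <;> simp [hQ]
  have hmon : ∀ i e, mon n i e ∈ Q ↔ e ∈ Q := by
    intro i e
    obtain ⟨e, rfl⟩ := (n i).surjective e
    rw [mon_n, hQ, hQ]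
  rcases h with ⟨rfl, rfl⟩ | ⟨i, hi, h⟩ | ⟨i, hi, h⟩
  · rfl
  · rw [← hadj s i e, h, hadj]
  · rw [← hadj s i e, sameCycle_mem_iff (hmon i) h, hadj]

end Gluing

/-- A decomposition of a branched covering of the sphere in hemispheres, with gluing permutations
`n i` along the three arcs. -/
structure Sheeting {S : Type*} [TopologicalSpace S] (f : S → Sphere) (ι : Type*)
    (n : Fin 3 → Equiv.Perm ι) where
  sheet : Bool → ι → Sphere → S
  cont : ∀ s e, ContinuousOn (sheet s e) (hemi s)
  proj : ∀ s e, ∀ z ∈ hemi s, f (sheet s e z) = z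
  bij : ∀ s, ∀ z ∈ hemi s, z ∉ Set.range branchPt → ∀ p, f p = z → ∃! e, sheet s e z = p
  glue : ∀ i e, ∀ z ∈ arc i, sheet false e z = sheet true (n i e) z

theorem mem_closure_preimage_openHemi {np nm : ℕ} (D : Dessin np nm) {s : Bool} {p : D.S}
    (hp : D.f p ∈ hemi s) : p ∈ closure (D.f ⁻¹' openHemi s) :=
  D.isOpenMap_f.preimage_closure_subset_closure_preimage (hemi_subset_closure s hp)

theorem openHemi_nonempty (s : Bool) : (openHemi s).Nonempty :=
  closure_nonempty_iff.1 ⟨_, hemi_subset_closure s (branchPt_mem_hemi 0 s)⟩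

/-- A continuous map which coincides pointwise with one of finitely many continuous maps, pairwise
distinct at every point, coincides with one of them. -/
theorem eqOn_of_isPreconnected {Y S ι : Type*} [TopologicalSpace Y] [TopologicalSpace S] [T2Space S]
    [Finite ι] {M : Set Y} (hM : IsPreconnected M) {g : Y → S} (hg : ContinuousOn g M)
    {h : ι → Y → S} (hh : ∀ e, ContinuousOn (h e) M) (hgh : ∀ z ∈ M, ∃ e, g z = h e z)
    (hinj : ∀ z ∈ M, ∀ e e', h e z = h e' z → e = e') {z₀ : Y} (hz₀ : z₀ ∈ M) {e : ι}
    (he : g z₀ = h e z₀) : Set.EqOn g (h e) M := by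
  choose idx hidx using fun z : M => hgh z z.2
  have hfib : ∀ x, idx ⁻¹' {x} = {z : M | g z = h x z} := fun x => by
    ext z
    exact ⟨fun hz => (show idx z = x from hz) ▸ hidx z,
      fun hz => hinj z z.2 _ _ ((hidx z).symm.trans hz)⟩
  have hcl : ∀ x, IsClosed (idx ⁻¹' {x}) := fun x => by
    rw [hfib]
    exact isClosed_eq (continuousOn_iff_continuous_domRestrict.1 hg)
      (continuousOn_iff_continuous_domRestrict.1 (hh x))
  -- The fibres of `idx` are closed and finite in number, so every preimage under `idx` is closed,
  -- hence also open.
  have hloc : IsLocallyConstant idx := by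
    intro Q
    rw [← isClosed_compl_iff, ← Set.preimage_compl, ← Set.biUnion_preimage_singleton]
    exact (Set.toFinite _).isClosed_biUnion fun x _ => hcl x
  have := isPreconnected_iff_preconnectedSpace.1 hM
  intro z hz
  have h1 := hloc.apply_eq_of_isPreconnected isPreconnected_univ (x := ⟨z, hz⟩) (y := ⟨z₀, hz₀⟩)
    trivial trivial
  have h2 : idx ⟨z₀, hz₀⟩ = e := hinj z₀ hz₀ _ _ ((hidx ⟨z₀, hz₀⟩).symm.trans he)
  rw [← h2, ← h1]
  exact hidx ⟨z, hz⟩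

theorem isCompact_hemi (s : Bool) : IsCompact (hemi s) := (isClosed_hemi s).isCompact

/-! ### Points, ramification and isomorphisms read off from a sheeting -/

namespace Sheeting

variable {np nm : ℕ} {D : Dessin np nm} {ι : Type*} {n : Fin 3 → Equiv.Perm ι}
  (σ : Sheeting D.f ι n)
include σ

theorem sheet_adj {i : Fin 3} {z : Sphere} (hz : z ∈ arc i) (s : Bool) (e : ι) :
    σ.sheet true (adj n s i e) z = σ.sheet s e z := by
  cases s
  · exact (σ.glue i e z hz).symm
  · rfl

theorem sheet_mon (i : Fin 3) (e : ι) :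
    σ.sheet true (mon n i e) (branchPt i) = σ.sheet true e (branchPt i) := by
  obtain ⟨e, rfl⟩ := (n i).surjective e
  rw [mon_n, ← σ.glue _ _ _ (branchPt_mem_arc_self i), ← σ.glue _ _ _
    ((branchPt_mem_arc i (i + 1)).2 (by revert i; decide))]

theorem sheet_eq_of_sameCycle {i : Fin 3} {e e' : ι} (h : (mon n i).SameCycle e e') :
    σ.sheet true e (branchPt i) = σ.sheet true e' (branchPt i) :=
  ((sameCycle_mem_iff (Q := {x | σ.sheet true x (branchPt i) = σ.sheet true e (branchPt i)})
    (fun x => by simp [σ.sheet_mon]) h).1 rfl).symm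

theorem sheet_injective {s : Bool} {z : Sphere} (hz : z ∈ hemi s) (hb : z ∉ Set.range branchPt)
    {e e' : ι} (h : σ.sheet s e z = σ.sheet s e' z) : e = e' :=
  (σ.bij s z hz hb _ (σ.proj s e z hz)).unique rfl h.symm

theorem sheet_eq_of_glued {z : Sphere} {s s' : Bool} {e e' : ι} (h : Glued n z s e s' e') :
    σ.sheet s e z = σ.sheet s' e' z := by
  rcases h with ⟨rfl, rfl⟩ | ⟨i, hi, h⟩ | ⟨i, rfl, h⟩
  · rfl
  · rw [← σ.sheet_adj hi, h, σ.sheet_adj hi]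
  · have hi := branchPt_mem_arc_self i
    rw [← σ.sheet_adj hi, σ.sheet_eq_of_sameCycle h, σ.sheet_adj hi]

theorem glued_of_sheet_eq_of_notMem {z : Sphere} {s s' : Bool} {e e' : ι} (hs : z ∈ hemi s)
    (hs' : z ∈ hemi s') (hb : z ∉ Set.range branchPt) (h : σ.sheet s e z = σ.sheet s' e' z) :
    Glued n z s e s' e' := by
  by_cases hss : s = s'
  · subst hss
    exact Or.inl ⟨rfl, σ.sheet_injective hs hb h⟩
  · obtain ⟨i, hi⟩ : ∃ i, z ∈ arc i := by
      cases s <;> cases s' <;> first | exact absurd rfl hss | skip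
      · exact mem_arc_of_mem_hemi hs' hs
      · exact mem_arc_of_mem_hemi hs hs'
    rw [glued_arc_iff hi hb]
    rw [← σ.sheet_adj hi, ← σ.sheet_adj hi s'] at h
    exact σ.sheet_injective (arc_subset_hemi i _ hi) hb h

theorem isClosed_image (s : Bool) (e : ι) {C : Set Sphere} (hC : IsClosed C) :
    IsClosed (σ.sheet s e '' (hemi s ∩ C)) :=
  (((isCompact_hemi s).inter_right hC).image_of_continuousOn
    ((σ.cont s e).mono Set.inter_subset_left)).isClosed

variable [Finite ι]

/-- The field `bij` says nothing over branch points. There, one uses that the finitely many sheets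
have closed union, and that the preimage of the open hemisphere, which they cover, has `p` in its
closure. -/
theorem exists_sheet {s : Bool} {p : D.S} (hp : D.f p ∈ hemi s) :
    ∃ e, σ.sheet s e (D.f p) = p := by
  have hcl : IsClosed (⋃ e, σ.sheet s e '' (hemi s ∩ Set.univ)) :=
    isClosed_iUnion_of_finite fun e => σ.isClosed_image s e isClosed_univ
  have hsub : D.f ⁻¹' openHemi s ⊆ ⋃ e, σ.sheet s e '' (hemi s ∩ Set.univ) := by
    intro q hq
    obtain ⟨e, he, -⟩ := σ.bij s _ (openHemi_subset_hemi s hq)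
      (notMem_branchPt_of_mem_openHemi hq) q rfl
    exact Set.mem_iUnion.2 ⟨e, _, ⟨openHemi_subset_hemi s hq, trivial⟩, he⟩
  obtain ⟨e, z, ⟨hz, -⟩, rfl⟩ := Set.mem_iUnion.1
    (closure_minimal hsub hcl (mem_closure_preimage_openHemi D hp))
  exact ⟨e, by rw [σ.proj s e z hz]⟩

theorem exists_sheet' (p : D.S) : ∃ s e, D.f p ∈ hemi s ∧ σ.sheet s e (D.f p) = p := by
  rcases mem_hemi_or (D.f p) with h | h <;> exact ⟨_, _, h, (σ.exists_sheet h).choose_spec⟩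

/-- The union of a set of upper and a set of lower sheets. -/
def region (Q : Bool → Set ι) : Set D.S :=
  {p | ∃ s, ∃ e ∈ Q s, ∃ z ∈ hemi s, σ.sheet s e z = p}

theorem isClosed_region (Q : Bool → Set ι) : IsClosed (σ.region Q) := by
  have h : σ.region Q = ⋃ s, ⋃ e : Q s, σ.sheet s e '' (hemi s ∩ Set.univ) := by
    ext p
    simp [region]
  rw [h]
  exact isClosed_iUnion_of_finite fun s => isClosed_iUnion_of_finite fun e =>
    σ.isClosed_image s e isClosed_univ

theorem mem_region_or (Q : Bool → Set ι) (p : D.S) :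
    p ∈ σ.region Q ∨ p ∈ σ.region (fun s => (Q s)ᶜ) := by
  obtain ⟨s, e, hz, he⟩ := σ.exists_sheet' p
  by_cases h : e ∈ Q s
  · exact Or.inl ⟨s, e, h, _, hz, he⟩
  · exact Or.inr ⟨s, e, h, _, hz, he⟩

/-- The two regions are closed and cover the surface, so a connected set on which they are disjoint
lies in one of them. -/
theorem subset_region_or {M : Set D.S} (hM : IsPreconnected M) (Q : Bool → Set ι)
    (hQ : ∀ p ∈ M, p ∈ σ.region Q → p ∉ σ.region (fun s => (Q s)ᶜ)) :
    M ⊆ σ.region Q ∨ M ⊆ σ.region (fun s => (Q s)ᶜ) := by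
  by_contra! h
  obtain ⟨⟨a, ha, ha'⟩, b, hb, hb'⟩ := And.imp Set.not_subset.1 Set.not_subset.1 h
  obtain ⟨p, hp, h1, h2⟩ := isPreconnected_closed_iff.1 hM _ _ (σ.isClosed_region Q)
    (σ.isClosed_region _) (fun p _ => σ.mem_region_or Q p)
    ⟨b, hb, (σ.mem_region_or Q b).resolve_right hb'⟩
    ⟨a, ha, (σ.mem_region_or Q a).resolve_left ha'⟩
  exact hQ p hp h1 h2

/-- Over a neighbourhood of a branch point which misses the opposite arc, the sheets of a cycle of
the monodromy and the other sheets are disjoint away from the branch point. -/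
theorem sameCycle_of_sheet_eq {i : Fin 3} {e e' : ι}
    (h : σ.sheet true e (branchPt i) = σ.sheet true e' (branchPt i)) :
    (mon n i).SameCycle e e' := by
  set p := σ.sheet true e (branchPt i) with hp
  have hfp : D.f p = branchPt i := σ.proj _ _ _ (branchPt_mem_hemi i true)
  obtain ⟨k, hk⟩ := D.ramified p
  have hV : D.f ⁻¹' (arc (i + 2))ᶜ ∈ 𝓝 p := by
    refine ((isClosed_arc _).isOpen_compl.preimage D.continuous_f).mem_nhds ?_
    rw [Set.mem_preimage, hfp]
    exact fun h => (branchPt_mem_arc i (i + 2)).1 h rfl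
  obtain ⟨N, hNo, hpN, hNV, hNc, hN, -, -⟩ := hk.exists_nhd hV
  -- The sheets, upper or lower, of the monodromy cycle of `e`. Since `N` avoids the arc `i + 2`,
  -- crossing an arc inside `N` stays in the cycle, so the connected set `N \ {p}` cannot meet both
  -- these sheets and the others.
  let Q : Bool → Set ι := fun s => {x | (mon n i).SameCycle e (adj n s i x)}
  have hb : ∀ q ∈ N \ {p}, D.f q ∉ Set.range branchPt := by
    rintro q ⟨hq, hne⟩ ⟨j, hj⟩
    rcases eq_or_ne j i with rfl | hji
    · exact hne (hN q hq (by rw [← hj, hfp]))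
    · refine hNV hq ?_
      rw [← hj, branchPt_mem_arc]
      exact fun h => hji (by clear * - h; revert i j; decide)
  have hdisj : ∀ q ∈ N \ {p}, q ∈ σ.region Q → q ∉ σ.region (fun s => (Q s)ᶜ) := by
    rintro q hq ⟨s, x, hx, z, hz, rfl⟩ ⟨s', x', hx', z', hz', hqq⟩
    have hbq := hb _ hq
    have hNq := hNV hq.1
    have hzz : z' = z := by rw [← σ.proj s' x' z' hz', hqq, σ.proj s x z hz]
    subst hzz
    rw [Set.mem_preimage, σ.proj s x z' hz] at hNq
    rw [σ.proj s x z' hz] at hbq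
    have hg := σ.glued_of_sheet_eq_of_notMem hz' hz hbq hqq
    by_cases har : ∃ j, z' ∈ arc j
    · obtain ⟨j, hj⟩ := har
      rw [glued_arc_iff hj hbq] at hg
      have hji : j ≠ i + 2 := by rintro rfl; exact hNq hj
      rcases fin_three_eq_or hji with rfl | rfl
      · exact hx' (by change Equiv.Perm.SameCycle _ _ _; rw [hg]; exact hx)
      · refine hx' (Equiv.Perm.SameCycle.trans hx ?_)
        refine (sameCycle_adj_succ s i x).trans ?_
        rw [← hg]
        exact (sameCycle_adj_succ s' i x').symm
    · push Not at har
      obtain ⟨rfl, rfl⟩ := (glued_iff_of_notMem_arc har).1 hg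
      exact hx' hx
  -- A sheet whose corner is `p` really enters the punctured neighbourhood: approach the branch
  -- point through the open hemisphere.
  have hmem : ∀ x, σ.sheet true x (branchPt i) = p → ∃ z ∈ hemi true, σ.sheet true x z ∈ N \ {p} := by
    intro x hx
    have hcl := hemi_subset_closure true (branchPt_mem_hemi i true)
    have := mem_closure_iff_nhdsWithin_neBot.1 hcl
    have ht : Tendsto (σ.sheet true x) (𝓝[openHemi true] (branchPt i)) (𝓝 p) :=
      hx ▸ ((σ.cont true x) _ (branchPt_mem_hemi i true)).mono (openHemi_subset_hemi true)
    obtain ⟨z, hzN, hz⟩ := ((ht.eventually (hNo.mem_nhds hpN)).and self_mem_nhdsWithin).exists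
    refine ⟨z, openHemi_subset_hemi _ hz, hzN, fun hzp => ?_⟩
    refine notMem_branchPt_of_mem_openHemi hz ⟨i, ?_⟩
    rw [← hfp, ← show σ.sheet true x z = p from hzp, σ.proj _ _ _ (openHemi_subset_hemi _ hz)]
  obtain ⟨z, hz, hzN⟩ := hmem e rfl
  obtain ⟨z', hz', hzN'⟩ := hmem e' h.symm
  by_contra hcon
  have h1 : σ.sheet true e z ∈ σ.region Q :=
    ⟨true, e, Equiv.Perm.SameCycle.refl _ _, z, hz, rfl⟩
  have h2 : σ.sheet true e' z' ∈ σ.region (fun s => (Q s)ᶜ) := ⟨true, e', hcon, z', hz', rfl⟩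
  rcases σ.subset_region_or hNc Q hdisj with hs | hs
  · exact hdisj _ hzN' (hs hzN') h2
  · exact hdisj _ hzN h1 (hs hzN)

theorem sheet_branchPt_eq_iff {i : Fin 3} {e e' : ι} :
    σ.sheet true e (branchPt i) = σ.sheet true e' (branchPt i) ↔ (mon n i).SameCycle e e' :=
  ⟨σ.sameCycle_of_sheet_eq, σ.sheet_eq_of_sameCycle⟩

/-- The combinatorial relation `Glued` describes all coincidences of sheets, so the permutations
determine the surface up to isomorphism. Only the branch points need the connectedness of punctured
neighbourhoods; elsewhere sheets are disjoint within a hemisphere. -/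
theorem sheet_eq_iff {z : Sphere} {s s' : Bool} {e e' : ι} (hs : z ∈ hemi s)
    (hs' : z ∈ hemi s') : σ.sheet s e z = σ.sheet s' e' z ↔ Glued n z s e s' e' := by
  refine ⟨fun h => ?_, σ.sheet_eq_of_glued⟩
  by_cases hb : z ∈ Set.range branchPt
  · obtain ⟨i, rfl⟩ := hb
    rw [glued_branchPt_iff]
    have hi := branchPt_mem_arc_self i
    rw [← σ.sheet_adj hi, ← σ.sheet_adj hi s'] at h
    exact σ.sameCycle_of_sheet_eq h
  · exact σ.glued_of_sheet_eq_of_notMem hs hs' hb h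

/-- Count the points near `p` over a nearby point of the open upper hemisphere: there are `k` of
them by the local model, and one for each upper sheet with corner `p`. In particular the index is
unique over a branch point. -/
theorem hasRamificationIndex_eq {i : Fin 3} {p : D.S} (hp : D.f p = branchPt i) {k : ℕ}
    (hk : HasRamificationIndex D.f p k) :
    k = Nat.card {e // σ.sheet true e (branchPt i) = p} := by
  obtain ⟨V, hV, hVcl, hVp⟩ : ∃ V ∈ 𝓝 p, IsClosed V ∧
      ∀ e, σ.sheet true e (branchPt i) ∈ V → σ.sheet true e (branchPt i) = p := by
    have hfin : (Set.range fun e => σ.sheet true e (branchPt i)).Finite := Set.finite_range _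
    have hW : ((Set.range fun e => σ.sheet true e (branchPt i)) \ {p})ᶜ ∈ 𝓝 p :=
      (hfin.subset Set.sdiff_subset).isClosed.isOpen_compl.mem_nhds (by simp)
    obtain ⟨V, hV, hVcl, hVW⟩ := exists_mem_nhds_isClosed_subset hW
    refine ⟨V, hV, hVcl, fun e he => ?_⟩
    by_contra hne
    exact hVW he ⟨⟨e, rfl⟩, hne⟩
  obtain ⟨N, hNo, hpN, hNV, -, -, hNf, hcard⟩ := hk.exists_nhd hV
  have := mem_closure_iff_nhdsWithin_neBot.1 (hemi_subset_closure true (branchPt_mem_hemi i true))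
  -- Near the branch point a sheet is inside `N` exactly if its corner is `p`; the closed
  -- neighbourhood `V` excludes the other, finitely many, corners.
  have hev : ∀ e, ∀ᶠ z in 𝓝[openHemi true] (branchPt i),
      (σ.sheet true e z ∈ N ↔ σ.sheet true e (branchPt i) = p) := by
    intro e
    have ht : Tendsto (σ.sheet true e) (𝓝[openHemi true] (branchPt i))
        (𝓝 (σ.sheet true e (branchPt i))) :=
      ((σ.cont true e) _ (branchPt_mem_hemi i true)).mono (openHemi_subset_hemi true)
    by_cases he : σ.sheet true e (branchPt i) = p
    · rw [he] at ht
      filter_upwards [ht (hNo.mem_nhds hpN)] with z hz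
      simp only [he, iff_true]
      exact hz
    · filter_upwards [ht (hVcl.isOpen_compl.mem_nhds fun h => he (hVp e h))] with z hz
      simp only [he, iff_false]
      exact fun h => hz (hNV h)
  rw [hp] at hNf
  obtain ⟨z, ⟨hz1, hz2⟩, hz⟩ := (((eventually_all.2 hev).and
    (mem_nhdsWithin_of_mem_nhds hNf)).and self_mem_nhdsWithin).exists
  have hzh := openHemi_subset_hemi _ hz
  have hzb := notMem_branchPt_of_mem_openHemi hz
  rw [← hcard z hz2 (fun h => hzb ⟨i, by rw [← hp, h]⟩)]
  symm
  refine Nat.card_congr (Equiv.ofBijective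
    (fun e => ⟨σ.sheet true e.1 z, (hz1 e.1).2 e.2, σ.proj _ _ _ hzh⟩) ⟨?_, ?_⟩)
  · intro e e' h
    exact Subtype.ext (σ.sheet_injective hzh hzb (Subtype.ext_iff.1 h))
  · rintro ⟨y, hyN, hy⟩
    obtain ⟨e, rfl, -⟩ := σ.bij true z hzh hzb y hy
    exact ⟨⟨e, (hz1 e).1 hyN⟩, rfl⟩

theorem existsUnique_eqOn {s : Bool} {g : Sphere → D.S} (hg : ContinuousOn g (hemi s))
    (hfg : ∀ z ∈ hemi s, D.f (g z) = z) : ∃! e, Set.EqOn g (σ.sheet s e) (hemi s) := by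
  obtain ⟨z₀, hz₀⟩ := openHemi_nonempty s
  have hsub := openHemi_subset_hemi s
  have hb : ∀ z ∈ openHemi s, z ∉ Set.range branchPt :=
    fun z hz => notMem_branchPt_of_mem_openHemi hz
  obtain ⟨e, he, huniq⟩ := σ.bij s z₀ (hsub hz₀) (hb _ hz₀) (g z₀) (hfg _ (hsub hz₀))
  refine ⟨e, ?_, fun e' he' => huniq e' (he' (hsub hz₀)).symm⟩
  refine Set.EqOn.of_subset_closure ?_ hg (σ.cont s e) hsub (hemi_subset_closure s)
  refine eqOn_of_isPreconnected (isPreconnected_openHemi s) (hg.mono hsub)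
    (fun x => (σ.cont s x).mono hsub) (fun z hz => ?_)
    (fun z hz x y h => σ.sheet_injective (hsub hz) (hb z hz) h) hz₀ he.symm
  obtain ⟨x, hx, -⟩ := σ.bij s z (hsub hz) (hb z hz) _ (hfg _ (hsub hz))
  exact ⟨x, hx.symm⟩

/-- The gluing permutations act transitively on the sheets of a connected covering. -/
theorem eq_univ_of_invariant {Q : Set ι} (hQ : ∀ i e, n i e ∈ Q ↔ e ∈ Q) (hne : Q.Nonempty) :
    Q = Set.univ := by
  have hdisj : ∀ p ∈ (Set.univ : Set D.S), p ∈ σ.region (fun _ => Q) →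
      p ∉ σ.region (fun s => ((fun _ => Q) s)ᶜ) := by
    rintro _ - ⟨s, e, he, z, hz, rfl⟩ ⟨s', e', he', z', hz', hqq⟩
    have hzz : z' = z := by rw [← σ.proj s' e' z' hz', hqq, σ.proj s e z hz]
    subst hzz
    exact he' ((((σ.sheet_eq_iff hz' hz).1 hqq).mem_iff hQ).2 he)
  have hz := branchPt_mem_hemi 0 true
  by_contra hcon
  obtain ⟨e', he'⟩ := (Set.ne_univ_iff_exists_notMem Q).1 hcon
  obtain ⟨e, he⟩ := hne
  rcases σ.subset_region_or isPreconnected_univ (fun _ => Q) hdisj with h | h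
  · exact hdisj _ trivial (h trivial) ⟨true, e', he', _, hz, rfl⟩
  · exact hdisj _ trivial ⟨true, e, he, _, hz, rfl⟩ (h trivial)

/-- Choosing a sheet through each point defines the map; `sheet_eq_iff` and `Glued.map` make the
choice irrelevant. It is continuous because the preimage of a closed set is a finite union of images
of closed subsets of hemispheres. -/
theorem exists_continuous {D' : Dessin np nm} {ι' : Type*} {n' : Fin 3 → Equiv.Perm ι'}
    (σ' : Sheeting D'.f ι' n') (φ : ι → ι') (hφ : ∀ i e, φ (n i e) = n' i (φ e)) :
    ∃ h : D.S → D'.S, Continuous h ∧ ∀ s e, ∀ z ∈ hemi s,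
      h (σ.sheet s e z) = σ'.sheet s (φ e) z := by
  choose s e hz he using σ.exists_sheet'
  have key : ∀ t x, ∀ z ∈ hemi t, σ'.sheet (s (σ.sheet t x z)) (φ (e (σ.sheet t x z)))
      (D.f (σ.sheet t x z)) = σ'.sheet t (φ x) z := by
    intro t x z hzt
    have h1 := hz (σ.sheet t x z)
    have h2 := he (σ.sheet t x z)
    rw [σ.proj _ _ _ hzt] at h1 h2 ⊢
    exact σ'.sheet_eq_of_glued (((σ.sheet_eq_iff h1 hzt).1 h2).map φ hφ)
  refine ⟨fun p => σ'.sheet (s p) (φ (e p)) (D.f p), ?_, key⟩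
  rw [continuous_iff_isClosed]
  intro C hC
  have hpre : (fun p => σ'.sheet (s p) (φ (e p)) (D.f p)) ⁻¹' C =
      ⋃ t, ⋃ x, σ.sheet t x '' (hemi t ∩ σ'.sheet t (φ x) ⁻¹' C) := by
    ext p
    simp only [Set.mem_preimage, Set.mem_iUnion]
    constructor
    · intro hp
      exact ⟨s p, e p, D.f p, ⟨hz p, hp⟩, he p⟩
    · rintro ⟨t, x, z, ⟨hzt, hzC⟩, rfl⟩
      rw [key t x z hzt]
      exact hzC
  rw [hpre]
  refine isClosed_iUnion_of_finite fun t => isClosed_iUnion_of_finite fun x => ?_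
  have h1 := (σ'.cont t (φ x)).preimage_isClosed_of_isClosed (isClosed_hemi t) hC
  have h2 := σ.isClosed_image t x h1
  rwa [← Set.inter_assoc, Set.inter_self] at h2

theorem exists_homeomorph {D' : Dessin np nm} {ι' : Type*} [Finite ι']
    {n' : Fin 3 → Equiv.Perm ι'} (σ' : Sheeting D'.f ι' n') (φ : ι ≃ ι')
    (hφ : ∀ i e, φ (n i e) = n' i (φ e)) :
    ∃ h : D.S ≃ₜ D'.S, (∀ p, D'.f (h p) = D.f p) ∧ ∀ s e, ∀ z ∈ hemi s,
      h (σ.sheet s e z) = σ'.sheet s (φ e) z := by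
  obtain ⟨h, hc, hh⟩ := σ.exists_continuous σ' φ hφ
  obtain ⟨h', hc', hh'⟩ := σ'.exists_continuous σ φ.symm (fun i e => by
    rw [Equiv.symm_apply_eq, hφ, Equiv.apply_symm_apply])
  refine ⟨⟨⟨h, h', fun p => ?_, fun p => ?_⟩, hc, hc'⟩, fun p => ?_, hh⟩
  · obtain ⟨s, e, hz, he⟩ := σ.exists_sheet' p
    rw [← he, hh _ _ _ hz, hh' _ _ _ hz, Equiv.symm_apply_apply]
  · obtain ⟨s, e, hz, he⟩ := σ'.exists_sheet' p
    rw [← he, hh' _ _ _ hz, hh _ _ _ hz, Equiv.apply_symm_apply]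
  · obtain ⟨s, e, hz, he⟩ := σ.exists_sheet' p
    change D'.f (h p) = _
    conv_lhs => rw [← he, hh _ _ _ hz, σ'.proj _ _ _ hz]

end Sheeting

/-! ## Existence of the decomposition in hemispheres -/

namespace Dessin

variable {np nm : ℕ} (D : Dessin np nm)

/-- A complete family of sections over an open hemisphere extends to the closed hemisphere. -/
theorem exists_extension {ι : Type*} [Finite ι] {s : Bool} {g : ι → Sphere → D.S}
    (hg : ∀ e, ContinuousOn (g e) (openHemi s)) (hfg : ∀ e, ∀ z ∈ openHemi s, D.f (g e z) = z)
    (hbij : ∀ z ∈ openHemi s, ∀ p, D.f p = z → ∃! e, g e z = p) :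
    ∃ G : ι → Sphere → D.S, (∀ e, ContinuousOn (G e) (hemi s)) ∧
      (∀ e, Set.EqOn (G e) (g e) (openHemi s)) ∧ (∀ e, ∀ z ∈ hemi s, D.f (G e z) = z) ∧
      ∀ z ∈ hemi s, z ∉ Set.range branchPt → ∀ p, D.f p = z → ∃! e, G e z = p := by
  have hsub := openHemi_subset_hemi s
  have hlim : ∀ e, ∀ z ∈ hemi s, ∃ p, D.f p = z ∧ Tendsto (g e) (𝓝[openHemi s] z) (𝓝 p) := by
    intro e z hz
    have := mem_closure_iff_nhdsWithin_neBot.1 (hemi_subset_closure s hz)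
    refine D.exists_tendsto ?_ fun A hA => ?_
    · refine Tendsto.congr' ?_ (tendsto_id.mono_left (nhdsWithin_le_nhds (s := openHemi s)))
      exact eventually_nhdsWithin_of_forall fun y hy => (hfg e y hy).symm
    · obtain ⟨B, hB, hBA, hBs, hBc⟩ := exists_isPreconnected_mem_nhdsWithin z hA
      exact ⟨B, hB, hBA, hBc.image _ ((hg e).mono hBs)⟩
  have hcont : ∀ e, ContinuousOn (extendFrom (openHemi s) (g e)) (hemi s) := fun e =>
    continuousOn_extendFrom (hemi_subset_closure s) fun z hz => (hlim e z hz).imp fun _ h => h.2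
  have heq : ∀ e, Set.EqOn (extendFrom (openHemi s) (g e)) (g e) (openHemi s) := fun e =>
    extendFrom_extends (hg e)
  have hproj : ∀ e, ∀ z ∈ hemi s, D.f (extendFrom (openHemi s) (g e) z) = z := by
    intro e z hz
    obtain ⟨p, hp, hl⟩ := hlim e z hz
    rw [extendFrom_eq (hemi_subset_closure s hz) hl, hp]
  refine ⟨fun e => extendFrom (openHemi s) (g e), hcont, heq, hproj, ?_⟩
  rintro z hz hb p rfl
  have hcl : IsClosed (⋃ e, extendFrom (openHemi s) (g e) '' hemi s) :=
    isClosed_iUnion_of_finite fun e =>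
      ((isCompact_hemi s).image_of_continuousOn (hcont e)).isClosed
  have hcov : D.f ⁻¹' openHemi s ⊆ ⋃ e, extendFrom (openHemi s) (g e) '' hemi s := by
    intro q hq
    obtain ⟨e, he, -⟩ := hbij _ hq q rfl
    exact Set.mem_iUnion.2 ⟨e, _, hsub hq, by rw [heq e hq, he]⟩
  obtain ⟨e, y, hy, hey⟩ := Set.mem_iUnion.1
    (closure_minimal hcov hcl (mem_closure_preimage_openHemi D hz))
  obtain rfl : D.f p = y := by rw [← hey, hproj e y hy]
  refine ⟨e, hey, fun e' he' => ?_⟩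
  -- Two sheets which tend to the unramified point `p` both enter a chart on which `D.f` is
  -- injective, hence agree at a point of the open hemisphere.
  obtain ⟨φ, hp, hφ⟩ := (D.hasRamificationIndex_one hb).exists_openPartialHomeomorph
  have := mem_closure_iff_nhdsWithin_neBot.1 (hemi_subset_closure s hz)
  have hev : ∀ x, extendFrom (openHemi s) (g x) (D.f p) = p →
      ∀ᶠ y in 𝓝[openHemi s] (D.f p), g x y ∈ φ.source := by
    intro x hx
    have h1 := ((hcont x) _ hz).mono hsub
    rw [ContinuousWithinAt, hx] at h1
    filter_upwards [h1.eventually (φ.open_source.mem_nhds hp), self_mem_nhdsWithin] with y hy1 hy2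
    rwa [heq x hy2] at hy1
  obtain ⟨y, ⟨hy1, hy2⟩, hy⟩ := (((hev e hey).and (hev e' he')).and self_mem_nhdsWithin).exists
  have h2 : g e' y = g e y := φ.injOn hy2 hy1 (by
    rw [← hφ hy2, ← hφ hy1, hfg _ _ hy, hfg _ _ hy])
  exact (hbij y hy _ (hfg e y hy)).unique h2 rfl

/-- The centre of a hemisphere. -/
def _root_.OrientedRibbon.centre (s : Bool) : ℂ := side s * Complex.I

theorem _root_.OrientedRibbon.centre_mem (s : Bool) : (centre s : Sphere) ∈ openHemi s := by
  rw [coe_mem_openHemi]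
  simp [centre, side_mul_self]

/-- An open hemisphere is convex in the affine coordinate and contains no branch point, so its
inclusion lifts uniquely through the covering from each point over its centre. -/
theorem exists_sections (s : Bool) :
    ∃ g : {p : D.S // D.f p = (centre s : Sphere)} → Sphere → D.S,
      (∀ e, ContinuousOn (g e) (openHemi s)) ∧ (∀ e, ∀ z ∈ openHemi s, D.f (g e z) = z) ∧
      ∀ z ∈ openHemi s, ∀ p, D.f p = z → ∃! e, g e z = p := by
  let A := {w : ℂ // 0 < side s * w.im}
  have hc : 0 < side s * (centre s).im := coe_mem_openHemi.1 (centre_mem s)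
  have : ContractibleSpace A := (convex_half s).contractibleSpace ⟨_, hc⟩
  have : LocallyPathConnectedSpace A := (isOpen_half s).locallyPathConnectedSpace
  let f : C(A, Sphere) := ⟨fun w => (w.1 : Sphere), OnePoint.continuous_coe.comp (by fun_prop)⟩
  have hs : ∀ a, f a ∈ (Set.range branchPt)ᶜ := fun a =>
    notMem_branchPt_of_mem_openHemi (coe_mem_openHemi.2 a.2)
  have hlift := fun (a : A) (p : D.S) (h : D.f p = f a) =>
    D.isCoveringMapOn_f.existsUnique_continuousMap_lifts f h hs
  let c : A := ⟨centre s, hc⟩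
  choose F hF hFu using fun e : {p : D.S // D.f p = (centre s : Sphere)} => hlift c e.1 e.2
  have : Nonempty A := ⟨c⟩
  have hfinj : Function.Injective f := fun a b h => Subtype.ext (OnePoint.coe_injective h)
  -- A left inverse of the inclusion, arbitrary off the hemisphere, turns the lifts into functions
  -- on the whole sphere.
  obtain ⟨w, hw⟩ : ∃ w : Sphere → A, ∀ a, w (f a) = a :=
    ⟨Function.invFun f, Function.leftInverse_invFun hfinj⟩
  have hmem : ∀ z ∈ openHemi s, ∃ a, f a = z := by
    rintro _ ⟨x, hx, rfl⟩
    exact ⟨⟨x, hx⟩, rfl⟩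
  refine ⟨fun e z => F e (w z), fun e => ?_, fun e z hz => ?_, fun z hz p hp => ?_⟩
  · rintro _ ⟨x, hx, rfl⟩
    rw [ContinuousWithinAt, openHemi, OnePoint.nhdsWithin_coe_image, tendsto_map'_iff]
    have h1 : Tendsto (fun y : A => F e y) (𝓝 ⟨x, hx⟩) (𝓝 (F e ⟨x, hx⟩)) :=
      (F e).continuous.tendsto _
    rw [← congrArg (F e) (hw ⟨x, hx⟩)] at h1
    rw [nhdsWithin_eq_map_subtype_coe hx, tendsto_map'_iff]
    refine h1.congr fun y => ?_
    exact congrArg (F e) (hw y).symm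
  · obtain ⟨a, rfl⟩ := hmem z hz
    change D.f (F e (w (f a))) = f a
    rw [hw]
    exact congrFun (hF e).2 a
  · obtain ⟨a, rfl⟩ := hmem z hz
    obtain ⟨G, ⟨hG1, hG2⟩, hGu⟩ := hlift a p hp
    have hGc : D.f (G c) = (centre s : Sphere) := congrFun hG2 c
    refine ⟨⟨G c, hGc⟩, ?_, fun e he => ?_⟩
    · change F _ (w (f a)) = p
      rw [hw, ← hFu ⟨G c, hGc⟩ G ⟨rfl, hG2⟩, hG1]
    · change F e (w (f a)) = p at he
      rw [hw] at he
      have := hGu (F e) ⟨he, (hF e).2⟩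
      exact Subtype.ext ((hF e).1.symm.trans (congrArg (fun H : C(A, D.S) => H c) this))

/-- The upper sheets. -/
abbrev UpperSheet : Type := {p : D.S // D.f p = (centre true : Sphere)}

instance (z : Sphere) : Finite {p : D.S // D.f p = z} := (D.finite_fiber z).to_subtype

/-- Every closed hemisphere lifts, by extension from its interior. Over a connected open arc, the
upper sheet which a lower sheet meets cannot change, which gives one bijection `N i` per arc. -/
theorem exists_sheeting : ∃ n : Fin 3 → Equiv.Perm D.UpperSheet, n 0 = 1 ∧
    Nonempty (Sheeting D.f D.UpperSheet n) := by
  choose g hg hfg hgb using D.exists_sections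
  choose G hG hGg hfG hGb using fun s => D.exists_extension (hg s) (hfg s) (hgb s)
  have hinj : ∀ s, ∀ z ∈ hemi s, z ∉ Set.range branchPt → ∀ e e', G s e z = G s e' z → e = e' :=
    fun s z hz hb e e' h => (hGb s z hz hb _ (hfG s e z hz)).unique rfl h.symm
  have harc : ∀ i, ∃ N : {p : D.S // D.f p = (centre false : Sphere)} ≃ D.UpperSheet,
      ∀ e, Set.EqOn (G false e) (G true (N e)) (arc i) := by
    intro i
    obtain ⟨z₀, hz₀⟩ := openArc_nonempty i
    have hmem : ∀ z ∈ openArc i, ∀ s, z ∈ hemi s ∧ z ∉ Set.range branchPt := fun z hz s =>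
      ⟨arc_subset_hemi i s (mem_openArc_iff.1 hz).1, (mem_openArc_iff.1 hz).2⟩
    have hex : ∀ z ∈ openArc i, ∀ e, ∃ e', G false e z = G true e' z := by
      intro z hz e
      obtain ⟨e', he', -⟩ := hGb true z (hmem z hz true).1 (hmem z hz true).2 (G false e z)
        (hfG false e z (hmem z hz false).1)
      exact ⟨e', he'.symm⟩
    choose N hN using hex z₀ hz₀
    have hbij : Function.Bijective N := by
      constructor
      · intro e e' h
        refine hinj false z₀ (hmem z₀ hz₀ false).1 (hmem z₀ hz₀ false).2 _ _ ?_
        rw [hN, hN, h]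
      · intro e'
        obtain ⟨e, he, -⟩ := hGb false z₀ (hmem z₀ hz₀ false).1 (hmem z₀ hz₀ false).2 (G true e' z₀)
          (hfG true e' z₀ (hmem z₀ hz₀ true).1)
        refine ⟨e, hinj true z₀ (hmem z₀ hz₀ true).1 (hmem z₀ hz₀ true).2 _ _ ?_⟩
        rw [← hN, he]
    refine ⟨Equiv.ofBijective N hbij, fun e => ?_⟩
    refine Set.EqOn.of_subset_closure ?_ ((hG false e).mono (arc_subset_hemi i _))
      ((hG true (N e)).mono (arc_subset_hemi i _)) (openArc_subset_arc i) (arc_subset_closure i)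
    exact eqOn_of_isPreconnected (isPreconnected_openArc i)
      ((hG false e).mono fun z hz => (hmem z hz _).1)
      (fun x => (hG true x).mono fun z hz => (hmem z hz _).1) (fun z hz => hex z hz e)
      (fun z hz x y h => hinj true z (hmem z hz _).1 (hmem z hz true).2 x y h) hz₀ (hN e)
  choose N hN using harc
  -- Lower sheets are renamed after their upper neighbour along the arc 0; this forces the first
  -- permutation to be 1.
  refine ⟨fun i => (N 0).symm.trans (N i), Equiv.symm_trans_self _, ⟨⟨fun s e => match s with
    | true => G true e
    | false => G false ((N 0).symm e), ?_, ?_, ?_, ?_⟩⟩⟩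
  · rintro (s | s) e
    · exact hG false _
    · exact hG true _
  · rintro (s | s) e z hz
    · exact hfG false _ z hz
    · exact hfG true _ z hz
  · rintro (s | s) z hz hb p hp
    · exact ((N 0).symm.bijective.existsUnique_iff (p := fun x => G false x z = p)).1
        (hGb false z hz hb p hp)
    · exact hGb true z hz hb p hp
  · intro i e z hz
    exact hN i _ hz

end Dessin

/-! ## Gluing hemispheres to a branched covering -/

/-- An open `W ⊆ V` has image `m '' V` minus the compact set `m '' (C \ W)`, so `m` is open on `V`.
This produces charts of the glued surface from closed pieces, on which continuity is easy. -/
theorem exists_openPartialHomeomorph_of_isCompact {S : Type*} [TopologicalSpace S] {C V : Set S}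
    {m : S → ℂ} (hC : IsCompact C) (hm : ContinuousOn m C) (hinj : Set.InjOn m C) (hVC : V ⊆ C)
    (hV : IsOpen V) (hmV : IsOpen (m '' V)) (hne : V.Nonempty) :
    ∃ φ : OpenPartialHomeomorph S ℂ, φ.source = V ∧ ∀ x, φ x = m x := by
  have : Nonempty S := hne.nonempty
  let e : PartialEquiv S ℂ := (hinj.mono hVC).toPartialEquiv m V
  have ho : IsOpenMap (V.domRestrict e) := by
    intro W hW
    obtain ⟨W', hW', rfl⟩ := isOpen_induced_iff.1 hW
    have himg : V.domRestrict e '' ((↑) ⁻¹' W') = m '' V \ m '' (C \ (V ∩ W')) := by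
      ext y
      constructor
      · rintro ⟨⟨x, hxV⟩, hxW, rfl⟩
        refine ⟨⟨x, hxV, rfl⟩, ?_⟩
        rintro ⟨x', ⟨hx'C, hx'⟩, h⟩
        rw [hinj hx'C (hVC hxV) h] at hx'
        exact hx' ⟨hxV, hxW⟩
      · rintro ⟨⟨x, hxV, rfl⟩, hx⟩
        refine ⟨⟨x, hxV⟩, ?_, rfl⟩
        by_contra hxW
        exact hx ⟨x, ⟨hVC hxV, fun h => hxW h.2⟩, rfl⟩
    rw [himg]
    exact hmV.sdiff ((hC.diff (hV.inter hW')).image_of_continuousOn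
      (hm.mono Set.sdiff_subset)).isClosed
  exact ⟨OpenPartialHomeomorph.ofContinuousOpenRestrict e (hm.mono hVC) ho hV, rfl, fun _ => rfl⟩

/-! ### Local coordinates of the sphere -/

/-- The local coordinate `(z - w₀) / ρ`. -/
def affineChart (w₀ : ℂ) (ρ : ℝ) (hρ : ρ ≠ 0) : OpenPartialHomeomorph Sphere ℂ :=
  (OnePoint.isOpenEmbedding_coe (X := ℂ)).toOpenPartialHomeomorph.symm.trans
    ((Homeomorph.mulLeft₀ (ρ : ℂ) (by exact_mod_cast hρ)).trans
      (Homeomorph.addRight w₀)).symm.toOpenPartialHomeomorph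

theorem affineChart_symm (w₀ : ℂ) (ρ : ℝ) (hρ : ρ ≠ 0) (w : ℂ) :
    (affineChart w₀ ρ hρ).symm w = ((ρ * w + w₀ : ℂ) : Sphere) := rfl

theorem affineChart_target (w₀ : ℂ) (ρ : ℝ) (hρ : ρ ≠ 0) : 
    (affineChart w₀ ρ hρ).target = Set.univ := by
  simp [affineChart]

theorem affineChart_source (w₀ : ℂ) (ρ : ℝ) (hρ : ρ ≠ 0) : 
    (affineChart w₀ ρ hρ).source = Set.range ((↑) : ℂ → Sphere) := by
  simp [affineChart]

/-- A local coordinate which straightens two arcs with a common end point. -/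
structure Corner (z₀ : Sphere) (i i' : Fin 3) where
  chart : OpenPartialHomeomorph Sphere ℂ
  target_eq : chart.target = Set.univ
  symm_zero : chart.symm 0 = z₀
  mem_hemi : ∀ s w, chart.symm w ∈ hemi s ↔ 0 ≤ side s * w.im
  mem_neg : ∀ x : ℝ, x < 0 → -1 ≤ x → chart.symm x ∈ openArc i
  mem_pos : ∀ x : ℝ, 0 < x → x ≤ 1 → chart.symm x ∈ openArc i'

def cornerReal (x₀ : ℝ) (i i' : Fin 3) (ρ : ℝ) (hρ : 0 < ρ)
    (h : ∀ x : ℝ, x < 0 → -1 ≤ x → ρ * x + x₀ ∈ openArcSet i)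
    (h' : ∀ x : ℝ, 0 < x → x ≤ 1 → ρ * x + x₀ ∈ openArcSet i') : Corner (realPt x₀) i i' where
  chart := affineChart x₀ ρ hρ.ne'
  target_eq := affineChart_target _ _ _
  symm_zero := by simp [affineChart_symm, realPt]
  mem_hemi s w := by
    rw [affineChart_symm, coe_mem_hemi]
    simp only [Complex.add_im, Complex.mul_im, Complex.ofReal_re, Complex.ofReal_im, zero_mul,
      add_zero]
    rw [mul_left_comm, mul_nonneg_iff_of_pos_left hρ]
  mem_neg x hx hx1 := ⟨_, h x hx hx1, by simp [affineChart_symm, realPt]⟩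
  mem_pos x hx hx1 := ⟨_, h' x hx hx1, by simp [affineChart_symm, realPt]⟩

/-- The inverse chart is `w ↦ -2 / w`. The factor 2 keeps the unit disc in `|z| ≥ 2`, away from 1;
negative `w` gives the arc (1, ∞) and positive `w` the arc (∞, 0), in the cyclic order of the
indices. -/
def cornerInfty : Corner OnePoint.infty 2 0 where
  chart := negInv.toOpenPartialHomeomorph.trans (affineChart 0 (1 / 2) (by norm_num))
  target_eq := by
    rw [OpenPartialHomeomorph.trans_target, affineChart_target]
    simp
  symm_zero := by
    simp only [OpenPartialHomeomorph.coe_trans_symm, Function.comp_apply, affineChart_symm]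
    simp only [mul_zero, add_zero]
    exact negInv_zero
  mem_hemi s w := by
    simp only [OpenPartialHomeomorph.coe_trans_symm, Function.comp_apply, affineChart_symm]
    change negInv _ ∈ _ ↔ _
    rw [negInv_mem_hemi, coe_mem_hemi]
    simp only [Complex.mul_im, Complex.ofReal_re, Complex.ofReal_im, zero_mul, add_zero]
    rw [mul_left_comm, mul_nonneg_iff_of_pos_left (by norm_num)]
  mem_neg x hx hx1 := by
    simp only [OpenPartialHomeomorph.coe_trans_symm, Function.comp_apply, affineChart_symm]
    change negInv _ ∈ _
    have hx0 : ((1 / 2 : ℝ) * x + 0 : ℂ) ≠ 0 := by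
      norm_num; exact_mod_cast hx.ne
    rw [negInv_coe hx0]
    refine ⟨-(x / 2)⁻¹, ?_, ?_⟩
    · change 1 < -(x / 2)⁻¹
      rw [← inv_neg, one_lt_inv₀ (by linarith)]
      linarith
    · simp only [realPt]; congr 1; push_cast; ring
  mem_pos x hx hx1 := by
    simp only [OpenPartialHomeomorph.coe_trans_symm, Function.comp_apply, affineChart_symm]
    change negInv _ ∈ _
    have hx0 : ((1 / 2 : ℝ) * x + 0 : ℂ) ≠ 0 := by
      norm_num; exact_mod_cast hx.ne'
    rw [negInv_coe hx0]
    refine ⟨-(x / 2)⁻¹, ?_, ?_⟩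
    · change -(x / 2)⁻¹ < 0
      simpa using hx
    · simp only [realPt]; congr 1; push_cast; ring

theorem isOpen_openArcSet (i : Fin 3) : IsOpen (openArcSet i) := by
  fin_cases i
  · exact isOpen_Iio
  · exact isOpen_Ioo
  · exact isOpen_Ioi

theorem exists_corner_branchPt (i : Fin 3) : Nonempty (Corner (branchPt i) i (i + 1)) := by
  fin_cases i
  · refine ⟨branchPt_zero' ▸ cornerReal 0 0 1 (1 / 2) (by norm_num) ?_ ?_⟩ <;> intro x h1 h2
    · change 1 / 2 * x + 0 < (0 : ℝ); linarith
    · constructor <;> linarith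
  · refine ⟨branchPt_one' ▸ cornerReal 1 1 2 (1 / 2) (by norm_num) ?_ ?_⟩ <;> intro x h1 h2
    · constructor <;> linarith
    · change (1 : ℝ) < 1 / 2 * x + 1; linarith
  · exact ⟨cornerInfty⟩

/-- An interior point of an arc is treated as a corner whose two sides are the same arc, so that a
single construction gives all the charts over the real circle. -/
theorem exists_corner_openArc {i : Fin 3} {z : Sphere} (hz : z ∈ openArc i) :
    Nonempty (Corner z i i) := by
  obtain ⟨x, hx, rfl⟩ := hz
  obtain ⟨r, hr, hball⟩ := Metric.isOpen_iff.1 (isOpen_openArcSet i) x hx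
  have h : ∀ y : ℝ, |y| ≤ 1 → r / 2 * y + x ∈ openArcSet i := by
    intro y hy
    refine hball ?_
    rw [Metric.mem_ball, Real.dist_eq, add_sub_cancel_right, abs_mul, abs_of_pos (half_pos hr)]
    nlinarith [abs_nonneg y]
  exact ⟨cornerReal x i i (r / 2) (half_pos hr)
    (fun y h1 h2 => h y (abs_le.2 ⟨h2, by linarith⟩))
    (fun y h1 h2 => h y (abs_le.2 ⟨by linarith, h2⟩))⟩

/-! ### Roots on half planes -/

/-- The branch of the `k`-th root on the closed half plane `s` whose argument, at a point of
argument `t ∈ [0, 2π]`, is `t / k`. -/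
def halfRoot (k : ℕ) (s : Bool) (w : ℂ) : ℂ :=
  Complex.exp (Real.pi * Complex.I * (2 - side s) / 2 * (k : ℂ)⁻¹) *
    (-(side s * Complex.I) * w) ^ ((k : ℂ)⁻¹)

variable {k : ℕ}

/-- The factor `-(side s * I)` turns the half plane into `0 ≤ re`, away from the cut of the
principal power, and the exponential prefactor restores the argument. At 0, continuity comes from
the positive real part of the exponent. -/
theorem continuousAt_halfRoot (hk : 0 < k) {s : Bool} {w : ℂ} (hw : 0 ≤ side s * w.im) :
    ContinuousAt (halfRoot k s) w := by
  have hpos : 0 < ((k : ℂ)⁻¹).re := by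
    rw [← Complex.ofReal_natCast, ← Complex.ofReal_inv, Complex.ofReal_re]
    positivity
  have h := Complex.continuousAt_cpow_const_of_re_pos (z := -(side s * Complex.I) * w)
    (w := (k : ℂ)⁻¹) (Or.inl (by simpa using hw)) hpos
  have h2 : ContinuousAt (fun w : ℂ => -(side s * Complex.I) * w) w := by fun_prop
  exact continuousAt_const.mul (ContinuousAt.comp (f := fun w : ℂ => -(side s * Complex.I) * w) h h2)

theorem halfRoot_pow (hk : 0 < k) (s : Bool) (w : ℂ) : halfRoot k s w ^ k = w := by
  have hk0 : (k : ℂ) ≠ 0 := by exact_mod_cast hk.ne'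
  rw [halfRoot, mul_pow, Complex.cpow_nat_inv_pow _ hk.ne', ← Complex.exp_nat_mul]
  have h : Complex.exp (k * (Real.pi * Complex.I * (2 - side s) / 2 * (k : ℂ)⁻¹)) =
      side s * Complex.I := by
    rw [show (k * (Real.pi * Complex.I * (2 - side s) / 2 * (k : ℂ)⁻¹) : ℂ) =
      Real.pi * Complex.I * (2 - side s) / 2 by field_simp]
    cases s
    · rw [show (Real.pi * Complex.I * (2 - side false) / 2 : ℂ) =
        Real.pi * Complex.I + Real.pi / 2 * Complex.I by simp [side]; ring, Complex.exp_add,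
        Complex.exp_pi_mul_I, Complex.exp_pi_div_two_mul_I]
      simp [side]
    · rw [show (Real.pi * Complex.I * (2 - side true) / 2 : ℂ) = Real.pi / 2 * Complex.I by
        simp [side]; ring, Complex.exp_pi_div_two_mul_I]
      simp [side]
  rw [h]
  have h2 : (side s : ℂ) * side s = 1 := by exact_mod_cast side_mul_self s
  linear_combination (-w * (side s * side s)) * Complex.I_mul_I + w * h2

theorem halfRoot_zero (hk : 0 < k) (s : Bool) : halfRoot k s 0 = 0 :=
  eq_zero_of_pow_eq_zero (halfRoot_pow hk s 0)

theorem halfRoot_ne_zero (hk : 0 < k) {s : Bool} {w : ℂ} (hw : w ≠ 0) : halfRoot k s w ≠ 0 := by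
  intro h
  have := halfRoot_pow hk s w
  rw [h, zero_pow hk.ne'] at this
  exact hw this.symm

theorem cpow_mul_I {x : ℝ} (hx : 0 < x) (s : Bool) (c : ℂ) :
    ((side s * Complex.I) * x) ^ c = (x : ℂ) ^ c * Complex.exp (side s * Real.pi / 2 * Complex.I * c) := by
  have hx0 : (x : ℂ) ≠ 0 := by exact_mod_cast hx.ne'
  have hs : (side s * Complex.I : ℂ) ≠ 0 := by cases s <;> simp [side]
  have hl : Complex.log (side s * Complex.I) = side s * Real.pi / 2 * Complex.I := by
    cases s
    · simp [side, Complex.log_neg_I]; ring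
    · simp [side, Complex.log_I]
  rw [mul_comm _ (x : ℂ), Complex.cpow_def_of_ne_zero (mul_ne_zero hx0 hs),
    Complex.cpow_def_of_ne_zero hx0, Complex.log_ofReal_mul hx hs, hl, ← Complex.exp_add,
    Complex.ofReal_log hx.le]
  congr 1
  ring

theorem halfRoot_neg {x : ℝ} (hx : x < 0) : halfRoot k true x = halfRoot k false x := by
  have h : ∀ s, halfRoot k s x = ((-x : ℝ) : ℂ) ^ ((k : ℂ)⁻¹) *
      Complex.exp (Real.pi * Complex.I * (k : ℂ)⁻¹) := by
    intro s
    have h1 := cpow_mul_I (neg_pos.2 hx) s (k : ℂ)⁻¹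
    rw [halfRoot, show (-(side s * Complex.I) * x : ℂ) = (side s * Complex.I) * ((-x : ℝ) : ℂ) by
      push_cast; ring, h1, mul_left_comm, ← Complex.exp_add]
    congr 2
    ring
  rw [h, h]

/-- The positive axis has argument 0 seen from above and `2π` from below, hence the factor `exp (2πi
/ k)`; on the negative axis both arguments are `π` and the branches agree. The monodromy has to
compensate exactly this jump. -/
theorem halfRoot_pos {x : ℝ} (hx : 0 < x) :
    halfRoot k true x * Complex.exp (2 * Real.pi * Complex.I / k) = halfRoot k false x := by
  have h : ∀ s, halfRoot k s x = (x : ℂ) ^ ((k : ℂ)⁻¹) *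
      Complex.exp (Real.pi * Complex.I * (1 - side s) * (k : ℂ)⁻¹) := by
    intro s
    have h1 := cpow_mul_I hx (!s) (k : ℂ)⁻¹
    rw [side_not] at h1
    rw [halfRoot, show (-(side s * Complex.I) * x : ℂ) = ((-side s : ℝ) * Complex.I) * x by
      push_cast; ring, h1, mul_left_comm, ← Complex.exp_add]
    congr 2
    push_cast
    ring
  rw [h, h, mul_assoc, ← Complex.exp_add]
  congr 2
  simp [side]
  ring

/-! ### Roots of unity along a cycle -/

/-- A function on a cycle of length `k` which is multiplied by `exp (2πi / k)` by the
permutation. -/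
theorem exists_cycle_rotation {ι : Type*} [Finite ι] (π : Equiv.Perm ι) (e₀ : ι) :
    ∃ (k : ℕ) (θ : ι → ℂ), 0 < k ∧ (π = 1 → k = 1) ∧
      (∀ e, π.SameCycle e₀ e → θ (π e) = θ e * Complex.exp (2 * Real.pi * Complex.I / k)) ∧
      (∀ e, π.SameCycle e₀ e → θ e ^ k = 1) ∧
      (∀ e e', π.SameCycle e₀ e → π.SameCycle e₀ e' → θ e = θ e' → e = e') ∧
      ∀ ξ : ℂ, ξ ^ k = 1 → ∃ e, π.SameCycle e₀ e ∧ θ e = ξ := by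
  classical
  set k := Function.minimalPeriod (fun x => π • x) e₀ with hkdef
  have hk : 0 < k := Function.minimalPeriod_pos_of_mem_periodicPts
    (Function.Injective.mem_periodicPts (MulAction.injective π) e₀)
  set ω := Complex.exp (2 * Real.pi * Complex.I / k) with hω
  have hprim : IsPrimitiveRoot ω k := Complex.isPrimitiveRoot_exp k hk.ne'
  have hω0 : ω ≠ 0 := Complex.exp_ne_zero _
  have hiff : ∀ j j' : ℤ, (π ^ j) e₀ = (π ^ j') e₀ ↔ ω ^ j = ω ^ j' := by
    intro j j'
    have h1 := MulAction.zpow_smul_eq_iff_minimalPeriod_dvd (a := π) (b := e₀) (n := j - j')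
    have h2 := hprim.zpow_eq_one_iff_dvd (j - j')
    rw [zpow_sub₀ hω0, div_eq_one_iff_eq (zpow_ne_zero _ hω0)] at h2
    rw [h2, ← h1, Equiv.Perm.smul_def, sub_eq_neg_add, zpow_add, Equiv.Perm.mul_apply, zpow_neg,
      Equiv.Perm.inv_eq_iff_eq]
  -- On the cycle, `θ` of `(π ^ j) e₀` is `ω ^ j`, by `hiff` independent of the exponent chosen; the
  -- value 1 elsewhere is a default.
  refine ⟨k, fun e => if h : π.SameCycle e₀ e then ω ^ h.choose else 1, hk, ?_, ?_⟩
  · rintro rfl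
    rw [hkdef, Function.minimalPeriod_eq_one_iff_isFixedPt]
    simp [Function.IsFixedPt]
  have hθ : ∀ j : ℤ, (if h : π.SameCycle e₀ ((π ^ j) e₀) then ω ^ h.choose else 1) = ω ^ j := by
    intro j
    have h : π.SameCycle e₀ ((π ^ j) e₀) := ⟨j, rfl⟩
    rw [dif_pos h, ← hiff]
    exact h.choose_spec
  refine ⟨?_, ?_, ?_, ?_⟩
  · rintro _ ⟨j, rfl⟩
    have h := hθ (1 + j)
    rw [zpow_add, zpow_one, Equiv.Perm.mul_apply] at h
    change dite _ _ _ = dite _ _ _ * _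
    rw [h, hθ, zpow_add₀ hω0, zpow_one, mul_comm]
  · rintro _ ⟨j, rfl⟩
    change (dite _ _ _) ^ k = 1
    rw [hθ, ← zpow_natCast, ← zpow_mul, mul_comm, zpow_mul, zpow_natCast, hprim.pow_eq_one, one_zpow]
  · rintro _ _ ⟨j, rfl⟩ ⟨j', rfl⟩ h
    change dite _ _ _ = dite _ _ _ at h
    rw [hθ, hθ] at h
    exact (hiff j j').2 h
  · intro ξ hξ
    have : NeZero k := ⟨hk.ne'⟩
    obtain ⟨j, -, rfl⟩ := hprim.eq_pow_of_pow_eq_one hξ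
    refine ⟨(π ^ (j : ℤ)) e₀, ⟨j, rfl⟩, ?_⟩
    change dite _ _ _ = _
    rw [hθ, zpow_natCast]

/-! ## The glued surface -/

section GluedSurface

variable {ι : Type} (n : Fin 3 → Equiv.Perm ι)

theorem isClosed_glued (s : Bool) (e : ι) (s' : Bool) (e' : ι) :
    IsClosed {z | Glued n z s e s' e'} := by
  have h : {z | Glued n z s e s' e'} = {_z | s = s' ∧ e = e'} ∪
      ((⋃ i, arc i ∩ {_z | adj n s i e = adj n s' i e'}) ∪
        ⋃ i, {branchPt i} ∩ {_z | (mon n i).SameCycle (adj n s i e) (adj n s' i e')}) := by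
    ext z
    simp [Glued]
  rw [h]
  exact isClosed_const.union ((isClosed_iUnion_of_finite fun i =>
    (isClosed_arc i).inter isClosed_const).union (isClosed_iUnion_of_finite fun i =>
    isClosed_singleton.inter isClosed_const))

theorem Glued.symm {z : Sphere} {s s' : Bool} {e e' : ι} (h : Glued n z s e s' e') :
    Glued n z s' e' s e := by
  rcases h with ⟨rfl, rfl⟩ | ⟨i, hi, h⟩ | ⟨i, hi, h⟩
  · exact Or.inl ⟨rfl, rfl⟩
  · exact Or.inr (Or.inl ⟨i, hi, h.symm⟩)
  · exact Or.inr (Or.inr ⟨i, hi, h.symm⟩)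

theorem Glued.trans {z : Sphere} {s s' s'' : Bool} {e e' e'' : ι} (h : Glued n z s e s' e')
    (h' : Glued n z s' e' s'' e'') : Glued n z s e s'' e'' := by
  by_cases hb : z ∈ Set.range branchPt
  · obtain ⟨i, rfl⟩ := hb
    rw [glued_branchPt_iff] at *
    exact Equiv.Perm.SameCycle.trans h h'
  · by_cases ha : ∃ i, z ∈ arc i
    · obtain ⟨i, hi⟩ := ha
      rw [glued_arc_iff hi hb] at *
      exact h.trans h'
    · push Not at ha
      rw [glued_iff_of_notMem_arc ha] at *
      exact ⟨h.1.trans h'.1, h.2.trans h'.2⟩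

/-- The disjoint union of the hemispheres. -/
abbrev Hemis (ι : Type) : Type := Σ x : Bool × ι, hemi x.1

/-- Identification of the points of the hemispheres. -/
abbrev gluedSetoid : Setoid (Hemis ι) where
  r x y := x.2.1 = y.2.1 ∧ Glued n x.2.1 x.1.1 x.1.2 y.1.1 y.1.2
  iseqv := by
    refine ⟨fun x => ⟨rfl, Or.inl ⟨rfl, rfl⟩⟩, ?_, ?_⟩
    · rintro x y ⟨h, h'⟩
      exact ⟨h.symm, h ▸ h'.symm⟩
    · rintro x y z ⟨h, h'⟩ ⟨h1, h1'⟩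
      exact ⟨h.trans h1, h'.trans n (h ▸ h1')⟩

/-- The surface obtained by gluing hemispheres. -/
abbrev GluedSurface : Type := Quotient (gluedSetoid n)

/-! ### Topology of the glued surface -/

namespace GluedSurface

/-- The projection to the sphere. -/
def proj : GluedSurface n → Sphere :=
  Quotient.lift (fun x : Hemis ι => x.2.1) fun _ _ h => h.1

theorem continuous_proj : Continuous (proj n) :=
  Continuous.quotient_lift (continuous_sigma fun _ => continuous_subtype_val) _

/-- The sheets of the glued surface (`∞` outside of the hemisphere). -/
def sheet (s : Bool) (e : ι) (z : Sphere) : GluedSurface n :=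
  open Classical in
  if h : z ∈ hemi s then Quotient.mk (gluedSetoid n) ⟨(s, e), ⟨z, h⟩⟩
  else Quotient.mk (gluedSetoid n) ⟨(s, e), ⟨OnePoint.infty, infty_mem_hemi⟩⟩

variable {n}

theorem sheet_of_mem {s : Bool} {e : ι} {z : Sphere} (h : z ∈ hemi s) :
    sheet n s e z = Quotient.mk (gluedSetoid n) ⟨(s, e), ⟨z, h⟩⟩ := dif_pos h

theorem exists_rep (p : GluedSurface n) : ∃ s e, proj n p ∈ hemi s ∧ sheet n s e (proj n p) = p := by
  induction p using Quotient.inductionOn with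
  | h x => exact ⟨x.1.1, x.1.2, x.2.2, sheet_of_mem x.2.2⟩

theorem proj_sheet {s : Bool} {e : ι} {z : Sphere} (h : z ∈ hemi s) :
    proj n (sheet n s e z) = z := by
  rw [sheet_of_mem h]; rfl

theorem sheet_eq_iff {s s' : Bool} {e e' : ι} {z : Sphere} (h : z ∈ hemi s) (h' : z ∈ hemi s') :
    sheet n s e z = sheet n s' e' z ↔ Glued n z s e s' e' := by
  rw [sheet_of_mem h, sheet_of_mem h', Quotient.eq]
  exact ⟨fun h => h.2, fun h => ⟨rfl, h⟩⟩

theorem sheet_adj {i : Fin 3} {z : Sphere} (hz : z ∈ arc i) (s : Bool) (e : ι) :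
    sheet n true (adj n s i e) z = sheet n s e z := by
  rw [sheet_eq_iff (arc_subset_hemi i _ hz) (arc_subset_hemi i _ hz)]
  exact Or.inr (Or.inl ⟨i, hz, rfl⟩)

theorem continuousOn_sheet (s : Bool) (e : ι) : ContinuousOn (sheet n s e) (hemi s) := by
  rw [continuousOn_iff_continuous_domRestrict]
  have h : Continuous fun z : hemi s => Quotient.mk (gluedSetoid n) ⟨(s, e), z⟩ :=
    continuous_quotient_mk'.comp continuous_sigmaMk
  refine h.congr fun z => ?_
  exact (sheet_of_mem z.2).symm

theorem isClosed_sheet_image (s : Bool) (e : ι) {C : Set Sphere} (hC : IsClosed C) :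
    IsClosed (sheet n s e '' (hemi s ∩ C)) := by
  have hq : IsQuotientMap (Quotient.mk (gluedSetoid n)) := isQuotientMap_quot_mk
  rw [← hq.isClosed_preimage, isClosed_sigma_iff]
  rintro ⟨s', e'⟩
  have hset : Sigma.mk (β := fun x : Bool × ι => hemi x.1) (s', e') ⁻¹'
      (Quotient.mk (gluedSetoid n) ⁻¹' (sheet n s e '' (hemi s ∩ C))) =
      (↑) ⁻¹' (hemi s ∩ C ∩ {z | Glued n z s e s' e'}) := by
    ext z
    constructor
    · rintro ⟨y, ⟨hy, hyC⟩, h⟩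
      rw [sheet_of_mem hy, Quotient.eq] at h
      obtain ⟨h1, h2⟩ := h
      have h1 : y = z := h1
      subst h1
      exact ⟨⟨hy, hyC⟩, h2⟩
    · rintro ⟨⟨hz, hzC⟩, h⟩
      exact ⟨z, ⟨hz, hzC⟩, by rw [sheet_of_mem hz, Quotient.eq]; exact ⟨rfl, h⟩⟩
  rw [hset]
  exact (((isClosed_hemi s).inter hC).inter (isClosed_glued n _ _ _ _)).preimage
    continuous_subtype_val

variable [Finite ι]

instance : CompactSpace (GluedSurface n) := by
  have : ∀ x : Bool × ι, CompactSpace (hemi x.1) := fun x =>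
    isCompact_iff_compactSpace.1 (isCompact_hemi _)
  infer_instance

/-- Points of different fibres are separated downstairs. For two points of one fibre, remove from
the surface all sheets that miss the given point: a common point of the two open sets lies on a
sheet which contains both points, and a sheet meets a fibre only once. -/
instance : T2Space (GluedSurface n) := by
  refine ⟨fun p p' hne => ?_⟩
  by_cases hf : proj n p = proj n p'
  · let O : GluedSurface n → Set (GluedSurface n) := fun p =>
      ⋂ x : {x : Bool × ι // p ∉ sheet n x.1 x.2 '' (hemi x.1 ∩ Set.univ)},
        (sheet n x.1.1 x.1.2 '' (hemi x.1.1 ∩ Set.univ))ᶜ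
    have hO : ∀ p, IsOpen (O p) := fun p => isOpen_iInter_of_finite fun x =>
      (isClosed_sheet_image _ _ isClosed_univ).isOpen_compl
    have hmem : ∀ p, p ∈ O p := fun p => Set.mem_iInter.2 fun x => x.2
    refine ⟨O p, O p', hO p, hO p', hmem p, hmem p', Set.disjoint_left.2 fun q hq hq' => ?_⟩
    obtain ⟨s, e, hs, he⟩ := exists_rep q
    have key : ∀ p, q ∈ O p → p = sheet n s e (proj n p) := by
      intro p hq
      by_contra hcon
      have hp : p ∉ sheet n s e '' (hemi s ∩ Set.univ) := by
        rintro ⟨z, ⟨hz, -⟩, rfl⟩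
        exact hcon (by rw [proj_sheet hz])
      exact Set.mem_iInter.1 hq ⟨(s, e), hp⟩ ⟨_, ⟨hs, trivial⟩, he⟩
    exact hne (by rw [key p hq, key p' hq', hf])
  · obtain ⟨V, V', hV, hV', h, h', hd⟩ := t2_separation hf
    exact ⟨_, _, hV.preimage (continuous_proj n), hV'.preimage (continuous_proj n), h, h',
      hd.preimage _⟩

omit [Finite ι] in
theorem isPreconnected_hemi (s : Bool) : IsPreconnected (hemi s) :=
  (isPreconnected_openHemi s).subset_closure (openHemi_subset_hemi s) (hemi_subset_closure s)

-- Sheets are connected, so a clopen set is a union of sheets. As `n 0 = 1`, it contains the lower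
-- sheet `e` exactly if it contains the upper one, and the set of its upper sheets is invariant
-- under the gluing.
omit [Finite ι] in
theorem connectedSpace [Nonempty ι] (h0 : n 0 = 1)
    (htr : ∀ Q : Set ι, (∀ i e, n i e ∈ Q ↔ e ∈ Q) → Q.Nonempty → Q = Set.univ) :
    ConnectedSpace (GluedSurface n) := by
  obtain ⟨e₀⟩ := ‹Nonempty ι›
  have : Nonempty (GluedSurface n) := ⟨sheet n true e₀ OnePoint.infty⟩
  have hpre : PreconnectedSpace (GluedSurface n) := by
    rw [preconnectedSpace_iff_clopen]
    intro U hU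
    by_contra! hcon
    obtain ⟨⟨p, hp⟩, hne⟩ := hcon
    have hsh : ∀ s e z z', z ∈ hemi s → z' ∈ hemi s → sheet n s e z ∈ U → sheet n s e z' ∈ U := by
      intro s e z z' hz hz' h
      exact ((isPreconnected_hemi s).image _ (continuousOn_sheet s e)).subset_isClopen hU
        ⟨_, ⟨z, hz, rfl⟩, h⟩ ⟨z', hz', rfl⟩
    have hglue : ∀ i e, sheet n true (n i e) (branchPt i) ∈ U ↔ sheet n false e (branchPt 0) ∈ U := by
      intro i e
      rw [← adj_false n, sheet_adj (branchPt_mem_arc_self i)]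
      exact ⟨hsh _ _ _ _ (branchPt_mem_hemi _ _) (branchPt_mem_hemi _ _),
        hsh _ _ _ _ (branchPt_mem_hemi _ _) (branchPt_mem_hemi _ _)⟩
    have hup : ∀ i e, sheet n true e (branchPt i) ∈ U ↔ sheet n true e (branchPt 0) ∈ U :=
      fun i e => ⟨hsh _ _ _ _ (branchPt_mem_hemi _ _) (branchPt_mem_hemi _ _),
        hsh _ _ _ _ (branchPt_mem_hemi _ _) (branchPt_mem_hemi _ _)⟩
    have hdown : ∀ e, sheet n false e (branchPt 0) ∈ U ↔ sheet n true e (branchPt 0) ∈ U := by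
      intro e
      rw [← hglue 0, h0]
      rfl
    have hall : {e | sheet n true e (branchPt 0) ∈ U} = Set.univ := by
      refine htr _ (fun i e => ?_) ?_
      · change _ ∈ U ↔ _ ∈ U
        rw [← hup i, hglue, hdown]
      · obtain ⟨s, e, hs, he⟩ := exists_rep p
        rw [← he] at hp
        have h1 := hsh _ _ _ _ hs (branchPt_mem_hemi 0 s) hp
        cases s
        · exact ⟨e, (hdown e).1 h1⟩
        · exact ⟨e, h1⟩
    refine hne (Set.eq_univ_of_forall fun q => ?_)
    obtain ⟨s, e, hs, he⟩ := exists_rep q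
    rw [← he]
    have he' : sheet n true e (branchPt 0) ∈ U := by
      have : e ∈ {e | sheet n true e (branchPt 0) ∈ U} := hall ▸ trivial
      exact this
    refine hsh _ _ _ _ (branchPt_mem_hemi 0 s) hs ?_
    cases s
    · exact (hdown e).2 he'
    · exact he'
  exact { toPreconnectedSpace := hpre, toNonempty := this }

/-! ### Local coordinates -/

/-- The image of a small disc in one sheet is open because it is the preimage of the disc minus the
closed images of all the other sheets; nothing is glued over an open hemisphere. -/
theorem hasRamificationIndex_openHemi {s : Bool} (e : ι) {z : Sphere} (hz : z ∈ openHemi s) :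
    HasRamificationIndex (proj n) (sheet n s e z) 1 := by
  obtain ⟨w₀, hw₀, rfl⟩ := hz
  obtain ⟨r, hr, hball⟩ := Metric.nhds_basis_closedBall.mem_iff.1 ((isOpen_half s).mem_nhds hw₀)
  let ψ := affineChart w₀ 1 one_ne_zero
  have hψ : ∀ w, ψ.symm w = ((w + w₀ : ℂ) : Sphere) := fun w => by
    simp [ψ, affineChart_symm]
  have hψt : ψ.target = Set.univ := affineChart_target _ _ _
  have hψ' : ∀ w : ℂ, ψ (w : Sphere) = w - w₀ := fun w => by
    have := ψ.right_inv (x := w - w₀) (hψt ▸ trivial)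
    rwa [hψ, sub_add_cancel] at this
  set Z : Set Sphere := (↑) '' Metric.closedBall w₀ r with hZ
  have hZh : Z ⊆ openHemi s := Set.image_mono hball
  have hZh' := hZh.trans (openHemi_subset_hemi s)
  have hZc : IsCompact Z := (isCompact_closedBall w₀ r).image OnePoint.continuous_coe
  set Z' : Set Sphere := (↑) '' Metric.ball w₀ r with hZ'
  have hZZ' : Z' ⊆ Z := Set.image_mono Metric.ball_subset_closedBall
  have hVo : IsOpen (sheet n s e '' Z') := by
    have hset : sheet n s e '' Z' = proj n ⁻¹' Z' \ ⋃ x : {x : Bool × ι // x ≠ (s, e)},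
        sheet n x.1.1 x.1.2 '' (hemi x.1.1 ∩ Z) := by
      ext p
      constructor
      · rintro ⟨z, hz, rfl⟩
        have hzs := hZh' (hZZ' hz)
        refine ⟨by rwa [Set.mem_preimage, proj_sheet hzs], ?_⟩
        simp only [Set.mem_iUnion, not_exists]
        rintro ⟨⟨s', e'⟩, hne⟩ ⟨z', ⟨hz', -⟩, h⟩
        obtain rfl : z' = z := by rw [← proj_sheet hz' (n := n) (e := e'), h, proj_sheet hzs]
        rw [sheet_eq_iff hz' hzs,
          glued_iff_of_notMem_arc (notMem_arc_of_mem_openHemi (hZh (hZZ' hz)))] at h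
        exact hne (Prod.ext h.1 h.2)
      · rintro ⟨hp, hp'⟩
        obtain ⟨s', e', hs', he'⟩ := exists_rep p
        by_cases heq : (s', e') = (s, e)
        · obtain ⟨rfl, rfl⟩ := Prod.ext_iff.1 heq
          exact ⟨_, hp, he'⟩
        · refine absurd ?_ hp'
          exact Set.mem_iUnion.2 ⟨⟨(s', e'), heq⟩, ⟨proj n p, ⟨hs', hZZ' hp⟩, he'⟩⟩
    rw [hset]
    exact ((OnePoint.isOpen_image_coe.2 Metric.isOpen_ball).preimage (continuous_proj n)).sdiff
      (isClosed_iUnion_of_finite fun x => isClosed_sheet_image _ _ hZc.isClosed)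
  have hpr : ∀ z ∈ Z, proj n (sheet n s e z) = z := fun z hz => proj_sheet (hZh' hz)
  have hcont : ContinuousOn (fun p => ψ (proj n p)) (sheet n s e '' Z) := by
    refine ψ.continuousOn.comp (continuous_proj n).continuousOn ?_
    rintro _ ⟨z, hz, rfl⟩
    rw [hpr z hz]
    obtain ⟨w, -, rfl⟩ := hz
    rw [affineChart_source]
    exact ⟨w, rfl⟩
  obtain ⟨φ, hφs, hφ⟩ := exists_openPartialHomeomorph_of_isCompact
    (hZc.image_of_continuousOn ((continuousOn_sheet s e).mono hZh')) hcont
    (by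
      rintro _ ⟨z, hz, rfl⟩ _ ⟨z', hz', rfl⟩ h
      simp only [hpr z hz, hpr z' hz'] at h
      obtain ⟨w, -, rfl⟩ := hz
      obtain ⟨w', -, rfl⟩ := hz'
      rw [hψ', hψ', sub_left_inj] at h
      rw [h])
    (Set.image_mono hZZ') hVo
    (by
      have : (fun p => ψ (proj n p)) '' (sheet n s e '' Z') = Metric.ball 0 r := by
        ext y
        constructor
        · rintro ⟨_, ⟨_, ⟨w, hw, rfl⟩, rfl⟩, rfl⟩
          have h1 : (w : Sphere) ∈ Z := hZZ' ⟨w, hw, rfl⟩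
          simp only [hpr _ h1, hψ']
          simpa [dist_eq_norm] using hw
        · intro hy
          have hw : y + w₀ ∈ Metric.ball w₀ r := by simpa [dist_eq_norm] using hy
          refine ⟨_, ⟨_, ⟨y + w₀, hw, rfl⟩, rfl⟩, ?_⟩
          have h1 : ((y + w₀ : ℂ) : Sphere) ∈ Z := hZZ' ⟨_, hw, rfl⟩
          simp only [hpr _ h1, hψ', add_sub_cancel_right]
      rw [this]
      exact Metric.isOpen_ball)
    ⟨_, _, ⟨w₀, Metric.mem_ball_self hr, rfl⟩, rfl⟩
  have hw₀Z' : (w₀ : Sphere) ∈ Z' := ⟨w₀, Metric.mem_ball_self hr, rfl⟩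
  have hsrc : ∀ w : ℂ, (w : Sphere) ∈ ψ.source := fun w => by
    rw [affineChart_source]; exact ⟨w, rfl⟩
  refine ⟨one_pos, φ, ψ, ?_, ?_, ?_, ?_, ?_⟩
  · rw [hφs]; exact ⟨_, hw₀Z', rfl⟩
  · rw [hφ, hpr _ (hZZ' hw₀Z'), hψ', sub_self]
  · rw [hpr _ (hZZ' hw₀Z')]; exact hsrc w₀
  · rw [hpr _ (hZZ' hw₀Z'), hψ', sub_self]
  · intro y hy
    rw [hφs] at hy
    obtain ⟨_, ⟨w, hw, rfl⟩, rfl⟩ := hy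
    rw [hφ, pow_one]
    refine ⟨?_, rfl⟩
    rw [hpr _ (hZZ' ⟨w, hw, rfl⟩)]
    exact hsrc w

end GluedSurface

end GluedSurface

/-! ### Charts of the glued surface over the real circle -/

section CornerChart

variable {ι : Type} {n : Fin 3 → Equiv.Perm ι} {z₀ : Sphere} {i i' : Fin 3}

theorem mem_hemi_of_arc {z : Sphere} (h : ∃ j, z ∈ arc j) (s : Bool) : z ∈ hemi s :=
  h.elim fun j hj => arc_subset_hemi j s hj

theorem Corner.glued_cases (c : Corner z₀ i i')
    (hz : ∀ s s' e e', Glued n z₀ s e s' e' →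
      (n i' * (n i)⁻¹).SameCycle (adj n s i e) (adj n s' i e'))
    {w : ℂ} (hw : ‖w‖ ≤ 1) {s s' : Bool} {e e' : ι} (h : Glued n (c.chart.symm w) s e s' e') :
    (s = s' ∧ e = e') ∨
    (w = 0 ∧ (n i' * (n i)⁻¹).SameCycle (adj n s i e) (adj n s' i e')) ∨
    (∃ x : ℝ, x < 0 ∧ w = x ∧ adj n s i e = adj n s' i e') ∨
    (∃ x : ℝ, 0 < x ∧ w = x ∧ adj n s i' e = adj n s' i' e') := by
  by_cases ha : ∃ j, c.chart.symm w ∈ arc j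
  · right
    have h1 := (c.mem_hemi true w).1 (mem_hemi_of_arc ha _)
    have h2 := (c.mem_hemi false w).1 (mem_hemi_of_arc ha _)
    have him : w.im = 0 := by
      simp only [side] at h1 h2
      norm_num at h1 h2
      linarith
    obtain ⟨x, rfl⟩ : ∃ x : ℝ, (x : ℂ) = w := ⟨w.re, by apply Complex.ext <;> simp [him]⟩
    have hx : |x| ≤ 1 := by simpa using hw
    rcases lt_trichotomy x 0 with hneg | rfl | hpos
    · have hm := mem_openArc_iff.1 (c.mem_neg x hneg (abs_le.1 hx).1)
      exact Or.inr (Or.inl ⟨x, hneg, rfl, (glued_arc_iff hm.1 hm.2).1 h⟩)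
    · rw [Complex.ofReal_zero, c.symm_zero] at h
      exact Or.inl ⟨by simp, hz _ _ _ _ h⟩
    · have hm := mem_openArc_iff.1 (c.mem_pos x hpos (abs_le.1 hx).2)
      exact Or.inr (Or.inr ⟨x, hpos, rfl, (glued_arc_iff hm.1 hm.2).1 h⟩)
  · push Not at ha
    exact Or.inl ((glued_iff_of_notMem_arc ha).1 h)

namespace GluedSurface

/-- The coordinate on a sheet is the half-plane root of the base coordinate times the root of unity
`θ` of its adjacent upper sheet along the arc `i`. Across the negative side, the arc `i`, the
factors agree; across the positive side, the arc `i'`, the monodromy multiplies `θ` by `exp (2πi /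
k)`, which cancels the jump of `halfRoot`. The coordinates fit together to a `k`-th root of the base
coordinate, bijective onto a disc since `θ` takes every `k`-th root of unity once on the cycle. -/
theorem hasRamificationIndex_corner [Finite ι] (c : Corner z₀ i i')
    (hz : ∀ s s' e e', Glued n z₀ s e s' e' ↔
      (n i' * (n i)⁻¹).SameCycle (adj n s i e) (adj n s' i e')) (e₀ : ι) :
    ∃ k, (n i' * (n i)⁻¹ = 1 → k = 1) ∧
      HasRamificationIndex (proj n) (sheet n true e₀ z₀) k := by
  obtain ⟨k, θ, hk, hk1, hθ, hθk, hθi, hθs⟩ := exists_cycle_rotation (n i' * (n i)⁻¹) e₀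
  refine ⟨k, hk1, hk, ?_⟩
  set π := n i' * (n i)⁻¹ with hπ
  have hadj : ∀ s e, π.SameCycle (adj n s i e) (adj n s i' e) := by
    intro s e
    cases s
    · exact ⟨1, by simp [hπ]⟩
    · exact Equiv.Perm.SameCycle.refl _ _
  -- The sheets which have the given point as a corner; no other sheet is glued to them inside the
  -- unit disc of the corner chart.
  let good : Bool → ι → Prop := fun s e => π.SameCycle e₀ (adj n s i e)
  let v : Bool → ι → ℂ → ℂ := fun s e w => halfRoot k s w * θ (adj n s i e)
  have hgood : ∀ w, ‖w‖ ≤ 1 → ∀ s e s' e', Glued n (c.chart.symm w) s e s' e' →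
      good s e → good s' e' := by
    intro w hw s e s' e' h hg
    rcases c.glued_cases (fun s s' e e' => (hz s s' e e').1) hw h with
      ⟨rfl, rfl⟩ | ⟨-, h⟩ | ⟨x, -, -, h⟩ | ⟨x, -, -, h⟩
    · exact hg
    · exact Equiv.Perm.SameCycle.trans hg h
    · change π.SameCycle _ _; rw [← h]; exact hg
    · refine Equiv.Perm.SameCycle.trans hg ((hadj s e).trans ?_)
      rw [h]
      exact (hadj s' e').symm
  have hvpos : ∀ x : ℝ, 0 < x → ∀ s e, good s e → v s e x = halfRoot k true x * θ (adj n s i' e) := by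
    intro x hx s e hg
    cases s
    · have h1 := hθ _ hg
      simp only [v, adj_false] at h1 ⊢
      rw [← halfRoot_pos hx, mul_assoc, mul_comm (Complex.exp _), ← h1]
      simp [hπ]
    · rfl
  have hvneg : ∀ x : ℝ, x < 0 → ∀ s e, v s e x = halfRoot k true x * θ (adj n s i e) := by
    intro x hx s e
    cases s
    · simp only [v, adj_false, halfRoot_neg hx]
    · rfl
  have hv0 : ∀ s e, v s e 0 = 0 := fun s e => by simp [v, halfRoot_zero hk]
  have hvpow : ∀ s e w, good s e → v s e w ^ k = w := fun s e w hg => by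
    simp only [v, mul_pow, halfRoot_pow hk, hθk _ hg, mul_one]
  have hvglue : ∀ w, ‖w‖ ≤ 1 → ∀ s e s' e', Glued n (c.chart.symm w) s e s' e' →
      good s e → v s e w = v s' e' w := by
    intro w hw s e s' e' h hg
    have hg' := hgood w hw s e s' e' h hg
    rcases c.glued_cases (fun s s' e e' => (hz s s' e e').1) hw h with
      ⟨rfl, rfl⟩ | ⟨rfl, h1⟩ | ⟨x, hx, rfl, h1⟩ | ⟨x, hx, rfl, h1⟩
    · rfl
    · rw [hv0, hv0]
    · rw [hvneg x hx, hvneg x hx, h1]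
    · rw [hvpos x hx _ _ hg, hvpos x hx _ _ hg', h1]
  have hright : ∀ w, c.chart (c.chart.symm w) = w := fun w =>
    c.chart.right_inv (c.target_eq ▸ trivial)
  have hsrc : ∀ w, c.chart.symm w ∈ c.chart.source := fun w =>
    c.chart.map_target (c.target_eq ▸ trivial)
  have hc0 : c.chart z₀ = 0 := by
    have h := hright 0
    rwa [c.symm_zero] at h
  have hsrc0 : z₀ ∈ c.chart.source := by
    have h := hsrc 0
    rwa [c.symm_zero] at h
  have hsc : Continuous c.chart.symm := by
    have := c.chart.continuousOn_symm
    rwa [c.target_eq, continuousOn_univ] at this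
  set Z : Set Sphere := c.chart.symm '' Metric.closedBall 0 1 with hZ
  set Z' : Set Sphere := c.chart.symm '' Metric.ball 0 1 with hZ'
  have hZZ' : Z' ⊆ Z := Set.image_mono Metric.ball_subset_closedBall
  have hZcl : IsClosed Z := ((isCompact_closedBall 0 1).image hsc).isClosed
  have hZo : IsOpen Z' := c.chart.isOpen_image_symm_of_subset_target Metric.isOpen_ball
    (by rw [c.target_eq]; exact Set.subset_univ _)
  choose S E hS hE using exists_rep (n := n)
  -- The sheet used at each point is chosen arbitrarily; `hvglue` removes the dependence wherever
  -- the sheet is good.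
  let m : GluedSurface n → ℂ := fun p => v (S p) (E p) (c.chart (proj n p))
  have hm : ∀ s e w, ‖w‖ ≤ 1 → c.chart.symm w ∈ hemi s → good s e →
      m (sheet n s e (c.chart.symm w)) = v s e w := by
    intro s e w hw hs hg
    have h1 := hS (sheet n s e (c.chart.symm w))
    have h2 := hE (sheet n s e (c.chart.symm w))
    simp only [proj_sheet hs] at h1 h2
    rw [sheet_eq_iff h1 hs] at h2
    simp only [m, proj_sheet hs, hright]
    exact (hvglue w hw _ _ _ _ (h2.symm n) hg).symm
  set C : Set (GluedSurface n) := ⋃ x : {x : Bool × ι // good x.1 x.2},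
    sheet n x.1.1 x.1.2 '' (hemi x.1.1 ∩ Z) with hC
  have hmemC : ∀ p, p ∈ C ↔ ∃ s e w, ‖w‖ ≤ 1 ∧ c.chart.symm w ∈ hemi s ∧ good s e ∧
      sheet n s e (c.chart.symm w) = p := by
    intro p
    simp only [hC, Set.mem_iUnion]
    constructor
    · rintro ⟨⟨⟨s, e⟩, hg⟩, _, ⟨hs, w, hw, rfl⟩, rfl⟩
      exact ⟨s, e, w, by simpa using hw, hs, hg, rfl⟩
    · rintro ⟨s, e, w, hw, hs, hg, rfl⟩
      exact ⟨⟨(s, e), hg⟩, _, ⟨hs, w, by simpa using hw, rfl⟩, rfl⟩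
  have hCcl : IsClosed C := isClosed_iUnion_of_finite fun x => isClosed_sheet_image _ _ hZcl
  -- The good part of the preimage of the open disc is open because its complement there is covered
  -- by the closed images of the other sheets.
  have hVo : IsOpen (proj n ⁻¹' Z' ∩ C) := by
    have hset : proj n ⁻¹' Z' ∩ C = proj n ⁻¹' Z' \ ⋃ x : {x : Bool × ι // ¬ good x.1 x.2},
        sheet n x.1.1 x.1.2 '' (hemi x.1.1 ∩ Z) := by
      ext p
      constructor
      · rintro ⟨hp, hpC⟩
        refine ⟨hp, ?_⟩
        simp only [Set.mem_iUnion, not_exists]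
        rintro ⟨⟨s', e'⟩, hng⟩ ⟨_, ⟨hs', w', hw', rfl⟩, h⟩
        obtain ⟨s, e, w, hw, hs, hg, rfl⟩ := (hmemC p).1 hpC
        have h1 : c.chart.symm w' = c.chart.symm w := by
          rw [← proj_sheet hs' (n := n) (e := e'), h, proj_sheet hs]
        rw [h1] at h hs'
        rw [sheet_eq_iff hs' hs] at h
        exact hng (hgood w hw _ _ _ _ (h.symm n) hg)
      · rintro ⟨hp, hp'⟩
        refine ⟨hp, ?_⟩
        by_cases hg : good (S p) (E p)
        · exact Set.mem_iUnion.2 ⟨⟨(S p, E p), hg⟩, ⟨proj n p, ⟨hS p, hZZ' hp⟩, hE p⟩⟩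
        · refine absurd ?_ hp'
          exact Set.mem_iUnion.2 ⟨⟨(S p, E p), hg⟩, ⟨proj n p, ⟨hS p, hZZ' hp⟩, hE p⟩⟩
    rw [hset]
    exact (hZo.preimage (continuous_proj n)).sdiff
      (isClosed_iUnion_of_finite fun x => isClosed_sheet_image _ _ hZcl)
  have hmpow : ∀ p ∈ C, c.chart (proj n p) = m p ^ k := by
    intro p hp
    obtain ⟨s, e, w, hw, hs, hg, rfl⟩ := (hmemC p).1 hp
    rw [hm s e w hw hs hg, hvpow s e w hg, proj_sheet hs, hright]
  -- On `C`, the preimage of a closed set is a finite union of sheet images of compact sets.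
  have hmc : ContinuousOn m C := by
    rw [continuousOn_iff_isClosed]
    intro A hA
    refine ⟨⋃ x : {x : Bool × ι // good x.1 x.2}, sheet n x.1.1 x.1.2 ''
      (hemi x.1.1 ∩ (c.chart.symm '' (Metric.closedBall 0 1 ∩
        ({w | 0 ≤ side x.1.1 * w.im} ∩ v x.1.1 x.1.2 ⁻¹' A)))), ?_, ?_⟩
    · refine isClosed_iUnion_of_finite fun x => isClosed_sheet_image _ _ ?_
      refine (IsCompact.image ?_ hsc).isClosed
      refine (isCompact_closedBall 0 1).inter_right ?_
      have hcl : IsClosed {w : ℂ | 0 ≤ side x.1.1 * w.im} :=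
        isClosed_le continuous_const (by fun_prop)
      refine ContinuousOn.preimage_isClosed_of_isClosed ?_ hcl hA
      intro w hw
      exact ((continuousAt_halfRoot hk hw).mul continuousAt_const).continuousWithinAt
    · ext p
      simp only [Set.mem_inter_iff, Set.mem_preimage, Set.mem_iUnion]
      constructor
      · rintro ⟨hpA, hpC⟩
        refine ⟨?_, hpC⟩
        obtain ⟨s, e, w, hw, hs, hg, rfl⟩ := (hmemC p).1 hpC
        rw [hm s e w hw hs hg] at hpA
        exact ⟨⟨(s, e), hg⟩, _, ⟨hs, w, ⟨by simpa using hw, (c.mem_hemi s w).1 hs, hpA⟩, rfl⟩, rfl⟩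
      · rintro ⟨⟨⟨⟨s, e⟩, hg⟩, _, ⟨hs, w, ⟨hw, -, hwA⟩, rfl⟩, rfl⟩, hpC⟩
        refine ⟨?_, hpC⟩
        rw [hm s e w (by simpa using hw) hs hg]
        exact hwA
  -- For injectivity, two points over the same `w` are first put in sheets over the same hemisphere,
  -- where `θ` distinguishes them.
  have hrep : ∀ w, ‖w‖ ≤ 1 → w ≠ 0 → ∀ s e t, c.chart.symm w ∈ hemi s → c.chart.symm w ∈ hemi t →
      good s e → ∃ e', good t e' ∧ sheet n s e (c.chart.symm w) = sheet n t e' (c.chart.symm w) := by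
    intro w hw hw0 s e t hs ht hg
    by_cases hst : s = t
    · subst hst; exact ⟨e, hg, rfl⟩
    · obtain ⟨j, hj⟩ : ∃ j, c.chart.symm w ∈ arc j := by
        cases s <;> cases t <;> first | exact absurd rfl hst | skip
        · exact mem_arc_of_mem_hemi ht hs
        · exact mem_arc_of_mem_hemi hs ht
      have hgl : Glued n (c.chart.symm w) s e t ((adj n t j)⁻¹ (adj n s j e)) :=
        Or.inr (Or.inl ⟨j, hj, by simp⟩)
      exact ⟨_, hgood w hw _ _ _ _ hgl hg, (sheet_eq_iff hs ht).2 hgl⟩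
  have hmi : Set.InjOn m C := by
    intro p hp p' hp' h
    have h1 := hmpow p hp
    rw [h, ← hmpow p' hp'] at h1
    obtain ⟨s, e, w, hw, hs, hg, rfl⟩ := (hmemC p).1 hp
    obtain ⟨s', e', w', hw', hs', hg', rfl⟩ := (hmemC p').1 hp'
    rw [proj_sheet hs, proj_sheet hs', hright, hright] at h1
    subst h1
    by_cases hw0 : w = 0
    · subst hw0
      rw [c.symm_zero] at hs hs' ⊢
      rw [sheet_eq_iff hs hs', hz]
      exact Equiv.Perm.SameCycle.trans (Equiv.Perm.SameCycle.symm hg) hg'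
    · obtain ⟨e'', hg'', heq⟩ := hrep w hw hw0 s' e' s hs' hs hg'
      rw [heq, hm s e w hw hs hg, hm s e'' w hw hs hg''] at h
      have h2 : adj n s i e = adj n s i e'' :=
        hθi _ _ hg hg'' (mul_left_cancel₀ (halfRoot_ne_zero hk hw0) h)
      rw [heq, (adj n s i).injective h2]
  have hp₀ : sheet n true e₀ z₀ ∈ C := (hmemC _).2 ⟨true, e₀, 0, by simp,
    (c.mem_hemi _ _).2 (by simp), Equiv.Perm.SameCycle.refl _ _, by rw [c.symm_zero]⟩
  have hz₀ : z₀ ∈ hemi true := c.symm_zero ▸ (c.mem_hemi true 0).2 (by simp)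
  have hz₀Z : z₀ ∈ Z' := ⟨0, by simp, c.symm_zero⟩
  have hmV : m '' (proj n ⁻¹' Z' ∩ C) = Metric.ball 0 1 := by
    ext y
    constructor
    · rintro ⟨p, ⟨⟨w, hw, hwp⟩, hpC⟩, rfl⟩
      have h1 := hmpow p hpC
      rw [← hwp, hright] at h1
      have h2 : ‖m p‖ ^ k < 1 := by rw [← norm_pow, ← h1]; simpa using hw
      simpa using (pow_lt_one_iff_of_nonneg (norm_nonneg _) hk.ne').1 h2
    · intro hy
      have hy1 : ‖y‖ < 1 := by simpa using hy
      have hyk : ‖y ^ k‖ < 1 := by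
        rw [norm_pow]; exact pow_lt_one₀ (norm_nonneg _) hy1 hk.ne'
      by_cases hy0 : y = 0
      · subst hy0
        refine ⟨_, ⟨?_, hp₀⟩, ?_⟩
        · rw [Set.mem_preimage, proj_sheet hz₀]; exact hz₀Z
        · have h1 := hmpow _ hp₀
          rw [proj_sheet hz₀, hc0] at h1
          exact eq_zero_of_pow_eq_zero h1.symm
      · obtain ⟨s, hs⟩ : ∃ s, c.chart.symm (y ^ k) ∈ hemi s := by
          rcases mem_hemi_or (c.chart.symm (y ^ k)) with h | h <;> exact ⟨_, h⟩
        have hr0 := halfRoot_ne_zero hk (s := s) (pow_ne_zero k hy0)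
        -- The number `y` and the chosen root of `y ^ k` differ by a `k`-th root of unity, which
        -- selects the sheet.
        obtain ⟨e₁, he₁, hθ₁⟩ := hθs (y / halfRoot k s (y ^ k)) (by
          rw [div_pow, halfRoot_pow hk, div_self (pow_ne_zero k hy0)])
        have hg : good s ((adj n s i)⁻¹ e₁) := by
          change π.SameCycle _ _
          simpa using he₁
        refine ⟨sheet n s ((adj n s i)⁻¹ e₁) (c.chart.symm (y ^ k)), ⟨?_, ?_⟩, ?_⟩
        · rw [Set.mem_preimage, proj_sheet hs]
          exact ⟨y ^ k, by simpa using hyk, rfl⟩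
        · exact (hmemC _).2 ⟨s, _, y ^ k, hyk.le, hs, hg, rfl⟩
        · rw [hm s _ _ hyk.le hs hg]
          have h1 : adj n s i ((adj n s i)⁻¹ e₁) = e₁ := by simp
          simp only [v]
          rw [h1, hθ₁, mul_div_cancel₀ _ hr0]
  have hp₀V : sheet n true e₀ z₀ ∈ proj n ⁻¹' Z' ∩ C :=
    ⟨by rw [Set.mem_preimage, proj_sheet hz₀]; exact hz₀Z, hp₀⟩
  obtain ⟨φ, hφs, hφ⟩ := exists_openPartialHomeomorph_of_isCompact hCcl.isCompact hmc hmi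
    Set.inter_subset_right hVo (hmV ▸ Metric.isOpen_ball) ⟨_, hp₀V⟩
  have hm0 : m (sheet n true e₀ z₀) = 0 := by
    have h1 := hmpow _ hp₀
    rw [proj_sheet hz₀, hc0] at h1
    exact eq_zero_of_pow_eq_zero h1.symm
  refine ⟨φ, c.chart, hφs ▸ hp₀V, by rw [hφ, hm0], ?_, ?_, ?_⟩
  · rw [proj_sheet hz₀]; exact hsrc0
  · rw [proj_sheet hz₀, hc0]
  · intro p hp
    rw [hφs] at hp
    rw [hφ]
    refine ⟨?_, hmpow p hp.2⟩
    obtain ⟨w, -, hw⟩ := hp.1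
    rw [← hw]
    exact hsrc w

/-- Over a regular point of an arc the two sides of the corner coincide, so the monodromy is `n i *
(n i)⁻¹ = 1` and the index is 1. -/
theorem exists_hasRamificationIndex [Finite ι] (p : GluedSurface n) :
    ∃ k, (proj n p ∉ Set.range branchPt → k = 1) ∧ HasRamificationIndex (proj n) p k := by
  obtain ⟨s, e, hs, he⟩ := exists_rep p
  rw [← he]
  rcases mem_openHemi_or_arc hs with h | ⟨i, hi⟩
  · exact ⟨1, fun _ => rfl, hasRamificationIndex_openHemi e h⟩
  · rw [← sheet_adj hi]
    by_cases hb : proj n p ∈ Set.range branchPt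
    · obtain ⟨j, hj⟩ := hb
      rw [← hj] at hs ⊢
      obtain ⟨c⟩ := exists_corner_branchPt j
      obtain ⟨k, -, hk⟩ := hasRamificationIndex_corner (n := n) c
        (fun _ _ _ _ => glued_branchPt_iff) (adj n s i e)
      exact ⟨k, fun h => absurd ⟨j, (proj_sheet (branchPt_mem_hemi j true)).symm⟩ h, hk⟩
    · obtain ⟨c⟩ := exists_corner_openArc (mem_openArc_iff.2 ⟨hi, hb⟩)
      obtain ⟨k, hk1, hk⟩ := hasRamificationIndex_corner (n := n) c
        (fun s s' e e' => by
          rw [mul_inv_cancel, glued_arc_iff hi hb, Equiv.Perm.sameCycle_one]) (adj n s i e)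
      exact ⟨k, fun _ => hk1 (mul_inv_cancel _), hk⟩

/-- Every transitive gluing datum with labelled cycles comes from a dessin. -/
theorem exists_dessin [Finite ι] [Nonempty ι] {np nm : ℕ} (h0 : n 0 = 1)
    (htr : ∀ Q : Set ι, (∀ i e, n i e ∈ Q ↔ e ∈ Q) → Q.Nonempty → Q = Set.univ)
    {zl : ι → Fin np} (hzl : Function.Surjective zl)
    (hzl' : ∀ e e', zl e = zl e' ↔ (mon n 0).SameCycle e e')
    {pl : ι → Fin nm} (hpl : Function.Surjective pl)
    (hpl' : ∀ e e', pl e = pl e' ↔ (mon n 2).SameCycle e e') :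
    ∃ (D : Dessin np nm) (σ : Sheeting D.f ι n),
      (∀ e, σ.sheet true e (branchPt 0) = D.zeroLabel (zl e)) ∧
      ∀ e, σ.sheet true e (branchPt 2) = D.poleLabel (pl e) := by
  have hlab : ∀ (i : Fin 3) {N : ℕ} {l : ι → Fin N}, Function.Surjective l →
      (∀ e e', l e = l e' ↔ (mon n i).SameCycle e e') →
      ∃ L : Fin N ≃ {p : GluedSurface n // proj n p = branchPt i},
        ∀ e, sheet n true e (branchPt i) = L (l e) := by
    intro i N l hl hl'
    have hi := branchPt_mem_hemi i true
    have hsame : ∀ e e', sheet n true e (branchPt i) = sheet n true e' (branchPt i) ↔ l e = l e' :=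
      fun e e' => by rw [sheet_eq_iff hi hi, glued_branchPt_iff, hl']; rfl
    obtain ⟨g, hg⟩ := hl.hasRightInverse
    refine ⟨Equiv.ofBijective (fun a => ⟨sheet n true (g a) (branchPt i), proj_sheet hi⟩)
      ⟨fun a b h => ?_, fun p => ?_⟩, fun e => (hsame _ _).2 (hg (l e)).symm⟩
    · have h1 := (hsame _ _).1 (Subtype.ext_iff.1 h)
      rwa [hg, hg] at h1
    · obtain ⟨p, hp⟩ := p
      obtain ⟨s, e, hs, he⟩ := exists_rep p
      rw [hp] at he
      rw [← sheet_adj (branchPt_mem_arc_self i)] at he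
      refine ⟨l (adj n s i e), Subtype.ext ?_⟩
      change sheet n true (g (l (adj n s i e))) (branchPt i) = p
      rw [(hsame _ _).2 (hg _), he]
  obtain ⟨Lz, hLz⟩ := hlab 0 hzl hzl'
  obtain ⟨Lp, hLp⟩ := hlab 2 hpl hpl'
  have := connectedSpace h0 htr
  refine ⟨⟨GluedSurface n, proj n, continuous_proj n, fun p => ?_, fun p h1 h2 h3 => ?_, Lz, Lp⟩,
    ⟨sheet n, continuousOn_sheet, fun s e z hz => proj_sheet hz, fun s z hz hb p hp => ?_,
      fun i e z hz => (sheet_adj hz false e).symm⟩, hLz, hLp⟩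
  · obtain ⟨k, -, hk⟩ := exists_hasRamificationIndex p
    exact ⟨k, hk⟩
  · obtain ⟨k, hk1, hk⟩ := exists_hasRamificationIndex p
    rw [hk1] at hk
    · exact hk
    · rintro ⟨i, hi⟩
      fin_cases i
      · exact h1 hi.symm
      · exact h2 hi.symm
      · exact h3 hi.symm
  · change proj n p = z at hp
    obtain ⟨s', e', hs', he'⟩ := exists_rep p
    rw [hp] at hs' he'
    have hex : ∃ e, Glued n z s e s' e' := by
      by_cases hss : s = s'
      · exact ⟨e', Or.inl ⟨hss, rfl⟩⟩
      · obtain ⟨j, hj⟩ : ∃ j, z ∈ arc j := by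
          cases s <;> cases s' <;> first | exact absurd rfl hss | skip
          · exact mem_arc_of_mem_hemi hs' hz
          · exact mem_arc_of_mem_hemi hz hs'
        exact ⟨(adj n s j)⁻¹ (adj n s' j e'), Or.inr (Or.inl ⟨j, hj, by simp⟩)⟩
    obtain ⟨e, he⟩ := hex
    refine ⟨e, ((sheet_eq_iff hz hs').2 he).trans he', fun e'' he'' => ?_⟩
    have h1 : Glued n z s e'' s e := (sheet_eq_iff hz hz).1
      (he''.trans (((sheet_eq_iff hz hs').2 he).trans he').symm)
    by_cases ha : ∃ j, z ∈ arc j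
    · obtain ⟨j, hj⟩ := ha
      exact (adj n s j).injective ((glued_arc_iff hj hb).1 h1)
    · push Not at ha
      exact ((glued_iff_of_notMem_arc ha).1 h1).2

end GluedSurface

end CornerChart

/-! ## The positive half-edges of an oriented ribbon graph -/

theorem cell_eq_iff {X : Type*} {s : Equiv.Perm X} {e e' : X} :
    cell s e = cell s e' ↔ s.SameCycle e e' := Quotient.eq

theorem exists_cell {X : Type*} {s : Equiv.Perm X} (c : Cell s) : ∃ e, cell s e = c :=
  Quotient.exists_rep c

theorem neg_one_ne_one : (-1 : ℤˣ) ≠ 1 := by decide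

theorem sign_ne_one_iff {u : ℤˣ} : u ≠ 1 ↔ u = -1 :=
  ⟨fun h => (Int.units_eq_one_or u).resolve_left h, fun h => h ▸ neg_one_ne_one⟩

namespace OrientedRibbonGraph

variable {np nm : ℕ} (R : OrientedRibbonGraph np nm)

theorem s1_mul_self : R.s1 * R.s1 = 1 := Equiv.ext R.s1_invol

theorem s1_inv : R.s1⁻¹ = R.s1 := inv_eq_of_mul_eq_one_left R.s1_mul_self

theorem s2_s0 (x : R.X) : R.s2 (R.s0 x) = R.s1 x := by simp [RibbonGraph.s2]

theorem s0_eq : R.s0 = R.s2⁻¹ * R.s1 := by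
  ext x
  rw [Equiv.Perm.mul_apply, Equiv.Perm.eq_inv_iff_eq, s2_s0]

theorem ε_s2_inv (x : R.X) : R.ε (R.s2⁻¹ x) = R.ε x := by
  rw [← R.ε_s2 (R.s2⁻¹ x)]
  simp

theorem ε_s0 (x : R.X) : R.ε (R.s0 x) = - R.ε x := by
  rw [s0_eq, Equiv.Perm.mul_apply, ε_s2_inv, R.ε_s1]

theorem face_eq_iff {x y : R.X} : R.face x = R.face y ↔ R.s2.SameCycle x y := cell_eq_iff

theorem vertex_eq_iff {x y : R.X} : R.vertex x = R.vertex y ↔ R.s0.SameCycle x y := cell_eq_iff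

theorem ε_eq_of_face_eq {x y : R.X} (h : R.face x = R.face y) : R.ε x = R.ε y := by
  obtain ⟨k, rfl⟩ := R.face_eq_iff.1 h
  clear h
  induction k with
  | zero => simp
  | succ k ih => rwa [add_comm, zpow_add, zpow_one, Equiv.Perm.mul_apply, R.ε_s2]
  | pred k ih => rwa [sub_eq_neg_add, zpow_add, zpow_neg_one, Equiv.Perm.mul_apply, ε_s2_inv]

/-- The positive half-edges. -/
abbrev PosHalf : Type := {x : R.X // R.ε x = 1}

theorem ε_s1_pos (e : R.PosHalf) : R.ε (R.s1 e) = -1 := by rw [R.ε_s1, e.2]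

/-- The next half-edge along a positive boundary. -/
def posNext : Equiv.Perm R.PosHalf := R.s2.subtypePerm fun x => by rw [R.ε_s2]

/-- The next edge along a negative boundary. -/
def negNext : Equiv.Perm R.PosHalf :=
  (R.s1 * R.s2 * R.s1).subtypePerm fun x => by
    simp only [Equiv.Perm.mul_apply, R.ε_s1, R.ε_s2, neg_neg]

@[simp] theorem coe_posNext (e : R.PosHalf) : (R.posNext e : R.X) = R.s2 e := rfl

@[simp] theorem coe_negNext (e : R.PosHalf) : (R.negNext e : R.X) = R.s1 (R.s2 (R.s1 e)) := rfl

/-- The gluing of the hemispheres: every edge is dual to the arc `[∞, 0]`. -/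
def gluing : Fin 3 → Equiv.Perm R.PosHalf := ![1, R.posNext, R.negNext⁻¹]

@[simp] theorem gluing_zero : R.gluing 0 = 1 := rfl
@[simp] theorem gluing_one : R.gluing 1 = R.posNext := rfl
@[simp] theorem gluing_two : R.gluing 2 = R.negNext⁻¹ := rfl

theorem mon_gluing_zero : mon R.gluing 0 = R.posNext := by simp [mon]

theorem mon_gluing_one : mon R.gluing 1 = R.negNext⁻¹ * R.posNext⁻¹ := by
  simp [mon]

theorem mon_gluing_two : mon R.gluing 2 = R.negNext := by
  simp [mon, show (2 : Fin 3) + 1 = 0 from rfl]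

theorem sameCycle_mon_zero_iff {e e' : R.PosHalf} :
    (mon R.gluing 0).SameCycle e e' ↔ R.face e = R.face e' := by
  rw [mon_gluing_zero, face_eq_iff, posNext, Equiv.Perm.sameCycle_subtypePerm]

theorem sameCycle_mon_two_iff {e e' : R.PosHalf} :
    (mon R.gluing 2).SameCycle e e' ↔ R.face (R.s1 e) = R.face (R.s1 e') := by
  rw [mon_gluing_two, face_eq_iff, negNext, Equiv.Perm.sameCycle_subtypePerm]
  nth_rw 2 [← R.s1_inv]
  rw [Equiv.Perm.sameCycle_conj, R.s1_inv]

/-- By `s0 * s1 * s2 = 1`, undoing a step along a positive and then along a negative boundary is two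
turns about the vertex of `s1 e`. Two are needed because one turn reverses the sign. -/
theorem coe_mon_one (e : R.PosHalf) :
    (mon R.gluing 1 e : R.X) = R.s1 (R.s0 (R.s0 (R.s1 e))) := by
  obtain ⟨e, rfl⟩ := R.posNext.surjective e
  obtain ⟨e, rfl⟩ := R.negNext.surjective e
  rw [mon_gluing_one]
  have h : (R.negNext⁻¹ * R.posNext⁻¹) (R.posNext (R.negNext e)) = e := by simp
  rw [h]
  simp only [coe_posNext, coe_negNext]
  have h0 : ∀ x, R.s0 (R.s1 (R.s2 x)) = x := fun x => by
    rw [s0_eq, Equiv.Perm.mul_apply, R.s1_invol]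
    simp
  rw [h0, h0, R.s1_invol]

theorem s0_zpow_ε (k : ℤ) (x : R.X) :
    R.ε ((R.s0 ^ k) x) = R.ε x ↔ Even k := by
  have key : R.ε ((R.s0 ^ k) x) = if Even k then R.ε x else - R.ε x := by
    induction k with
    | zero => simp
    | succ k ih =>
      rw [add_comm, zpow_add, zpow_one, Equiv.Perm.mul_apply, R.ε_s0, ih]
      have h1 : Even (1 + (k : ℤ)) ↔ ¬ Even (k : ℤ) := by rw [add_comm]; exact Int.even_add_one
      by_cases hk : Even (k : ℤ)
      · rw [if_pos hk, if_neg (by rwa [h1, not_not])]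
      · rw [if_neg hk, if_pos (h1.2 hk), neg_neg]
    | pred k ih =>
      have h : R.ε ((R.s0 ^ (-(k : ℤ))) x) = - R.ε ((R.s0 ^ (-(k : ℤ) - 1)) x) := by
        rw [← R.ε_s0, ← Equiv.Perm.mul_apply, ← zpow_one_add, add_sub_cancel]
      rw [h, neg_eq_iff_eq_neg] at ih
      rw [ih]
      by_cases hk : Even (-(k : ℤ))
      · have h1 : ¬ Even (-(k : ℤ) - 1) := by rw [Int.even_sub_one]; simpa using hk
        simp [hk, h1]
      · have h1 : Even (-(k : ℤ) - 1) := by rw [Int.even_sub_one]; simpa using hk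
        rw [if_neg hk, if_pos h1, neg_neg]
  rw [key]
  split_ifs with h
  · simp [h]
  · simp only [h, iff_false]
    intro h1
    rcases Int.units_eq_one_or (R.ε x) with h2 | h2 <;> rw [h2] at h1 <;> revert h1 <;> decide

/-- Powers of `s0` joining two half-edges of the same sign are even, so the cycles of `s0 ^ 2` on
the negative half-edges are the vertices. -/
theorem sameCycle_mon_one_iff {e e' : R.PosHalf} :
    (mon R.gluing 1).SameCycle e e' ↔ R.vertex (R.s1 e) = R.vertex (R.s1 e') := by
  have hmon : mon R.gluing 1 = (R.s1 * (R.s0 ^ (2 : ℤ)) * R.s1⁻¹).subtypePerm (fun x => by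
      simp [zpow_ofNat, pow_two, R.s1_inv, R.ε_s1, R.ε_s0]) := by
    ext e
    rw [coe_mon_one]
    simp [R.s1_inv, zpow_ofNat, pow_two]
  rw [hmon, vertex_eq_iff, Equiv.Perm.sameCycle_subtypePerm, Equiv.Perm.sameCycle_conj, R.s1_inv]
  constructor
  · rintro ⟨k, hk⟩
    exact ⟨2 * k, by rw [zpow_mul, hk]⟩
  · rintro ⟨k, hk⟩
    have h1 : Even k := by
      rw [← R.s0_zpow_ε k (R.s1 e), hk, ε_s1_pos, ε_s1_pos]
    obtain ⟨m, rfl⟩ := h1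
    exact ⟨m, by rw [← zpow_mul, two_mul, hk]⟩

theorem exists_pos_vertex (v : R.Vertex) : ∃ e : R.PosHalf, R.vertex (R.s1 e) = v := by
  obtain ⟨x, rfl⟩ := exists_cell v
  by_cases hx : R.ε x = 1
  · refine ⟨⟨R.s1 (R.s0 x), by rw [R.ε_s1, R.ε_s0, hx, neg_neg]⟩, ?_⟩
    rw [R.s1_invol]
    exact R.vertex_eq_iff.2 (Equiv.Perm.SameCycle.symm ⟨1, by simp⟩)
  · refine ⟨⟨R.s1 x, by rw [R.ε_s1, sign_ne_one_iff.1 hx, neg_neg]⟩, ?_⟩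
    rw [R.s1_invol]
    rfl

/-- The signs alternate around a vertex. Both halves are identified with the same set of positive
half-edges: the negative ones by `s1`, the positive ones by one turn followed by `s1`. -/
theorem cellSize_vertex (v : R.Vertex) :
    cellSize R.s0 v = 2 * Nat.card {e : R.PosHalf // R.vertex (R.s1 e) = v} := by
  have hsum : {x // R.vertex x = v} ≃
      {e : R.PosHalf // R.vertex (R.s1 e) = v} ⊕ {e : R.PosHalf // R.vertex (R.s1 e) = v} := by
    classical
    have hs0 : ∀ x, R.vertex (R.s0 x) = R.vertex x := fun x =>
      R.vertex_eq_iff.2 (Equiv.Perm.SameCycle.symm ⟨1, by simp⟩)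
    refine (Equiv.sumCompl fun x : {x // R.vertex x = v} => R.ε x = 1).symm.trans
      (Equiv.sumCongr ?_ ?_)
    · exact
        { toFun := fun x => ⟨⟨R.s1 (R.s0 x.1), by rw [R.ε_s1, R.ε_s0, x.2, neg_neg]⟩, by
            rw [R.s1_invol, hs0]; exact x.1.2⟩
          invFun := fun e => ⟨⟨R.s0⁻¹ (R.s1 e.1), by
            rw [← hs0]; simpa using e.2⟩, by
            have h := R.ε_s0 (R.s0⁻¹ (R.s1 e.1))
            rw [show R.s0 (R.s0⁻¹ (R.s1 e.1)) = R.s1 e.1 by simp, ε_s1_pos, neg_inj] at h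
            exact h.symm⟩
          left_inv := fun x => by ext; simp [R.s1_invol]
          right_inv := fun e => by ext; simp [R.s1_invol] }
    · exact
        { toFun := fun x => ⟨⟨R.s1 x.1, by rw [R.ε_s1, sign_ne_one_iff.1 x.2, neg_neg]⟩, by
            rw [R.s1_invol]; exact x.1.2⟩
          invFun := fun e => ⟨⟨R.s1 e.1, e.2⟩, by rw [ε_s1_pos]; exact neg_one_ne_one⟩
          left_inv := fun x => by ext; simp [R.s1_invol]
          right_inv := fun e => by ext; simp [R.s1_invol] }
  rw [two_mul, ← Nat.card_sum, ← Nat.card_congr hsum]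
  rfl

/-! ### Labels -/

theorem exists_posLabel (e : R.PosHalf) : ∃ i, R.face e = R.posLabel i :=
  ⟨R.posLabel.symm ⟨R.face e, fun y hy => (R.ε_eq_of_face_eq hy).trans e.2⟩, by simp⟩

theorem exists_negLabel (e : R.PosHalf) : ∃ j, R.face (R.s1 e) = R.negLabel j :=
  ⟨R.negLabel.symm ⟨R.face (R.s1 e), fun y hy => (R.ε_eq_of_face_eq hy).trans (R.ε_s1_pos e)⟩,
    by simp⟩

theorem posLabel_injective {i i' : Fin np} (h : (R.posLabel i : R.Face) = R.posLabel i') : i = i' :=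
  R.posLabel.injective (Subtype.ext h)

theorem negLabel_injective {i i' : Fin nm} (h : (R.negLabel i : R.Face) = R.negLabel i') : i = i' :=
  R.negLabel.injective (Subtype.ext h)

theorem exists_face_eq_posLabel (i : Fin np) : ∃ e : R.PosHalf, R.face e = R.posLabel i := by
  obtain ⟨x, hx⟩ := exists_cell (R.posLabel i).1
  exact ⟨⟨x, (R.posLabel i).2 x hx⟩, hx⟩

theorem exists_face_eq_negLabel (j : Fin nm) :
    ∃ e : R.PosHalf, R.face (R.s1 e) = R.negLabel j := by
  obtain ⟨x, hx⟩ := exists_cell (R.negLabel j).1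
  refine ⟨⟨R.s1 x, ?_⟩, ?_⟩
  · rw [R.ε_s1, (R.negLabel j).2 x hx, neg_neg]
  · rw [R.s1_invol]; exact hx

theorem posDegree_eq (i : Fin np) :
    R.posDegree i = Nat.card {e : R.PosHalf // R.face e = R.posLabel i} :=
  Nat.card_congr
    { toFun := fun x => ⟨⟨x, (R.posLabel i).2 x x.2⟩, x.2⟩
      invFun := fun e => ⟨e.1, e.2⟩
      left_inv := fun _ => rfl
      right_inv := fun _ => rfl }

theorem negDegree_eq (j : Fin nm) :
    R.negDegree j = Nat.card {e : R.PosHalf // R.face (R.s1 e) = R.negLabel j} :=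
  Nat.card_congr
    { toFun := fun x => ⟨⟨R.s1 x, by rw [R.ε_s1, (R.negLabel j).2 x x.2, neg_neg]⟩, by
        rw [R.s1_invol]; exact x.2⟩
      invFun := fun e => ⟨R.s1 e.1, e.2⟩
      left_inv := fun x => by ext; simp [R.s1_invol]
      right_inv := fun x => by ext; simp [R.s1_invol] }

instance : Nonempty R.PosHalf := by
  obtain ⟨x⟩ := R.nonemptyX
  by_cases hx : R.ε x = 1
  · exact ⟨⟨x, hx⟩⟩
  · exact ⟨⟨R.s1 x, by rw [R.ε_s1, sign_ne_one_iff.1 hx, neg_neg]⟩⟩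

/-- Adding the opposite half-edges to an invariant `Q` gives a set stable under `s1` and `s2`, hence
under the transitive group generated by `s0` and `s1`. -/
theorem gluing_transitive {Q : Set R.PosHalf} (hQ : ∀ i e, R.gluing i e ∈ Q ↔ e ∈ Q)
    (hne : Q.Nonempty) : Q = Set.univ := by
  let P : Set R.X := {x | ∃ e ∈ Q, x = e ∨ x = R.s1 e}
  have h1 : ∀ x, R.s1 x ∈ P ↔ x ∈ P := by
    have h : ∀ x, x ∈ P → R.s1 x ∈ P := by
      rintro _ ⟨e, he, rfl | rfl⟩
      · exact ⟨e, he, Or.inr rfl⟩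
      · exact ⟨e, he, Or.inl (R.s1_invol _)⟩
    exact fun x => ⟨fun hx => by simpa [R.s1_invol] using h _ hx, h x⟩
  have hneg : ∀ e, R.negNext e ∈ Q ↔ e ∈ Q := fun e => by
    rw [← hQ 2 (R.negNext e)]
    simp
  have h2 : ∀ x, R.s2⁻¹ x ∈ P ↔ x ∈ P := by
    have h : ∀ x, R.s2 x ∈ P ↔ x ∈ P := by
      intro x
      by_cases hx : R.ε x = 1
      · have hmem : ∀ e : R.PosHalf, (e : R.X) ∈ P ↔ e ∈ Q := by
          intro e
          refine ⟨?_, fun h => ⟨e, h, Or.inl rfl⟩⟩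
          rintro ⟨e', he', h | h⟩
          · rwa [Subtype.ext h]
          · have := R.ε_s1_pos e'
            rw [← h, e.2] at this
            exact absurd this.symm neg_one_ne_one
        exact (hmem (R.posNext ⟨x, hx⟩)).trans ((hQ 1 _).trans (hmem ⟨x, hx⟩).symm)
      · have hmem : ∀ e : R.PosHalf, R.s1 e ∈ P ↔ e ∈ Q := by
          intro e
          refine ⟨?_, fun h => ⟨e, h, Or.inr rfl⟩⟩
          rintro ⟨e', he', h | h⟩
          · have := R.ε_s1_pos e
            rw [h, e'.2] at this
            exact absurd this.symm neg_one_ne_one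
          · rwa [Subtype.ext (R.s1.injective h)]
        have hx' : R.ε (R.s1 x) = 1 := by rw [R.ε_s1, sign_ne_one_iff.1 hx, neg_neg]
        have h3 := (hmem (R.negNext ⟨_, hx'⟩)).trans ((hneg _).trans (hmem ⟨_, hx'⟩).symm)
        simpa [R.s1_invol] using h3
    intro x
    rw [← h]
    simp
  have h0 : ∀ x, R.s0 x ∈ P ↔ x ∈ P := fun x => by
    rw [s0_eq, Equiv.Perm.mul_apply, h2, h1]
  have hcl : ∀ σ ∈ Subgroup.closure ({R.s0, R.s1} : Set (Equiv.Perm R.X)), ∀ x,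
      σ x ∈ P ↔ x ∈ P := by
    intro σ hσ
    induction hσ using Subgroup.closure_induction with
    | mem τ hτ =>
      rcases hτ with rfl | rfl
      · exact h0
      · exact h1
    | one => simp
    | mul τ τ' _ _ ih ih' => intro x; rw [Equiv.Perm.mul_apply, ih, ih']
    | inv τ _ ih => intro x; rw [← ih]; simp
  ext e
  simp only [Set.mem_univ, iff_true]
  obtain ⟨e', he'⟩ := hne
  obtain ⟨σ, hσ, h⟩ := R.connected e' e
  have h3 : (e : R.X) ∈ P := h ▸ (hcl σ hσ _).2 ⟨e', he', Or.inl rfl⟩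
  obtain ⟨e'', he'', h4 | h4⟩ := h3
  · rwa [Subtype.ext h4]
  · have := R.ε_s1_pos e''
    rw [← h4, e.2] at this
    exact absurd this.symm neg_one_ne_one

/-! ### Isomorphisms -/

variable {R} {R' : OrientedRibbonGraph np nm}

theorem IsIso.map_s2 {φ : R.X ≃ R'.X} (h : IsIso R R' φ) (x : R.X) :
    φ (R.s2 x) = R'.s2 (φ x) := by
  obtain ⟨y, rfl⟩ := R.s0.surjective x
  rw [s2_s0, h.1, s2_s0, h.2.1]

/-- An isomorphism of ribbon graphs, as a bijection of the positive half-edges. -/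
structure IsPosIso (R R' : OrientedRibbonGraph np nm) (ψ : R.PosHalf ≃ R'.PosHalf) : Prop where
  gluing : ∀ i e, ψ (R.gluing i e) = R'.gluing i (ψ e)
  pos : ∀ (e : R.PosHalf) i, R.face e = R.posLabel i → R'.face (ψ e) = R'.posLabel i
  neg : ∀ (e : R.PosHalf) j, R.face (R.s1 e) = R.negLabel j →
    R'.face (R'.s1 (ψ e)) = R'.negLabel j

theorem IsPosIso.posNext {ψ : R.PosHalf ≃ R'.PosHalf} (h : IsPosIso R R' ψ) (e : R.PosHalf) :
    ψ (R.posNext e) = R'.posNext (ψ e) := h.gluing 1 e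

theorem IsPosIso.negNext {ψ : R.PosHalf ≃ R'.PosHalf} (h : IsPosIso R R' ψ) (e : R.PosHalf) :
    ψ (R.negNext e) = R'.negNext (ψ e) := by
  have := h.gluing 2 (R.negNext e)
  rw [gluing_two, gluing_two, show R.negNext⁻¹ (R.negNext e) = e by simp] at this
  rw [this]
  simp

theorem IsIso.exists_isPosIso {φ : R.X ≃ R'.X} (h : IsIso R R' φ) :
    ∃ ψ, IsPosIso R R' ψ ∧ ∀ e, (ψ e : R'.X) = φ e := by
  refine ⟨φ.subtypeEquiv fun x => by rw [h.2.2.1], ⟨fun i e => ?_, fun e i hi => ?_,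
    fun e j hj => ?_⟩, fun e => rfl⟩
  · fin_cases i
    · rfl
    · ext
      exact h.map_s2 _
    · obtain ⟨e, rfl⟩ := R.negNext.surjective e
      change (φ.subtypeEquiv _) (R.negNext⁻¹ (R.negNext e)) =
        R'.negNext⁻¹ ((φ.subtypeEquiv _) (R.negNext e))
      rw [Equiv.Perm.eq_inv_iff_eq]
      ext
      simp [h.map_s2, h.2.1]
  · exact (h.2.2.2.1 i e).1 hi
  · have := (h.2.2.2.2 j (R.s1 e)).1 hj
    rwa [h.2.1] at this

theorem IsIso.apply_eq {φ φ' : R.X ≃ R'.X} (h : IsIso R R' φ) (h' : IsIso R R' φ')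
    (heq : ∀ e : R.PosHalf, φ e = φ' e) : φ = φ' := by
  ext x
  by_cases hx : R.ε x = 1
  · exact heq ⟨x, hx⟩
  · have hx' : R.ε (R.s1 x) = 1 := by rw [R.ε_s1, sign_ne_one_iff.1 hx, neg_neg]
    refine R'.s1.injective ?_
    rw [← h.2.1, ← h'.2.1]
    exact heq ⟨_, hx'⟩

/-- The extension to the negative half-edges is forced by `s1`, and compatibility with `s0` follows
from `s1` and `s2`. -/
theorem IsPosIso.exists_isIso {ψ : R.PosHalf ≃ R'.PosHalf} (h : IsPosIso R R' ψ) :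
    ∃ φ, IsIso R R' φ ∧ ∀ e : R.PosHalf, φ e = ψ e := by
  classical
  have hs : ∀ (T : OrientedRibbonGraph np nm) {x : T.X}, ¬ T.ε x = 1 → T.ε (T.s1 x) = 1 := by
    intro T x hx
    rw [T.ε_s1, sign_ne_one_iff.1 hx, neg_neg]
  -- The extension is defined for all pairs of graphs so that the inverse is the extension of
  -- `ψ.symm`.
  let F : ∀ {T T' : OrientedRibbonGraph np nm}, (T.PosHalf ≃ T'.PosHalf) → T.X → T'.X :=
    fun {T T'} χ x => if hx : T.ε x = 1 then χ ⟨x, hx⟩ else T'.s1 (χ ⟨T.s1 x, hs T hx⟩)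
  have hFpos : ∀ {T T' : OrientedRibbonGraph np nm} (χ : T.PosHalf ≃ T'.PosHalf) (e : T.PosHalf),
      F χ e = χ e := fun χ e => dif_pos e.2
  have hFneg : ∀ {T T' : OrientedRibbonGraph np nm} (χ : T.PosHalf ≃ T'.PosHalf) (e : T.PosHalf),
      F χ (T.s1 e) = T'.s1 (χ e) := by
    intro T T' χ e
    have h1 : ¬ T.ε (T.s1 e) = 1 := by rw [ε_s1_pos]; exact neg_one_ne_one
    simp only [F, dif_neg h1]
    congr 3
    ext
    exact T.s1_invol _
  have hcases : ∀ (T : OrientedRibbonGraph np nm) (x : T.X),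
      ∃ e : T.PosHalf, x = e ∨ x = T.s1 e := by
    intro T x
    by_cases hx : T.ε x = 1
    · exact ⟨⟨x, hx⟩, Or.inl rfl⟩
    · exact ⟨⟨T.s1 x, hs T hx⟩, Or.inr (T.s1_invol x).symm⟩
  have hinv : ∀ {T T' : OrientedRibbonGraph np nm} (χ : T.PosHalf ≃ T'.PosHalf) (x : T.X),
      F χ.symm (F χ x) = x := by
    intro T T' χ x
    obtain ⟨e, rfl | rfl⟩ := hcases T x
    · rw [hFpos, hFpos, Equiv.symm_apply_apply]
    · rw [hFneg, hFneg, Equiv.symm_apply_apply]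
  let φ : R.X ≃ R'.X := ⟨F ψ, F ψ.symm, hinv ψ, hinv ψ.symm⟩
  have hφpos : ∀ e : R.PosHalf, φ e = ψ e := hFpos ψ
  have hφneg : ∀ e : R.PosHalf, φ (R.s1 e) = R'.s1 (ψ e) := hFneg ψ
  have h1 : ∀ x, φ (R.s1 x) = R'.s1 (φ x) := by
    intro x
    obtain ⟨e, rfl | rfl⟩ := hcases R x
    · rw [hφneg, hφpos]
    · rw [R.s1_invol, hφneg, hφpos, R'.s1_invol]
  have h2 : ∀ x, φ (R.s2 x) = R'.s2 (φ x) := by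
    intro x
    obtain ⟨e, rfl | rfl⟩ := hcases R x
    · rw [hφpos]
      exact (hφpos (R.posNext e)).trans (congrArg Subtype.val (h.posNext e))
    · refine R'.s1.injective ?_
      rw [← h1, hφneg]
      exact (hφpos (R.negNext e)).trans (congrArg Subtype.val (h.negNext e))
  refine ⟨φ, ⟨fun x => ?_, h1, fun x => ?_, fun i x => ?_, fun j x => ?_⟩, hφpos⟩
  · refine R'.s2.injective ?_
    rw [← h2, R.s2_s0, R'.s2_s0, h1]
  · obtain ⟨e, rfl | rfl⟩ := hcases R x
    · rw [hφpos, (ψ e).2, e.2]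
    · rw [hφneg, ε_s1_pos, ε_s1_pos]
  · obtain ⟨e, rfl | rfl⟩ := hcases R x
    · obtain ⟨i', hi'⟩ := R.exists_posLabel e
      rw [hφpos, h.pos e i' hi', hi']
      exact ⟨fun h => by rw [R.posLabel_injective h],
        fun h => by rw [R'.posLabel_injective h]⟩
    · refine ⟨fun h => ?_, fun h => ?_⟩
      · have := (R.posLabel i).2 _ h
        rw [ε_s1_pos] at this
        exact absurd this neg_one_ne_one
      · have := (R'.posLabel i).2 _ h
        rw [hφneg, ε_s1_pos] at this
        exact absurd this neg_one_ne_one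
  · obtain ⟨e, rfl | rfl⟩ := hcases R x
    · refine ⟨fun h => ?_, fun h => ?_⟩
      · have := (R.negLabel j).2 _ h
        rw [e.2] at this
        exact absurd this.symm neg_one_ne_one
      · have := (R'.negLabel j).2 _ h
        rw [hφpos, (ψ e).2] at this
        exact absurd this.symm neg_one_ne_one
    · obtain ⟨j', hj'⟩ := R.exists_negLabel e
      rw [hφneg, h.neg e j' hj', hj']
      exact ⟨fun h => by rw [R.negLabel_injective h],
        fun h => by rw [R'.negLabel_injective h]⟩

end OrientedRibbonGraph

/-! ## Models: sheetings indexed by the positive half-edges -/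

/-- A multiplicative relation that is total and single-valued in both directions is the graph of an
isomorphism. Automorphisms on the two sides are related only through their action on sheets, which
is such a relation. -/
theorem nonempty_mulEquiv_of_rel {G H : Type*} [Group G] [Group H] (C : G → H → Prop)
    (hG : ∀ g, ∃ h, C g h) (hH : ∀ h, ∃ g, C g h) (huG : ∀ g h h', C g h → C g h' → h = h')
    (huH : ∀ g g' h, C g h → C g' h → g = g')
    (hmul : ∀ g g' h h', C g h → C g' h' → C (g * g') (h * h')) : Nonempty (G ≃* H) := by
  choose F hF using hG
  choose F' hF' using hH
  exact ⟨⟨⟨F, F', fun g => huH _ _ _ (hF' _) (hF g), fun h => huG _ _ _ (hF _) (hF' h)⟩,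
    fun g g' => huG _ _ _ (hF _) (hmul _ _ _ _ (hF g) (hF g'))⟩⟩

namespace Sheeting

/-- Change of the index set of a sheeting. -/
def reindex {S : Type*} [TopologicalSpace S] {f : S → Sphere} {ι ι' : Type*}
    {n : Fin 3 → Equiv.Perm ι} {n' : Fin 3 → Equiv.Perm ι'} (σ : Sheeting f ι n) (φ : ι' ≃ ι)
    (hφ : ∀ i e, φ (n' i e) = n i (φ e)) : Sheeting f ι' n' where
  sheet s e := σ.sheet s (φ e)
  cont s e := σ.cont s (φ e)
  proj s e := σ.proj s (φ e)
  bij s z hz hb p hp := (φ.bijective.existsUnique_iff (p := fun x => σ.sheet s x z = p)).1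
    (σ.bij s z hz hb p hp)
  glue i e z hz := by rw [hφ, σ.glue i _ z hz]

variable {np nm : ℕ} {D D' : Dessin np nm} {ι ι' : Type*}
  {n : Fin 3 → Equiv.Perm ι} {n' : Fin 3 → Equiv.Perm ι'}

/-- A homeomorphism over the sphere carries sheets to sheets, since a section over a closed
hemisphere is a sheet. Surjectivity on sheets comes from transitivity of the gluing of the target.
-/
theorem exists_equiv [Finite ι'] [Nonempty ι] (σ : Sheeting D.f ι n) (σ' : Sheeting D'.f ι' n') (h0 : n 0 = 1)
    (h0' : n' 0 = 1) (h : D.S ≃ₜ D'.S) (hf : ∀ p, D'.f (h p) = D.f p) :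
    ∃ ψ : ι ≃ ι', (∀ i e, ψ (n i e) = n' i (ψ e)) ∧
      ∀ s e, ∀ z ∈ hemi s, h (σ.sheet s e z) = σ'.sheet s (ψ e) z := by
  have hex : ∀ s e, ∃ e', ∀ z ∈ hemi s, h (σ.sheet s e z) = σ'.sheet s e' z := by
    intro s e
    obtain ⟨e', he', -⟩ := σ'.existsUnique_eqOn (s := s) (g := fun z => h (σ.sheet s e z))
      (h.continuous.comp_continuousOn (σ.cont s e)) (fun z hz => by rw [hf, σ.proj s e z hz])
    exact ⟨e', he'⟩
  choose Ψ hΨ using hex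
  have hinj : ∀ i, ∀ e e' : ι', (∀ z ∈ arc i, σ'.sheet true e z = σ'.sheet true e' z) → e = e' := by
    intro i e e' hee
    obtain ⟨z, hz⟩ := openArc_nonempty i
    obtain ⟨hz, hb⟩ := mem_openArc_iff.1 hz
    exact σ'.sheet_injective (arc_subset_hemi i true hz) hb (hee z hz)
  -- Both normalisations `n 0 = 1` enter here: sheets of the same index meet along the arc 0, and
  -- their images still do.
  have hsame : ∀ e, Ψ false e = Ψ true e := by
    intro e
    refine hinj 0 _ _ fun z hz => ?_
    have h1 := hΨ false e z (arc_subset_hemi 0 _ hz)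
    rw [σ.glue 0 e z hz, h0, σ'.glue 0 _ z hz, h0'] at h1
    rw [← hΨ true e z (arc_subset_hemi 0 _ hz)]
    exact h1.symm
  have hcomm : ∀ i e, Ψ true (n i e) = n' i (Ψ true e) := by
    intro i e
    refine hinj i _ _ fun z hz => ?_
    rw [← σ'.glue i _ z hz, ← hΨ true _ z (arc_subset_hemi i _ hz), ← hsame,
      ← hΨ false _ z (arc_subset_hemi i _ hz), σ.glue i e z hz]
  have hbij : Function.Bijective (Ψ true) := by
    constructor
    · intro e e' hee
      obtain ⟨z, hz⟩ := openArc_nonempty 0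
      obtain ⟨hz, hb⟩ := mem_openArc_iff.1 hz
      refine σ.sheet_injective (arc_subset_hemi 0 true hz) hb (h.injective ?_)
      rw [hΨ true _ z (arc_subset_hemi 0 _ hz), hee, hΨ true _ z (arc_subset_hemi 0 _ hz)]
    · rw [← Set.range_eq_univ]
      refine σ'.eq_univ_of_invariant (fun i e' => ⟨?_, ?_⟩) (Set.range_nonempty _)
      · rintro ⟨x, hx⟩
        obtain ⟨y, rfl⟩ := (n i).surjective x
        rw [hcomm] at hx
        exact ⟨y, (n' i).injective hx⟩
      · rintro ⟨x, rfl⟩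
        exact ⟨n i x, hcomm i x⟩
  refine ⟨Equiv.ofBijective _ hbij, hcomm, ?_⟩
  rintro (s | s) e z hz
  · rw [hΨ false e z hz, hsame]; rfl
  · exact hΨ true e z hz

theorem homeomorph_ext [Finite ι] (σ : Sheeting D.f ι n) {h h' : D.S → D'.S}
    (hh : ∀ s e, ∀ z ∈ hemi s, h (σ.sheet s e z) = h' (σ.sheet s e z)) : h = h' := by
  funext p
  obtain ⟨s, e, hs, he⟩ := σ.exists_sheet' p
  rw [← he]
  exact hh s e _ hs

end Sheeting

variable {np nm : ℕ}

/-- A sheeting indexed by the positive half-edges of `R`, compatible with the labels. -/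
structure IsModel (R : OrientedRibbonGraph np nm) (D : Dessin np nm)
    (σ : Sheeting D.f R.PosHalf R.gluing) : Prop where
  zero : ∀ (e : R.PosHalf) i, R.face e = R.posLabel i →
    σ.sheet true e (branchPt 0) = D.zeroLabel i
  pole : ∀ (e : R.PosHalf) j, R.face (R.s1 e) = R.negLabel j →
    σ.sheet true e (branchPt 2) = D.poleLabel j

namespace IsModel

variable {R R' : OrientedRibbonGraph np nm} {D D' : Dessin np nm}
  {σ : Sheeting D.f R.PosHalf R.gluing} {σ' : Sheeting D'.f R'.PosHalf R'.gluing}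

theorem zero_iff (H : IsModel R D σ) {e : R.PosHalf} {i : Fin np} :
    σ.sheet true e (branchPt 0) = D.zeroLabel i ↔ R.face e = R.posLabel i := by
  refine ⟨fun h => ?_, H.zero e i⟩
  obtain ⟨i', hi'⟩ := R.exists_posLabel e
  rw [H.zero e i' hi'] at h
  rwa [← D.zeroLabel.injective (Subtype.ext h)]

theorem pole_iff (H : IsModel R D σ) {e : R.PosHalf} {j : Fin nm} :
    σ.sheet true e (branchPt 2) = D.poleLabel j ↔ R.face (R.s1 e) = R.negLabel j := by
  refine ⟨fun h => ?_, H.pole e j⟩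
  obtain ⟨i', hi'⟩ := R.exists_negLabel e
  rw [H.pole e i' hi'] at h
  rwa [← D.poleLabel.injective (Subtype.ext h)]

theorem hasRamificationIndex_zeroLabel (H : IsModel R D σ) (i : Fin np) :
    HasRamificationIndex D.f (D.zeroLabel i).1 (R.posDegree i) := by
  obtain ⟨k, hk⟩ := D.ramified (D.zeroLabel i).1
  have h := σ.hasRamificationIndex_eq (i := 0) (D.zeroLabel i).2 hk
  rw [R.posDegree_eq, ← Nat.card_congr (Equiv.subtypeEquivRight fun e => H.zero_iff), ← h]
  exact hk

theorem hasRamificationIndex_poleLabel (H : IsModel R D σ) (j : Fin nm) :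
    HasRamificationIndex D.f (D.poleLabel j).1 (R.negDegree j) := by
  obtain ⟨k, hk⟩ := D.ramified (D.poleLabel j).1
  have h := σ.hasRamificationIndex_eq (i := 2) (D.poleLabel j).2 hk
  rw [R.negDegree_eq, ← Nat.card_congr (Equiv.subtypeEquivRight fun e => H.pole_iff), ← h]
  exact hk

/-- The vertices are the points over `1`, the degree being twice the ramification index. -/
theorem exists_vertexEquiv (σ : Sheeting D.f R.PosHalf R.gluing) :
    ∃ W : {p : D.S // D.f p = branchPt 1} ≃ R.Vertex, ∀ p k,
      HasRamificationIndex D.f p.1 k ↔ cellSize R.s0 (W p) = 2 * k := by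
  have hE : ∀ p : {p : D.S // D.f p = branchPt 1}, ∃ e, σ.sheet true e (branchPt 1) = p.1 := by
    intro p
    have h := σ.exists_sheet (s := true) (p := p.1) (by rw [p.2]; exact branchPt_mem_hemi 1 true)
    rwa [p.2] at h
  choose E hE using hE
  have hW : ∀ p e, σ.sheet true e (branchPt 1) = p.1 ↔ R.vertex (R.s1 e) = R.vertex (R.s1 (E p)) := by
    intro p e
    rw [← hE p, σ.sheet_branchPt_eq_iff, R.sameCycle_mon_one_iff]
  refine ⟨Equiv.ofBijective (fun p => R.vertex (R.s1 (E p))) ⟨fun p p' h => ?_, fun v => ?_⟩,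
    fun p k => ?_⟩
  · exact Subtype.ext ((hE p).symm.trans ((hW p' _).2 h))
  · obtain ⟨e, rfl⟩ := R.exists_pos_vertex v
    exact ⟨⟨σ.sheet true e (branchPt 1), σ.proj true e _ (branchPt_mem_hemi 1 true)⟩,
      ((hW _ e).1 rfl).symm⟩
  · have hcard : cellSize R.s0 (R.vertex (R.s1 (E p))) =
        2 * Nat.card {e // σ.sheet true e (branchPt 1) = p.1} := by
      rw [R.cellSize_vertex, Nat.card_congr (Equiv.subtypeEquivRight fun e => hW p e)]
    change _ ↔ cellSize R.s0 (R.vertex (R.s1 (E p))) = 2 * k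
    rw [hcard]
    obtain ⟨k', hk'⟩ := D.ramified p.1
    have h' := σ.hasRamificationIndex_eq p.2 hk'
    constructor
    · intro hk
      rw [← σ.hasRamificationIndex_eq p.2 hk]
    · intro hk
      have : k' = k := by omega
      rwa [← this]

theorem card_vertexCount (σ : Sheeting D.f R.PosHalf R.gluing) (i : ℕ) :
    Nat.card {p : D.S // D.f p = ((1 : ℂ) : OnePoint ℂ) ∧
      ∃ k, HasRamificationIndex D.f p k ∧ 2 * k = i} = R.vertexCount i := by
  obtain ⟨W, hW⟩ := exists_vertexEquiv σ
  refine Nat.card_congr ((Equiv.subtypeSubtypeEquivSubtypeInter (fun p => D.f p = branchPt 1)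
    (fun p => ∃ k, HasRamificationIndex D.f p k ∧ 2 * k = i)).symm.trans
    (W.subtypeEquiv fun p => ?_))
  constructor
  · rintro ⟨k, hk, rfl⟩
    exact (hW p k).1 hk
  · intro h
    obtain ⟨k, hk⟩ := D.ramified p.1
    exact ⟨k, hk, ((hW p k).1 hk).symm.trans h⟩

theorem hasProfile_iff (σ : Sheeting D.f R.PosHalf R.gluing) (μ : ℕ →₀ ℕ) :
    D.HasProfile μ ↔ ∀ i, R.vertexCount i = μ i :=
  forall_congr' fun i => by rw [card_vertexCount σ]

theorem ramificationCount_eq (σ : Sheeting D.f R.PosHalf R.gluing) (k : ℕ) :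
    D.ramificationCount k = R.vertexCount (2 * k) := by
  rw [← card_vertexCount σ]
  refine Nat.card_congr (Equiv.subtypeEquivRight fun p => ?_)
  simp

/-! ### Isomorphisms of models -/

theorem exists_isIso_of_isPosIso (H : IsModel R D σ) (H' : IsModel R' D' σ')
    {ψ : R.PosHalf ≃ R'.PosHalf} (hψ : R.IsPosIso R' ψ) :
    ∃ h, Dessin.IsIso D D' h ∧ ∀ s e, ∀ z ∈ hemi s, h (σ.sheet s e z) = σ'.sheet s (ψ e) z := by
  obtain ⟨h, hf, hh⟩ := σ.exists_homeomorph σ' ψ hψ.gluing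
  refine ⟨h, ⟨hf, fun i => ?_, fun j => ?_⟩, hh⟩
  · obtain ⟨e, he⟩ := R.exists_face_eq_posLabel i
    rw [← H.zero e i he, hh true e _ (branchPt_mem_hemi 0 true), H'.zero _ i (hψ.pos e i he)]
  · obtain ⟨e, he⟩ := R.exists_face_eq_negLabel j
    rw [← H.pole e j he, hh true e _ (branchPt_mem_hemi 2 true), H'.pole _ j (hψ.neg e j he)]

theorem exists_isPosIso_of_isIso (H : IsModel R D σ) (H' : IsModel R' D' σ')
    {h : D.S ≃ₜ D'.S} (hh : Dessin.IsIso D D' h) :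
    ∃ ψ, R.IsPosIso R' ψ ∧ ∀ s e, ∀ z ∈ hemi s, h (σ.sheet s e z) = σ'.sheet s (ψ e) z := by
  obtain ⟨ψ, hψ, hσ⟩ := σ.exists_equiv σ' rfl rfl h hh.1
  refine ⟨ψ, ⟨hψ, fun e i hi => ?_, fun e j hj => ?_⟩, hσ⟩
  · rw [← H'.zero_iff, ← hσ true e _ (branchPt_mem_hemi 0 true), H.zero e i hi, hh.2.1]
  · rw [← H'.pole_iff, ← hσ true e _ (branchPt_mem_hemi 2 true), H.pole e j hj, hh.2.2]

/-- Both kinds of isomorphism are bijections of the positive half-edges which commute with the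
gluing and respect the labels of the corners over 0 and ∞. -/
theorem equiv_iff (H : IsModel R D σ) (H' : IsModel R' D' σ') :
    (∃ φ, OrientedRibbonGraph.IsIso R R' φ) ↔ ∃ h, Dessin.IsIso D D' h := by
  constructor
  · rintro ⟨φ, hφ⟩
    obtain ⟨ψ, hψ, -⟩ := hφ.exists_isPosIso
    obtain ⟨h, hh, -⟩ := H.exists_isIso_of_isPosIso H' hψ
    exact ⟨h, hh⟩
  · rintro ⟨h, hh⟩
    obtain ⟨ψ, hψ, -⟩ := H.exists_isPosIso_of_isIso H' hh
    obtain ⟨φ, hφ, -⟩ := hψ.exists_isIso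
    exact ⟨φ, hφ⟩

/-- The relation is "permutes the sheets in the same way". It is single-valued because the sheets
cover the surface and because an isomorphism of graphs is determined on positive half-edges. -/
theorem nonempty_aut_mulEquiv (H : IsModel R D σ) : Nonempty (R.aut ≃* D.aut) := by
  refine nonempty_mulEquiv_of_rel (fun (φ : R.aut) (h : D.aut) => ∀ e e' : R.PosHalf,
    φ.1 e = e' → ∀ s, ∀ z ∈ hemi s, h.1 (σ.sheet s e z) = σ.sheet s e' z) ?_ ?_ ?_ ?_ ?_
  · rintro ⟨φ, hφ⟩
    obtain ⟨ψ, hψ, hψφ⟩ := OrientedRibbonGraph.IsIso.exists_isPosIso hφ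
    obtain ⟨h, hh, hc⟩ := H.exists_isIso_of_isPosIso H hψ
    refine ⟨⟨h, hh⟩, fun e e' hee s z hz => ?_⟩
    rw [hc s e z hz, Subtype.ext ((hψφ e).trans hee)]
  · rintro ⟨h, hh⟩
    obtain ⟨ψ, hψ, hc⟩ := H.exists_isPosIso_of_isIso H hh
    obtain ⟨φ, hφ, hφψ⟩ := hψ.exists_isIso
    refine ⟨⟨φ, hφ⟩, fun e e' hee s z hz => ?_⟩
    rw [hc s e z hz, Subtype.ext ((hφψ e).symm.trans hee)]
  · rintro ⟨φ, hφ⟩ ⟨h, hh⟩ ⟨h', hh'⟩ hc hc'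
    refine Subtype.ext (Homeomorph.ext fun p => congrFun
      (σ.homeomorph_ext (h := h) (h' := h') fun s e z hz => ?_) p)
    have hpos : R.ε (φ e) = 1 := by rw [hφ.2.2.1, e.2]
    exact (hc e ⟨φ e, hpos⟩ rfl s z hz).trans (hc' e ⟨φ e, hpos⟩ rfl s z hz).symm
  · rintro ⟨φ, hφ⟩ ⟨φ', hφ'⟩ ⟨h, hh⟩ hc hc'
    refine Subtype.ext (OrientedRibbonGraph.IsIso.apply_eq hφ hφ' fun e => ?_)
    have hpos : R.ε (φ e) = 1 := by rw [hφ.2.2.1, e.2]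
    have hpos' : R.ε (φ' e) = 1 := by rw [hφ'.2.2.1, e.2]
    obtain ⟨z, hz⟩ := openArc_nonempty 0
    obtain ⟨hz, hb⟩ := mem_openArc_iff.1 hz
    have hz' := arc_subset_hemi 0 true hz
    exact congrArg Subtype.val (σ.sheet_injective hz' hb
      ((hc e ⟨φ e, hpos⟩ rfl true z hz').symm.trans (hc' e ⟨φ' e, hpos'⟩ rfl true z hz')))
  · rintro ⟨φ, hφ⟩ ⟨φ', hφ'⟩ ⟨h, hh⟩ ⟨h', hh'⟩ hc hc' e e' hee s z hz
    have hpos' : R.ε (φ' e) = 1 := by rw [hφ'.2.2.1, e.2]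
    change h (h' (σ.sheet s e z)) = _
    have h1 := hc' e ⟨φ' e, hpos'⟩ rfl s z hz
    change h' _ = _ at h1
    rw [h1]
    exact hc ⟨φ' e, hpos'⟩ e' hee s z hz

end IsModel

theorem exists_isModel_dessin (R : OrientedRibbonGraph np nm) : ∃ D σ, IsModel R D σ := by
  choose zl hzl using R.exists_posLabel
  choose pl hpl using R.exists_negLabel
  obtain ⟨D, σ, h0, h2⟩ := GluedSurface.exists_dessin (np := np) (nm := nm) R.gluing_zero
    (fun Q hQ hne => R.gluing_transitive hQ hne) (zl := zl) (fun i => by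
      obtain ⟨e, he⟩ := R.exists_face_eq_posLabel i
      exact ⟨e, R.posLabel_injective ((hzl e).symm.trans he)⟩) (fun e e' => by
      rw [R.sameCycle_mon_zero_iff, hzl, hzl]
      exact ⟨fun h => by rw [h], R.posLabel_injective⟩) (pl := pl) (fun j => by
      obtain ⟨e, he⟩ := R.exists_face_eq_negLabel j
      exact ⟨e, R.negLabel_injective ((hpl e).symm.trans he)⟩) (fun e e' => by
      rw [R.sameCycle_mon_two_iff, hpl, hpl]
      exact ⟨fun h => by rw [h], R.negLabel_injective⟩)
  refine ⟨D, σ, fun e i hi => ?_, fun e j hj => ?_⟩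
  · rw [h0, R.posLabel_injective ((hzl e).symm.trans hi)]
  · rw [h2, R.negLabel_injective ((hpl e).symm.trans hj)]

/-! ### The ribbon graph of a dessin -/

section ofGluing

variable {ι : Type} [Fintype ι]

/-- The ribbon graph with boundary permutations `a` on the positive half-edges and `b` on the
negative ones. -/
def RibbonGraph.ofGluing [Nonempty ι] (a b : Equiv.Perm ι)
    (htr : ∀ Q : Set ι, (∀ e, a e ∈ Q ↔ e ∈ Q) → (∀ e, b e ∈ Q ↔ e ∈ Q) → Q.Nonempty →
      Q = Set.univ) : RibbonGraph where
  X := ι ⊕ ι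
  s0 := (Equiv.sumCongr a b)⁻¹ * Equiv.sumComm ι ι
  s1 := Equiv.sumComm ι ι
  s1_invol := by rintro (e | e) <;> rfl
  s1_ne := by rintro (e | e) h <;> cases h
  connected := by
    set G : Subgroup (Equiv.Perm (ι ⊕ ι)) := Subgroup.closure
      ({(Equiv.sumCongr a b)⁻¹ * Equiv.sumComm ι ι, Equiv.sumComm ι ι} : Set _) with hG
    have h1 : Equiv.sumComm ι ι ∈ G := Subgroup.subset_closure (Or.inr rfl)
    have h2 : (Equiv.sumCongr a b : Equiv.Perm (ι ⊕ ι)) ∈ G := by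
      have h := G.mul_mem (Subgroup.subset_closure (Or.inl rfl) :
        (Equiv.sumCongr a b)⁻¹ * Equiv.sumComm ι ι ∈ G) (G.inv_mem h1)
      rw [mul_inv_cancel_right] at h
      simpa using G.inv_mem h
    intro x y
    let Q : Set ι := {e | ∃ σ ∈ G, σ x = Sum.inl e}
    have hstep : ∀ τ ∈ G, ∀ e e', τ (Sum.inl e) = Sum.inl e' → (e' ∈ Q ↔ e ∈ Q) := by
      intro τ hτ e e' h
      constructor
      · rintro ⟨σ, hσ, hx⟩
        exact ⟨τ⁻¹ * σ, G.mul_mem (G.inv_mem hτ) hσ, by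
          rw [Equiv.Perm.mul_apply, hx, Equiv.Perm.inv_eq_iff_eq, h]⟩
      · rintro ⟨σ, hσ, hx⟩
        exact ⟨τ * σ, G.mul_mem hτ hσ, by rw [Equiv.Perm.mul_apply, hx, h]⟩
    have hQ : Q = Set.univ := by
      refine htr Q (fun e => hstep _ h2 e _ rfl)
        (fun e => hstep _ (G.mul_mem (G.mul_mem h1 h2) h1) e _ rfl) ?_
      rcases x with e | e
      · exact ⟨e, 1, G.one_mem, rfl⟩
      · exact ⟨e, _, h1, rfl⟩
    have hmem : ∀ e, e ∈ Q := fun e => hQ ▸ Set.mem_univ e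
    rcases y with e | e
    · exact hmem e
    · obtain ⟨σ, hσ, hx⟩ := hmem e
      exact ⟨_, G.mul_mem h1 hσ, by rw [Equiv.Perm.mul_apply, hx]; rfl⟩

theorem RibbonGraph.ofGluing_s2 [Nonempty ι] (a b : Equiv.Perm ι) (htr) :
    (RibbonGraph.ofGluing a b htr).s2 = Equiv.sumCongr a b := by
  change Equiv.sumComm ι ι * ((Equiv.sumCongr a b)⁻¹ * Equiv.sumComm ι ι)⁻¹ = Equiv.sumCongr a b
  rw [mul_inv_rev, inv_inv, mul_inv_cancel_left]

theorem RibbonGraph.ofGluing_s2_zpow [Nonempty ι] (a b : Equiv.Perm ι) (htr) (k : ℤ) :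
    (RibbonGraph.ofGluing a b htr).s2 ^ k = Equiv.sumCongr (a ^ k) (b ^ k) := by
  rw [ofGluing_s2]
  exact (map_zpow (Equiv.Perm.sumCongrHom ι ι) (a, b) k).symm

/-- Points over a branch point and boundaries of one sign are both the cycles of the same monodromy,
so labels of the points become labels of the boundaries. -/
theorem Sheeting.exists_label_equiv {D : Dessin np nm} {n : Fin 3 → Equiv.Perm ι}
    (σ : Sheeting D.f ι n) {i : Fin 3} {N : ℕ} (L : Fin N ≃ {p : D.S // D.f p = branchPt i})
    {β : Type*} {P : β → Prop} {c : ι → β} (hc : ∀ e e', c e = c e' ↔ (mon n i).SameCycle e e')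
    (hP : ∀ e, P (c e)) (hs : ∀ b, P b → ∃ e, c e = b) :
    ∃ M : Fin N ≃ {b // P b}, ∀ e k, c e = M k → σ.sheet true e (branchPt i) = L k := by
  have hE : ∀ k, ∃ e, σ.sheet true e (branchPt i) = L k := by
    intro k
    have h := σ.exists_sheet (s := true) (p := (L k).1)
      (by rw [(L k).2]; exact branchPt_mem_hemi i true)
    rwa [(L k).2] at h
  choose E hE using hE
  refine ⟨Equiv.ofBijective (fun k => ⟨c (E k), hP _⟩) ⟨fun k k' h => ?_, fun b => ?_⟩,
    fun e k h => ?_⟩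
  · have h1 := σ.sheet_branchPt_eq_iff.2 ((hc _ _).1 (Subtype.ext_iff.1 h))
    rw [hE, hE] at h1
    exact L.injective (Subtype.ext h1)
  · obtain ⟨e, he⟩ := hs b.1 b.2
    refine ⟨L.symm ⟨σ.sheet true e (branchPt i), σ.proj true e _ (branchPt_mem_hemi i true)⟩,
      Subtype.ext ?_⟩
    change c (E _) = b
    rw [← he, hc, ← σ.sheet_branchPt_eq_iff, hE, Equiv.apply_symm_apply]
  · rw [← hE k, σ.sheet_branchPt_eq_iff]
    exact (hc _ _).1 h

theorem Sheeting.exists_isModel [Nonempty ι] {D : Dessin np nm} {n : Fin 3 → Equiv.Perm ι}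
    (σ : Sheeting D.f ι n) (h0 : n 0 = 1) : ∃ R σ, IsModel R D σ := by
  have htr : ∀ Q : Set ι, (∀ e, n 1 e ∈ Q ↔ e ∈ Q) → (∀ e, (n 2)⁻¹ e ∈ Q ↔ e ∈ Q) → Q.Nonempty →
      Q = Set.univ := by
    intro Q h1 h2 hne
    refine σ.eq_univ_of_invariant (fun i e => ?_) hne
    fin_cases i
    · change n 0 e ∈ Q ↔ e ∈ Q
      rw [h0]; rfl
    · exact h1 e
    · change n 2 e ∈ Q ↔ e ∈ Q
      rw [← h2]
      simp
  -- With `n 0 = 1` these are the monodromies around 0 and around ∞.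
  let G := RibbonGraph.ofGluing (n 1) (n 2)⁻¹ htr
  have hzl : ∀ (k : ℤ) e, (G.s2 ^ k) (Sum.inl e) = Sum.inl ((n 1 ^ k) e) := fun k e => by
    rw [RibbonGraph.ofGluing_s2_zpow]; rfl
  have hzr : ∀ (k : ℤ) e, (G.s2 ^ k) (Sum.inr e) = Sum.inr (((n 2)⁻¹ ^ k) e) := fun k e => by
    rw [RibbonGraph.ofGluing_s2_zpow]; rfl
  have hinl : ∀ e, G.s2 (Sum.inl e) = Sum.inl (n 1 e) := fun e => hzl 1 e
  have hinr : ∀ e, G.s2 (Sum.inr e) = Sum.inr ((n 2)⁻¹ e) := fun e => hzr 1 e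
  have hmon0 : mon n 0 = n 1 := by simp [mon, h0]
  have hmon2 : mon n 2 = (n 2)⁻¹ := by simp [mon, h0, show (2 : Fin 3) + 1 = 0 from rfl]
  let ε : G.X → ℤˣ := Sum.elim (fun _ => 1) (fun _ => -1)
  have hface : ∀ x y, G.face x = G.face y → ε x = ε y := by
    intro x y h
    obtain ⟨k, rfl⟩ := cell_eq_iff.1 h
    rcases x with e | e
    · rw [hzl]; rfl
    · rw [hzr]; rfl
  have hpos : ∀ e e', G.face (Sum.inl e) = G.face (Sum.inl e') ↔ (mon n 0).SameCycle e e' := by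
    intro e e'
    rw [hmon0]
    refine cell_eq_iff.trans (exists_congr fun k => ?_)
    rw [hzl]
    exact Sum.inl_injective.eq_iff
  have hneg : ∀ e e', G.face (Sum.inr e) = G.face (Sum.inr e') ↔ (mon n 2).SameCycle e e' := by
    intro e e'
    rw [hmon2]
    refine cell_eq_iff.trans (exists_congr fun k => ?_)
    rw [hzr]
    exact Sum.inr_injective.eq_iff
  obtain ⟨Mz, hMz⟩ := σ.exists_label_equiv (i := 0) D.zeroLabel
    (P := fun b => ∀ x, G.face x = b → ε x = 1) hpos (fun e x h => hface _ _ h) (fun b hb => by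
      obtain ⟨x, rfl⟩ := exists_cell b
      rcases x with e | e
      · exact ⟨e, rfl⟩
      · exact absurd (hb _ rfl) neg_one_ne_one)
  obtain ⟨Mp, hMp⟩ := σ.exists_label_equiv (i := 2) D.poleLabel
    (P := fun b => ∀ x, G.face x = b → ε x = -1) hneg (fun e x h => hface _ _ h) (fun b hb => by
      obtain ⟨x, rfl⟩ := exists_cell b
      rcases x with e | e
      · exact absurd (hb _ rfl).symm neg_one_ne_one
      · exact ⟨e, rfl⟩)
  let R : OrientedRibbonGraph np nm :=
    { G with
      ε := ε
      ε_s2 := by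
        rintro (e | e)
        · exact (congrArg ε (hinl e)).trans rfl
        · exact (congrArg ε (hinr e)).trans rfl
      ε_s1 := by
        rintro (e | e)
        · rfl
        · exact (neg_neg _).symm
      posLabel := Mz
      negLabel := Mp }
  let φ : R.PosHalf ≃ ι := (Equiv.ofBijective (fun e => (⟨Sum.inl e, rfl⟩ : R.PosHalf))
    ⟨fun e e' h => Sum.inl_injective (Subtype.ext_iff.1 h), by
      rintro ⟨e | e, h⟩
      · exact ⟨e, rfl⟩
      · exact absurd h neg_one_ne_one⟩).symm
  have h1 : ∀ e, R.posNext (φ.symm e) = φ.symm (n 1 e) := fun e => Subtype.ext (hinl e)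
  have h2 : ∀ e, R.negNext (φ.symm e) = φ.symm ((n 2)⁻¹ e) := fun e =>
    Subtype.ext (congrArg R.s1 (hinr e))
  refine ⟨R, σ.reindex φ fun i x => ?_, fun x i hx => ?_, fun x j hx => ?_⟩
  · obtain ⟨e, rfl⟩ := φ.symm.surjective x
    rw [Equiv.apply_symm_apply, ← Equiv.eq_symm_apply]
    fin_cases i
    · change φ.symm e = φ.symm (n 0 e)
      rw [h0]; rfl
    · exact h1 e
    · change R.negNext⁻¹ _ = φ.symm (n 2 e)
      rw [Equiv.Perm.inv_eq_iff_eq, h2]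
      simp
  · obtain ⟨e, rfl⟩ := φ.symm.surjective x
    change σ.sheet true (φ (φ.symm e)) (branchPt 0) = _
    rw [Equiv.apply_symm_apply]
    exact hMz e i hx
  · obtain ⟨e, rfl⟩ := φ.symm.surjective x
    change σ.sheet true (φ (φ.symm e)) (branchPt 2) = _
    rw [Equiv.apply_symm_apply]
    exact hMp e j hx

end ofGluing

theorem exists_isModel_ribbon (D : Dessin np nm) : ∃ R σ, IsModel R D σ := by
  obtain ⟨n, h0, ⟨σ⟩⟩ := D.exists_sheeting
  have : Fintype D.UpperSheet := Fintype.ofFinite _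
  have : Nonempty D.UpperSheet := by
    obtain ⟨p⟩ := D.conn.toNonempty
    obtain ⟨s, e, -⟩ := σ.exists_sheet' p
    exact ⟨e⟩
  exact σ.exists_isModel h0

/-! ## The exponential strip -/

/-- The strip parametrisation of the sphere. -/
def stripExp (q : ℝ × ℝ) : ℂ := Complex.exp (2 * Real.pi * Complex.I * (q.1 + q.2 * Complex.I))

theorem stripExp_eq (q : ℝ × ℝ) :
    stripExp q = Complex.exp (((-(2 * Real.pi * q.2) : ℝ) : ℂ) + (2 * Real.pi * q.1 : ℝ) * Complex.I) := by
  rw [stripExp]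
  congr 1
  push_cast
  linear_combination (2 * Real.pi * q.2 : ℂ) * Complex.I_mul_I

theorem stripExp_im (q : ℝ × ℝ) :
    (stripExp q).im = Real.exp (-(2 * Real.pi * q.2)) * Real.sin (2 * Real.pi * q.1) := by
  rw [stripExp_eq, Complex.exp_im]
  simp

theorem norm_stripExp (q : ℝ × ℝ) : ‖stripExp q‖ = Real.exp (-(2 * Real.pi * q.2)) := by
  rw [stripExp_eq, Complex.norm_exp]
  simp

theorem stripExp_ne_zero (q : ℝ × ℝ) : stripExp q ≠ 0 := Complex.exp_ne_zero _

theorem continuous_stripExp : Continuous stripExp := by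
  unfold stripExp
  fun_prop

theorem stripExp_zero (y : ℝ) : stripExp (0, y) = (Real.exp (-(2 * Real.pi * y)) : ℝ) := by
  rw [stripExp_eq]
  simp

theorem stripExp_one (y : ℝ) : stripExp (1, y) = (Real.exp (-(2 * Real.pi * y)) : ℝ) := by
  rw [stripExp_eq, Complex.exp_add]
  simp [Complex.exp_two_pi_mul_I]

theorem stripExp_half (y : ℝ) : stripExp (1 / 2, y) = (-Real.exp (-(2 * Real.pi * y)) : ℝ) := by
  rw [stripExp_eq, Complex.exp_add]
  have : ((2 * Real.pi * (1 / 2) : ℝ) : ℂ) * Complex.I = Real.pi * Complex.I := by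
    push_cast; ring
  simp only [this, Complex.exp_pi_mul_I]
  push_cast
  ring

/-- The left end of the half strip over a hemisphere. -/
def stripLeft (s : Bool) : ℝ := if s then 0 else 1 / 2

/-- The closed half strip over a hemisphere. -/
def strip (s : Bool) : Set ℝ := Set.Icc (stripLeft s) (stripLeft s + 1 / 2)

/-- The open half strip over a hemisphere. -/
def openStrip (s : Bool) : Set ℝ := Set.Ioo (stripLeft s) (stripLeft s + 1 / 2)

theorem openStrip_subset (s : Bool) : openStrip s ⊆ strip s := Set.Ioo_subset_Icc_self

theorem strip_subset (s : Bool) : strip s ⊆ Set.Icc 0 1 := by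
  cases s <;> simp only [strip, stripLeft] <;> intro t ht <;> constructor <;>
    simp at ht <;> linarith [ht.1, ht.2]

theorem openStrip_subset_Ioo (s : Bool) : openStrip s ⊆ Set.Ioo 0 1 := by
  cases s <;> simp only [openStrip, stripLeft] <;> intro t ht <;> constructor <;>
    simp at ht <;> linarith [ht.1, ht.2]

theorem side_mul_sin (s : Bool) (t : ℝ) :
    side s * Real.sin (2 * Real.pi * t) = Real.sin (2 * Real.pi * (t - stripLeft s)) := by
  cases s
  · simp only [side, stripLeft, Bool.false_eq_true, if_false]
    rw [show 2 * Real.pi * (t - 1 / 2) = 2 * Real.pi * t - Real.pi by ring, Real.sin_sub_pi]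
    ring
  · simp [side, stripLeft]

theorem stripExp_mem_openHemi {s : Bool} {q : ℝ × ℝ} (hq : q.1 ∈ openStrip s) :
    (stripExp q : Sphere) ∈ openHemi s := by
  rw [coe_mem_openHemi, stripExp_im, mul_left_comm, side_mul_sin]
  have := Real.pi_pos
  refine mul_pos (Real.exp_pos _) (Real.sin_pos_of_pos_of_lt_pi ?_ ?_)
  · have := sub_pos.2 hq.1
    positivity
  · nlinarith [hq.2]

theorem stripExp_mem_hemi {s : Bool} {q : ℝ × ℝ} (hq : q.1 ∈ strip s) :
    (stripExp q : Sphere) ∈ hemi s := by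
  rw [coe_mem_hemi, stripExp_im, mul_left_comm, side_mul_sin]
  have := Real.pi_pos
  refine mul_nonneg (Real.exp_pos _).le (Real.sin_nonneg_of_nonneg_of_le_pi ?_ ?_)
  · have := sub_nonneg.2 hq.1
    positivity
  · nlinarith [hq.2]

theorem stripExp_notMem_branchPt {q : ℝ × ℝ} (hq : q.1 ∈ Set.Ioo (0 : ℝ) 1) :
    (stripExp q : Sphere) ∉ Set.range branchPt := by
  have hpi := Real.pi_pos
  rintro ⟨i, hi⟩
  fin_cases i
  · exact stripExp_ne_zero q (OnePoint.coe_injective hi).symm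
  · have h1 : (1 : ℂ) = stripExp q := OnePoint.coe_injective hi
    obtain ⟨n, hn⟩ := Complex.exp_eq_one_iff.1 h1.symm
    have h2 : (q.1 : ℂ) + q.2 * Complex.I = n := by
      have h3 : (2 * Real.pi * Complex.I : ℂ) ≠ 0 := Complex.two_pi_I_ne_zero
      refine mul_left_cancel₀ h3 ?_
      rw [hn]; ring
    have h3 : q.1 = n := by simpa using congrArg Complex.re h2
    rw [h3] at hq
    have h4 : (0 : ℤ) < n := by exact_mod_cast hq.1
    have h5 : n < (1 : ℤ) := by exact_mod_cast hq.2
    omega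
  · exact OnePoint.infty_ne_coe _ hi

/-- The inverse of the strip parametrisation over a hemisphere. -/
def stripLog (s : Bool) (w : ℂ) : ℝ × ℝ :=
  ((Complex.log (side s * w) / (2 * Real.pi * Complex.I)).re + stripLeft s,
    (Complex.log (side s * w) / (2 * Real.pi * Complex.I)).im)

theorem exp_stripLeft (s : Bool) :
    Complex.exp (2 * Real.pi * Complex.I * stripLeft s) = side s := by
  cases s
  · rw [stripLeft, side]
    simp only [Bool.false_eq_true, if_false]
    rw [show (2 * Real.pi * Complex.I * ((1 / 2 : ℝ) : ℂ)) = Real.pi * Complex.I by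
      push_cast; ring, Complex.exp_pi_mul_I]
    simp
  · simp [stripLeft, side]

theorem stripExp_stripLog {s : Bool} {w : ℂ} (hw : w ≠ 0) : stripExp (stripLog s w) = w := by
  have hs : (side s : ℂ) ≠ 0 := by cases s <;> simp [side]
  have h1 : ((stripLog s w).1 : ℂ) + (stripLog s w).2 * Complex.I =
      Complex.log (side s * w) / (2 * Real.pi * Complex.I) + stripLeft s := by
    conv_rhs => rw [← Complex.re_add_im (Complex.log (side s * w) / (2 * Real.pi * Complex.I))]
    simp only [stripLog]
    push_cast
    ring
  rw [stripExp, h1, mul_add, mul_div_cancel₀ _ Complex.two_pi_I_ne_zero, Complex.exp_add,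
    Complex.exp_log (mul_ne_zero hs hw), exp_stripLeft, mul_right_comm, ← Complex.ofReal_mul,
    side_mul_self]
  simp

theorem stripLog_stripExp {s : Bool} {q : ℝ × ℝ} (hq : q.1 ∈ openStrip s) :
    stripLog s (stripExp q) = q := by
  have hpi := Real.pi_pos
  have h1 : (side s : ℂ) * stripExp q =
      Complex.exp (2 * Real.pi * Complex.I * (q.1 + q.2 * Complex.I - stripLeft s)) := by
    rw [mul_sub, Complex.exp_sub, exp_stripLeft, stripExp, eq_div_iff, mul_right_comm,
      ← Complex.ofReal_mul, side_mul_self]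
    · simp
    · cases s <;> simp [side]
  have him : (2 * Real.pi * Complex.I * (q.1 + q.2 * Complex.I - stripLeft s) : ℂ).im =
      2 * Real.pi * (q.1 - stripLeft s) := by simp
  have h2 : Complex.log (side s * stripExp q) / (2 * Real.pi * Complex.I) =
      q.1 + q.2 * Complex.I - stripLeft s := by
    rw [h1, Complex.log_exp, mul_div_cancel_left₀ _ Complex.two_pi_I_ne_zero]
    · rw [him]
      nlinarith [hq.1]
    · rw [him]
      nlinarith [hq.2]
  simp only [stripLog, h2]
  ext <;> simp

theorem stripLog_mem {s : Bool} {w : ℂ} (hw : 0 < side s * w.im) :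
    (stripLog s w).1 ∈ openStrip s := by
  have hpi := Real.pi_pos
  have h1 : (stripLog s w).1 = Complex.arg (side s * w) / (2 * Real.pi) + stripLeft s := by
    simp only [stripLog, add_left_inj]
    rw [show (2 * Real.pi * Complex.I : ℂ) = ((2 * Real.pi : ℝ) : ℂ) * Complex.I by push_cast; ring,
      ← div_div, Complex.div_I, Complex.neg_re, Complex.mul_I_re, neg_neg, Complex.div_ofReal_im,
      Complex.log_im]
  have him : 0 < ((side s : ℂ) * w).im := by simpa using hw
  have h2 : 0 < Complex.arg (side s * w) := by
    have h3 := Complex.arg_nonneg_iff.2 him.le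
    refine lt_of_le_of_ne h3 fun h => ?_
    have := (Complex.arg_eq_zero_iff.1 h.symm).2
    exact him.ne' this
  have h3 : Complex.arg (side s * w) < Real.pi := Complex.arg_lt_pi_iff.2 (Or.inr him.ne')
  rw [h1]
  constructor
  · have : 0 < Complex.arg (side s * w) / (2 * Real.pi) := by positivity
    linarith
  · have : Complex.arg (side s * w) / (2 * Real.pi) < 1 / 2 := by
      rw [div_lt_iff₀ (by positivity)]
      linarith
    linarith

theorem continuousAt_stripLog {s : Bool} {w : ℂ} (hw : 0 < side s * w.im) :
    ContinuousAt (stripLog s) w := by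
  have him : ((side s : ℂ) * w).im ≠ 0 := by
    have : ((side s : ℂ) * w).im = side s * w.im := by simp
    rw [this]; exact hw.ne'
  have h : ContinuousAt (fun w : ℂ => Complex.log (side s * w) / (2 * Real.pi * Complex.I)) w :=
    ((continuousAt_const.mul continuousAt_id).clog (Or.inr him)).div_const _
  exact ((Complex.continuous_re.continuousAt.comp h).add continuousAt_const).prodMk
    (Complex.continuous_im.continuousAt.comp h)

theorem strip_subset_closure (s : Bool) :
    (Prod.fst ⁻¹' strip s : Set (ℝ × ℝ)) ⊆ closure (Prod.fst ⁻¹' openStrip s) := by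
  have h : closure (openStrip s) = strip s := closure_Ioo (by norm_num)
  have h1 : (Prod.fst ⁻¹' openStrip s : Set (ℝ × ℝ)) = openStrip s ×ˢ Set.univ := by ext; simp
  rw [h1, closure_prod_eq, h, closure_univ]
  intro q hq
  exact ⟨hq, trivial⟩

theorem tendsto_stripExp_atTop (t : ℝ) :
    Tendsto (fun y => (stripExp (t, y) : Sphere)) atTop (𝓝 (branchPt 0)) := by
  refine OnePoint.continuous_coe.continuousAt.tendsto.comp ?_
  rw [tendsto_zero_iff_norm_tendsto_zero]
  simp only [norm_stripExp]
  refine Real.tendsto_exp_neg_atTop_nhds_zero.comp ?_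
  exact tendsto_id.const_mul_atTop (by positivity)

theorem tendsto_stripExp_atBot (t : ℝ) :
    Tendsto (fun y => (stripExp (t, y) : Sphere)) atBot (𝓝 (branchPt 2)) := by
  have h : Tendsto ((↑) : ℂ → Sphere) (Bornology.cobounded ℂ) (𝓝 OnePoint.infty) := by
    rw [Metric.cobounded_eq_cocompact, ← Filter.coclosedCompact_eq_cocompact]
    exact OnePoint.tendsto_coe_infty
  refine h.comp ?_
  rw [← tendsto_norm_atTop_iff_cobounded]
  simp only [norm_stripExp]
  refine Real.tendsto_exp_atTop.comp ?_
  rw [tendsto_neg_atTop_iff]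
  exact tendsto_id.const_mul_atBot (by positivity)

/-- The modulus of `stripExp (t, y)` is `exp (-2πy)`: the line `t = 1/2` covers the arc (∞, 0), and
both sides of the strip cover (0, 1) for `y > 0` and (1, ∞) for `y < 0`. -/
theorem exists_stripExp_of_mem_openArc {z : Sphere} {i : Fin 3} (hz : z ∈ openArc i) :
    ∃ y : ℝ, (i = 0 ∧ z = stripExp (1 / 2, y)) ∨
      (i = 1 ∧ 0 < y ∧ z = stripExp (0, y) ∧ z = stripExp (1, y)) ∨
      (i = 2 ∧ y < 0 ∧ z = stripExp (0, y) ∧ z = stripExp (1, y)) := by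
  have hpi := Real.pi_pos
  have hlog : ∀ x : ℝ, 0 < x →
      Real.exp (-(2 * Real.pi * (-(Real.log x) / (2 * Real.pi)))) = x := by
    intro x hx
    rw [mul_div_cancel₀ _ (by positivity), neg_neg, Real.exp_log hx]
  obtain ⟨x, hx, rfl⟩ := hz
  fin_cases i
  · refine ⟨-(Real.log (-x)) / (2 * Real.pi), Or.inl ⟨rfl, ?_⟩⟩
    have hx' : x < 0 := hx
    rw [stripExp_half, hlog _ (neg_pos.2 hx'), neg_neg]
    rfl
  · have hx' : 0 < x ∧ x < 1 := hx
    refine ⟨-(Real.log x) / (2 * Real.pi), Or.inr (Or.inl ⟨rfl, ?_, ?_, ?_⟩)⟩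
    · have := Real.log_neg hx'.1 hx'.2
      have h2 := neg_pos.2 this
      positivity
    · rw [stripExp_zero, hlog _ hx'.1]; rfl
    · rw [stripExp_one, hlog _ hx'.1]; rfl
  · have hx' : 1 < x := hx
    refine ⟨-(Real.log x) / (2 * Real.pi), Or.inr (Or.inr ⟨rfl, ?_, ?_, ?_⟩)⟩
    · have := Real.log_pos hx'
      exact div_neg_of_neg_of_pos (neg_neg_of_pos this) (by positivity)
    · rw [stripExp_zero, hlog _ (zero_lt_one.trans hx')]; rfl
    · rw [stripExp_one, hlog _ (zero_lt_one.trans hx')]; rfl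

/-! ### Models and preimages of the circle -/

variable {np nm : ℕ} {R : OrientedRibbonGraph np nm} {D : Dessin np nm}

/-- The rectangle of `e` is its upper sheet, over `t ≤ 1/2`, and its lower sheet, over `1/2 ≤ t`,
joined along the arc 0. The prescribed gluings of the sides are those along the arcs 1 and 2, and
the ends are the corners over 0 and ∞. -/
theorem IsModel.isPreimageOfCircle {σ : Sheeting D.f R.PosHalf R.gluing} (H : IsModel R D σ) :
    D.IsPreimageOfCircle R := by
  classical
  obtain ⟨e₀⟩ : Nonempty R.PosHalf := inferInstance
  -- Only positive half-edges carry a rectangle; `e₀` is a default for the others.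
  let q : R.X → R.PosHalf := fun x => if hx : R.ε x = 1 then ⟨x, hx⟩ else e₀
  have hq : ∀ e : R.PosHalf, q e = e := fun e => dif_pos e.2
  let r : R.X → ℝ × ℝ → D.S := fun x p =>
    if p.1 ≤ 1 / 2 then σ.sheet true (q x) (stripExp p) else σ.sheet false (q x) (stripExp p)
  have hr : ∀ (e : R.PosHalf) s p, p.1 ∈ strip s → r e p = σ.sheet s e (stripExp p) := by
    intro e s p hp
    simp only [r, hq]
    cases s
    · simp only [strip, stripLeft, Bool.false_eq_true, if_false] at hp
      split_ifs with h
      · obtain ⟨t, y⟩ := p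
        obtain rfl : t = 1 / 2 := le_antisymm h hp.1
        have hmem : ((stripExp (1 / 2, y) : ℂ) : Sphere) ∈ arc 0 := by
          rw [stripExp_half]
          exact realPt_mem_arc.2 (by simp [arcSet, (Real.exp_pos _).le])
        rw [σ.glue 0 e _ hmem]
        rfl
      · rfl
    · simp only [strip, stripLeft, if_true, zero_add] at hp
      rw [if_pos hp.2]
  have hstrip : ∀ t ∈ Set.Icc (0 : ℝ) 1, ∃ s, t ∈ strip s := by
    intro t ht
    rcases le_total t (1 / 2) with h | h
    · exact ⟨true, by simp [strip, stripLeft, ht.1]; linarith⟩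
    · refine ⟨false, ?_⟩
      simp only [strip, stripLeft, Bool.false_eq_true, if_false]
      exact ⟨h, by linarith [ht.2]⟩
  have h0 : (0 : ℝ) ∈ strip true := by simp [strip, stripLeft]
  have h1 : (1 : ℝ) ∈ strip false := by
    simp only [strip, stripLeft, Bool.false_eq_true, if_false]
    norm_num
  have hcont : ∀ (e : R.PosHalf) s, ContinuousOn (r e) (Prod.fst ⁻¹' strip s) := fun e s =>
    ((σ.cont s e).comp (OnePoint.continuous_coe.comp continuous_stripExp).continuousOn
      (fun p hp => stripExp_mem_hemi hp)).congr fun p hp => hr e s p hp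
  have hclosed : ∀ s, IsClosed (Prod.fst ⁻¹' strip s : Set (ℝ × ℝ)) := fun s =>
    isClosed_Icc.preimage continuous_fst
  refine ⟨r, fun x hx => ?_, fun x hx t ht y => ?_, fun p t ht y hp => ?_, fun x hx y hy => ?_,
    fun x hx y hy => ?_, fun x hx i hi t ht => ?_, fun x hx j hj t ht => ?_⟩
  · refine ((hcont ⟨x, hx⟩ true).union_of_isClosed (hcont ⟨x, hx⟩ false) (hclosed _)
      (hclosed _)).mono ?_
    rintro ⟨t, y⟩ ⟨ht, -⟩
    obtain ⟨s | s, hs⟩ := hstrip t ht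
    · exact Or.inr hs
    · exact Or.inl hs
  · obtain ⟨s, hs⟩ := hstrip t ht
    rw [hr ⟨x, hx⟩ s (t, y) hs, σ.proj s _ _ (stripExp_mem_hemi hs)]
    rfl
  · obtain ⟨s, hs⟩ := hstrip t ⟨ht.1.le, ht.2.le⟩
    obtain ⟨e, he, hu⟩ := σ.bij s (stripExp (t, y)) (stripExp_mem_hemi hs)
      (stripExp_notMem_branchPt ht) p hp
    refine ⟨e, ⟨e.2, (hr e s (t, y) hs).trans he⟩, ?_⟩
    rintro x ⟨hx, hxp⟩
    exact congrArg Subtype.val (hu ⟨x, hx⟩ ((hr ⟨x, hx⟩ s (t, y) hs).symm.trans hxp))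
  · have hmem : ((stripExp (1, y) : ℂ) : Sphere) ∈ arc 1 := by
      rw [stripExp_one]
      refine realPt_mem_arc.2 ⟨(Real.exp_pos _).le, Real.exp_le_one_iff.2 ?_⟩
      have := Real.pi_pos
      exact neg_nonpos.2 (by positivity)
    refine (hr ⟨x, hx⟩ false (1, y) h1).trans ?_
    refine Eq.trans ?_ (hr (R.posNext ⟨x, hx⟩) true (0, y) h0).symm
    rw [σ.glue 1 _ _ hmem, stripExp_one, stripExp_zero]
    rfl
  · have hmem : ((stripExp (1, y) : ℂ) : Sphere) ∈ arc 2 := by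
      rw [stripExp_one]
      refine realPt_mem_arc.2 (Real.one_le_exp_iff.2 ?_)
      have := Real.pi_pos
      exact neg_nonneg.2 (mul_nonpos_of_nonneg_of_nonpos (by positivity) hy)
    refine (hr ⟨x, hx⟩ true (0, y) h0).trans ?_
    refine Eq.trans ?_ (hr (R.negNext ⟨x, hx⟩) false (1, y) h1).symm
    rw [σ.glue 2 _ _ hmem, stripExp_one, stripExp_zero, R.gluing_two]
    simp
  · obtain ⟨s, hs⟩ := hstrip t ht
    have heq : (fun y => r x (t, y)) = fun y => σ.sheet s ⟨x, hx⟩ (stripExp (t, y)) :=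
      funext fun y => hr ⟨x, hx⟩ s (t, y) hs
    rw [heq, ← H.zero ⟨x, hx⟩ i hi, show σ.sheet true ⟨x, hx⟩ (branchPt 0) =
      σ.sheet s ⟨x, hx⟩ (branchPt 0) by
        rw [← σ.sheet_adj (branchPt_mem_arc_self 0) s]; cases s <;> rfl]
    exact (σ.cont s _ _ (branchPt_mem_hemi 0 s)).tendsto.comp
      (tendsto_nhdsWithin_iff.2 ⟨tendsto_stripExp_atTop t, .of_forall fun y => stripExp_mem_hemi hs⟩)
  · obtain ⟨s, hs⟩ := hstrip t ht
    have heq : (fun y => r x (t, y)) = fun y => σ.sheet s ⟨x, hx⟩ (stripExp (t, y)) :=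
      funext fun y => hr ⟨x, hx⟩ s (t, y) hs
    rw [heq, ← H.pole ⟨x, hx⟩ j hj, show σ.sheet true ⟨x, hx⟩ (branchPt 2) =
      σ.sheet s ⟨x, hx⟩ (branchPt 2) by
        rw [← σ.sheet_adj ((branchPt_mem_arc 2 0).2 (by decide)) s]; cases s <;> rfl]
    exact (σ.cont s _ _ (branchPt_mem_hemi 2 s)).tendsto.comp
      (tendsto_nhdsWithin_iff.2 ⟨tendsto_stripExp_atBot t, .of_forall fun y => stripExp_mem_hemi hs⟩)

/-- Over each open hemisphere the exponential of the half strip has a continuous inverse, so the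
rectangles give sections, which extend to the closed hemisphere. By density the extension agrees
with the rectangle on the closed half strip, and the gluings of the sides become those of the arcs.
-/
theorem exists_isModel_of_isPreimageOfCircle (h : D.IsPreimageOfCircle R) :
    ∃ σ, IsModel R D σ := by
  obtain ⟨r, hc, hf, hb, h1, h2, hz, hp⟩ := h
  have hzeq : ∀ s, ∀ z ∈ openHemi s, ∃ w : ℂ, (w : Sphere) = z ∧ 0 < side s * w.im := by
    rintro s z ⟨w, hw, rfl⟩
    exact ⟨w, rfl, hw⟩
  have hw0 : ∀ {s} {w : ℂ}, 0 < side s * w.im → w ≠ 0 := by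
    rintro s w hw rfl
    simp at hw
  let toC : Sphere → ℂ := fun z => z.elim 0 id
  let g : Bool → R.PosHalf → Sphere → D.S := fun s e z => r e (stripLog s (toC z))
  have hg : ∀ s (e : R.PosHalf) (w : ℂ), g s e w = r e (stripLog s w) := fun s e w => rfl
  have hmem : ∀ {s} {w : ℂ}, 0 < side s * w.im → (stripLog s w).1 ∈ Set.Ioo (0 : ℝ) 1 :=
    fun hw => openStrip_subset_Ioo _ (stripLog_mem hw)
  have hgc : ∀ s e, ContinuousOn (g s e) (openHemi s) := by
    intro s e z hz
    obtain ⟨w, rfl, hw⟩ := hzeq s z hz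
    refine ContinuousAt.continuousWithinAt ?_
    rw [OnePoint.continuousAt_coe]
    have hr : ContinuousAt (r e) (stripLog s w) := by
      refine (hc e e.2).continuousAt ?_
      have h3 : (Set.Ioo (0 : ℝ) 1 ×ˢ (Set.univ : Set ℝ)) ∈ 𝓝 (stripLog s w) :=
        (isOpen_Ioo.prod isOpen_univ).mem_nhds ⟨hmem hw, trivial⟩
      exact Filter.mem_of_superset h3 (Set.prod_mono Set.Ioo_subset_Icc_self le_rfl)
    exact ContinuousAt.comp (f := stripLog s) (g := r e) hr (continuousAt_stripLog hw)
  have hgf : ∀ s e, ∀ z ∈ openHemi s, D.f (g s e z) = z := by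
    intro s e z hz
    obtain ⟨w, rfl, hw⟩ := hzeq s z hz
    have h3 := hf e e.2 (stripLog s w).1 (Set.Ioo_subset_Icc_self (hmem hw)) (stripLog s w).2
    refine h3.trans (congrArg _ (stripExp_stripLog (s := s) (hw0 hw)))
  have hgb : ∀ s, ∀ z ∈ openHemi s, ∀ p, D.f p = z → ∃! e, g s e z = p := by
    intro s z hz p hp
    obtain ⟨w, rfl, hw⟩ := hzeq s z hz
    obtain ⟨x, ⟨hx, hxp⟩, hu⟩ := hb p (stripLog s w).1 (hmem hw) (stripLog s w).2
      (hp.trans (congrArg _ (stripExp_stripLog (s := s) (hw0 hw)).symm))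
    exact ⟨⟨x, hx⟩, hxp, fun e he => Subtype.ext (hu e ⟨e.2, he⟩)⟩
  choose G hG hGg hfG hGb using fun s => D.exists_extension (hgc s) (hgf s) (hgb s)
  have hGr : ∀ s (e : R.PosHalf) (q : ℝ × ℝ), q.1 ∈ strip s → G s e (stripExp q) = r e q := by
    intro s e q hq
    refine Set.EqOn.of_subset_closure (s := Prod.fst ⁻¹' openStrip s) (t := Prod.fst ⁻¹' strip s)
      (f := fun q => G s e (stripExp q)) (g := r e) ?_ ?_ ?_ ?_ (strip_subset_closure s) hq
    · intro q hq
      refine (hGg s e (stripExp_mem_openHemi hq)).trans ?_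
      rw [hg, stripLog_stripExp hq]
    · exact (hG s e).comp (OnePoint.continuous_coe.comp continuous_stripExp).continuousOn
        fun q hq => stripExp_mem_hemi hq
    · exact (hc e e.2).mono fun q hq => ⟨strip_subset s hq, trivial⟩
    · exact fun q hq => openStrip_subset s hq
  have hs0 : (0 : ℝ) ∈ strip true := by simp [strip, stripLeft]
  have hs1 : (1 : ℝ) ∈ strip false := by
    simp only [strip, stripLeft, Bool.false_eq_true, if_false]
    norm_num
  have hs2 : ∀ s, (1 / 2 : ℝ) ∈ strip s := by
    intro s
    cases s <;> norm_num [strip, stripLeft]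
  let σ : Sheeting D.f R.PosHalf R.gluing :=
    { sheet := G
      cont := hG
      proj := hfG
      bij := hGb
      glue := by
        intro i e z hz
        refine Set.EqOn.of_subset_closure (s := openArc i) (t := arc i) (f := G false e)
          (g := G true (R.gluing i e)) ?_ ((hG false e).mono (arc_subset_hemi i _))
          ((hG true _).mono (arc_subset_hemi i _)) (openArc_subset_arc i) (arc_subset_closure i) hz
        intro z hz
        obtain ⟨y, ⟨rfl, rfl⟩ | ⟨rfl, hy, hz0, hz1⟩ | ⟨rfl, hy, hz0, hz1⟩⟩ :=
          exists_stripExp_of_mem_openArc hz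
        · rw [hGr _ _ _ (hs2 _), hGr _ _ _ (hs2 _)]
          rfl
        · rw [hz1, hGr _ _ (1, y) hs1, ← hz1, hz0, hGr _ _ (0, y) hs0]
          exact h1 e e.2 y hy.le
        · obtain ⟨e, rfl⟩ := R.negNext.surjective e
          rw [hz1, hGr _ _ (1, y) hs1, ← hz1, hz0, hGr _ _ (0, y) hs0, R.gluing_two,
            show R.negNext⁻¹ (R.negNext e) = e by simp]
          exact (h2 e e.2 y hy.le).symm }
  have hlim : ∀ (e : R.PosHalf) (l : Filter ℝ) (i : Fin 3),
      Tendsto (fun y => ((stripExp (0, y) : ℂ) : Sphere)) l (𝓝 (branchPt i)) →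
      Tendsto (fun y => r e (0, y)) l (𝓝 (G true e (branchPt i))) := by
    intro e l i hl
    have heq : (fun y => r e (0, y)) = fun y => G true e (stripExp (0, y)) :=
      funext fun y => (hGr true e (0, y) hs0).symm
    rw [heq]
    exact (hG true e _ (branchPt_mem_hemi i true)).tendsto.comp
      (tendsto_nhdsWithin_iff.2 ⟨hl, .of_forall fun y => stripExp_mem_hemi hs0⟩)
  refine ⟨σ, fun e i hi => ?_, fun e j hj => ?_⟩
  · exact tendsto_nhds_unique (hlim e atTop 0 (tendsto_stripExp_atTop 0))
      (hz e e.2 i hi 0 (by simp))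
  · exact tendsto_nhds_unique (hlim e atBot 2 (tendsto_stripExp_atBot 0))
      (hp e e.2 j hj 0 (by simp))

theorem isPreimageOfCircle_iff : D.IsPreimageOfCircle R ↔ ∃ σ, IsModel R D σ :=
  ⟨exists_isModel_of_isPreimageOfCircle, fun ⟨_, H⟩ => H.isPreimageOfCircle⟩

/-! ## The correspondence of isomorphism classes -/

/-- The condition `hr` makes the relation depend only on the class of the second term, so that
equality of classes is equivalent to `M` itself. -/
theorem exists_quotient_equiv {A B : Type*} (sA : Setoid A) (sB : Setoid B) (M : A → B → Prop)
    (hA : ∀ a, ∃ b, M a b) (hB : ∀ b, ∃ a, M a b)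
    (hM : ∀ a a' b b', M a b → M a' b' → (sA a a' ↔ sB b b'))
    (hr : ∀ a b b', M a b → sB b b' → M a b') :
    ∃ Φ : Quotient sA ≃ Quotient sB, ∀ a b, Φ (Quotient.mk _ a) = Quotient.mk _ b ↔ M a b := by
  choose F hF using hA
  let Φ : Quotient sA → Quotient sB := Quotient.lift (fun a => Quotient.mk sB (F a))
    fun a a' h => Quotient.sound ((hM _ _ _ _ (hF a) (hF a')).1 h)
  have hΦ : ∀ a b, Φ (Quotient.mk _ a) = Quotient.mk _ b ↔ M a b := fun a b =>
    ⟨fun h => hr _ _ _ (hF a) (Quotient.exact h),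
      fun h => Quotient.sound ((hM _ _ _ _ (hF a) h).1 (sA.refl a))⟩
  refine ⟨Equiv.ofBijective Φ ⟨fun x y h => ?_, fun y => ?_⟩, hΦ⟩
  · induction x using Quotient.inductionOn with | _ a
    induction y using Quotient.inductionOn with | _ a'
    have h1 : M a (F a') := (hΦ a _).1 h
    exact Quotient.sound ((hM _ _ _ _ h1 (hF a')).2 (sB.refl _))
  · induction y using Quotient.inductionOn with | _ b
    obtain ⟨a, ha⟩ := hB b
    exact ⟨Quotient.mk _ a, (hΦ a b).2 ha⟩

variable {np nm : ℕ}

/-- Transport of a sheeting by an isomorphism. -/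
def Sheeting.map {D D' : Dessin np nm} {ι : Type*} {n : Fin 3 → Equiv.Perm ι}
    (σ : Sheeting D.f ι n) (h : D.S ≃ₜ D'.S) (hf : ∀ p, D'.f (h p) = D.f p) :
    Sheeting D'.f ι n where
  sheet s e z := h (σ.sheet s e z)
  cont s e := h.continuous.comp_continuousOn (σ.cont s e)
  proj s e z hz := by rw [hf, σ.proj s e z hz]
  bij s z hz hb p hp := by
    obtain ⟨q, rfl⟩ := h.surjective p
    obtain ⟨e, he, hu⟩ := σ.bij s z hz hb q ((hf q).symm.trans hp)
    exact ⟨e, congrArg h he, fun e' he' => hu e' (h.injective he')⟩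
  glue i e z hz := by rw [σ.glue i e z hz]

theorem IsModel.map {R : OrientedRibbonGraph np nm} {D D' : Dessin np nm}
    {σ : Sheeting D.f R.PosHalf R.gluing} (H : IsModel R D σ) {h : D.S ≃ₜ D'.S}
    (hh : Dessin.IsIso D D' h) : IsModel R D' (σ.map h hh.1) where
  zero e i hi := by rw [← hh.2.1, ← H.zero e i hi]; rfl
  pole e j hj := by rw [← hh.2.2, ← H.pole e j hj]; rfl

/-! ### Edges, boundaries, vertices and the genus -/

namespace OrientedRibbonGraph

variable (R : OrientedRibbonGraph np nm)

/-- Every edge has exactly one positive half. -/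
def posHalfEquivEdge : R.PosHalf ≃ R.Edge :=
  Equiv.ofBijective (fun e => R.edge e) ⟨fun e e' h => by
      obtain ⟨k, hk⟩ := cell_eq_iff.1 h
      obtain ⟨m, rfl | rfl⟩ := k.even_or_odd'
      · rw [zpow_mul, zpow_ofNat, pow_two, R.s1_mul_self, one_zpow] at hk
        exact Subtype.ext hk
      · rw [zpow_add, zpow_mul, zpow_ofNat, pow_two, R.s1_mul_self, one_zpow, one_mul,
          zpow_one] at hk
        have := R.ε_s1_pos e
        rw [hk, e'.2] at this
        exact absurd this.symm neg_one_ne_one, fun a => by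
      obtain ⟨x, rfl⟩ := exists_cell a
      by_cases hx : R.ε x = 1
      · exact ⟨⟨x, hx⟩, rfl⟩
      · exact ⟨⟨R.s1 x, by rw [R.ε_s1, sign_ne_one_iff.1 hx, neg_neg]⟩,
          cell_eq_iff.2 (Equiv.Perm.SameCycle.symm ⟨1, by simp⟩)⟩⟩

theorem posHalfEquivEdge_apply (e : R.PosHalf) : R.posHalfEquivEdge e = R.edge e := rfl

theorem card_X : Nat.card R.X = 2 * Nat.card R.PosHalf := by
  classical
  rw [two_mul, ← Nat.card_sum]
  refine Nat.card_congr ((Equiv.sumCompl fun x => R.ε x = 1).symm.trans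
    (Equiv.sumCongr (Equiv.refl _) ?_))
  exact
    { toFun := fun x => ⟨R.s1 x, by rw [R.ε_s1, sign_ne_one_iff.1 x.2, neg_neg]⟩
      invFun := fun e => ⟨R.s1 e, by rw [ε_s1_pos]; exact neg_one_ne_one⟩
      left_inv := fun x => by ext; simp [R.s1_invol]
      right_inv := fun e => by ext; simp [R.s1_invol] }

theorem card_edge : Nat.card R.Edge = Nat.card R.PosHalf :=
  (Nat.card_congr R.posHalfEquivEdge).symm

theorem card_face : Nat.card R.Face = np + nm := by
  have h : Function.Bijective (Sum.elim (fun i => (R.posLabel i).1) (fun j => (R.negLabel j).1)) := by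
    constructor
    · have hne : ∀ i j, (R.posLabel i).1 ≠ (R.negLabel j).1 := by
        intro i j h
        obtain ⟨e, he⟩ := R.exists_face_eq_posLabel i
        have h1 := (R.negLabel j).2 e (he.trans h)
        rw [e.2] at h1
        exact neg_one_ne_one h1.symm
      rintro (i | i) (j | j) h
      · exact congrArg _ (R.posLabel_injective h)
      · exact absurd h (hne i j)
      · exact absurd h.symm (hne j i)
      · exact congrArg _ (R.negLabel_injective h)
    · intro b
      obtain ⟨x, rfl⟩ := exists_cell b
      by_cases hx : R.ε x = 1
      · obtain ⟨i, hi⟩ := R.exists_posLabel ⟨x, hx⟩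
        exact ⟨Sum.inl i, hi.symm⟩
      · obtain ⟨j, hj⟩ := R.exists_negLabel
          ⟨R.s1 x, by rw [R.ε_s1, sign_ne_one_iff.1 hx, neg_neg]⟩
        rw [R.s1_invol] at hj
        exact ⟨Sum.inr j, hj.symm⟩
  rw [← Nat.card_congr (Equiv.ofBijective _ h)]
  simp

theorem card_vertex_fiber {μ : ℕ →₀ ℕ} (h : ∀ i, R.vertexCount i = μ i) :
    Nat.card R.Vertex = μ.sum (fun _ m => m) ∧ Nat.card R.X = μ.sum fun i m => i * m := by
  classical
  have : Fintype R.Vertex := Fintype.ofFinite _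
  have hmem : ∀ v ∈ (Finset.univ : Finset R.Vertex), cellSize R.s0 v ∈ μ.support := by
    intro v _
    rw [Finsupp.mem_support_iff, ← h]
    have : Nonempty {w : R.Vertex // cellSize R.s0 w = cellSize R.s0 v} := ⟨⟨v, rfl⟩⟩
    exact Nat.card_pos.ne'
  have hfib : ∀ i, ((Finset.univ : Finset R.Vertex).filter fun v => cellSize R.s0 v = i).card = μ i := by
    intro i
    rw [← h, RibbonGraph.vertexCount, Nat.card_eq_fintype_card, Fintype.card_subtype]
  constructor
  · rw [Nat.card_eq_fintype_card, ← Finset.card_univ, Finset.card_eq_sum_card_fiberwise hmem]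
    exact Finset.sum_congr rfl fun i _ => hfib i
  · have h1 : Nat.card R.X = ∑ v : R.Vertex, cellSize R.s0 v := by
      rw [← Nat.card_congr (Equiv.sigmaFiberEquiv (cell R.s0)), Nat.card_sigma]
      rfl
    rw [h1, ← Finset.sum_fiberwise_of_maps_to hmem]
    refine Finset.sum_congr rfl fun i _ => ?_
    rw [Finset.sum_congr rfl fun v hv => (Finset.mem_filter.1 hv).2, Finset.sum_const, hfib,
      smul_eq_mul, mul_comm]

/-- The Euler characteristic involves only the number of vertices, half the sum of the degrees, and
`np + nm`. So the numerical condition on `μ` alone is equivalent to genus `g`. -/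
theorem hasGenus_iff {μ : ℕ →₀ ℕ} (h : ∀ i, R.vertexCount i = μ i) (g : ℕ) :
    R.HasGenus g ↔ (μ.sum fun i m => i * m) + 4 =
      4 * g + 2 * (np + nm) + 2 * (μ.sum fun _ m => m) := by
  obtain ⟨h1, h2⟩ := R.card_vertex_fiber h
  have h3 := R.card_X
  rw [RibbonGraph.HasGenus, R.card_edge, R.card_face, h1]
  rw [h2] at h3
  generalize (μ.sum fun i m => i * m) = a at *
  generalize (μ.sum fun _ m => m) = b at *
  generalize Nat.card R.PosHalf = c at *
  push_cast
  omega

end OrientedRibbonGraph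

theorem exists_ribbonClass_equiv (g np nm : ℕ) (μ : ℕ →₀ ℕ)
    (hμ : (μ.sum fun i m => i * m) + 4 = 4 * g + 2 * (np + nm) + 2 * (μ.sum fun _ m => m)) :
    ∃ Φ : RibbonClass g np nm μ ≃ DessinClass np nm μ,
      ∀ (R : RibbonType g np nm μ) (D : DessinType np nm μ),
        (Φ (Quotient.mk _ R) = Quotient.mk _ D ↔ Dessin.IsPreimageOfCircle R.1 D.1) ∧
        (Φ (Quotient.mk _ R) = Quotient.mk _ D →
          (∀ i, HasRamificationIndex D.1.f (D.1.zeroLabel i).1 (R.1.posDegree i)) ∧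
          (∀ j, HasRamificationIndex D.1.f (D.1.poleLabel j).1 (R.1.negDegree j)) ∧
          Nonempty (R.1.aut ≃* D.1.aut)) := by
  obtain ⟨Φ, hΦ⟩ := exists_quotient_equiv
    ((OrientedRibbonGraph.isoSetoid np nm).comap
      (Subtype.val : RibbonType g np nm μ → OrientedRibbonGraph np nm))
    ((Dessin.isoSetoid np nm).comap (Subtype.val : DessinType np nm μ → Dessin np nm))
    (fun R D => ∃ σ, IsModel R.1 D.1 σ)
    (fun R => by
      obtain ⟨D, σ, H⟩ := exists_isModel_dessin R.1
      exact ⟨⟨D, (IsModel.hasProfile_iff σ μ).2 R.2.2⟩, σ, H⟩)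
    (fun D => by
      obtain ⟨R, σ, H⟩ := exists_isModel_ribbon D.1
      have h := (IsModel.hasProfile_iff σ μ).1 D.2
      exact ⟨⟨R, (R.hasGenus_iff h g).2 hμ, h⟩, σ, H⟩)
    (fun R R' D D' ⟨_, H⟩ ⟨_, H'⟩ => H.equiv_iff H')
    (fun R D D' ⟨_, H⟩ ⟨_, hh⟩ => ⟨_, H.map hh⟩)
  refine ⟨Φ, fun R D => ⟨(hΦ R D).trans isPreimageOfCircle_iff.symm, fun h => ?_⟩⟩
  obtain ⟨σ, H⟩ := (hΦ R D).1 h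
  exact ⟨H.hasRamificationIndex_zeroLabel, H.hasRamificationIndex_poleLabel,
    H.nonempty_aut_mulEquiv⟩

/-! ## Volumes -/

/-- A parametrisation which identifies the integral points on both sides carries the unit cube to a
fundamental domain of the lattice, and a Haar measure is determined by its value there. -/
theorem latticeMeasure_eq_map {ι κ : Type*} [Fintype ι] [Fintype κ] {K : Submodule ℝ (ι → ℝ)}
    (L : (κ → ℝ) ≃ₗ[ℝ] K) (hL : ∀ v, L v ∈ integralPoints K ↔ ∀ j, ∃ z : ℤ, v j = z) :
    latticeMeasure K = Measure.map L volume := by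
  set b : Module.Basis κ ℝ K := (Pi.basisFun ℝ κ).map L with hb
  have hspan : integralPoints K = Submodule.span ℤ (Set.range b) := by
    ext u
    obtain ⟨v, rfl⟩ := L.surjective u
    rw [hL, b.mem_span_iff_repr_mem ℤ]
    refine forall_congr' fun j => ?_
    rw [hb, Module.Basis.map_repr]
    simp [eq_comm]
  have hpar : Measure.addHaar (ZSpan.fundamentalDomain b) =
      Measure.addHaar (b.parallelepiped : Set K) :=
    measure_congr (ZSpan.fundamentalDomain_ae_parallelepiped b _)
  have h0 : Measure.addHaar (b.parallelepiped : Set K) ≠ 0 :=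
    (Measure.measure_pos_of_nonempty_interior _ b.parallelepiped.interior_nonempty).ne'
  have htop : Measure.addHaar (b.parallelepiped : Set K) ≠ ⊤ :=
    b.parallelepiped.isCompact.measure_lt_top.ne
  have hcov : ENNReal.ofReal (ZLattice.covolume (integralPoints K) Measure.addHaar) =
      Measure.addHaar (b.parallelepiped : Set K) := by
    rw [hspan, ZLattice.covolume_eq_measure_fundamentalDomain _ _ (ZSpan.isAddFundamentalDomain b _),
      Measure.real, hpar, ENNReal.ofReal_toReal htop]
  have h1 : b.addHaar = latticeMeasure K := by
    rw [latticeMeasure, hcov]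
    have hS : SigmaFinite ((Measure.addHaar (b.parallelepiped : Set K))⁻¹ •
        (Measure.addHaar : Measure K)) := by
      have : IsFiniteMeasureOnCompacts ((Measure.addHaar (b.parallelepiped : Set K))⁻¹ •
        (Measure.addHaar : Measure K)) := IsFiniteMeasureOnCompacts.smul _ (ENNReal.inv_ne_top.2 h0)
      infer_instance
    rw [Module.Basis.addHaar_eq_iff]
    rw [Measure.smul_apply, smul_eq_mul, ENNReal.inv_mul_cancel h0 htop]
  rw [← h1]
  have h2 := (Pi.basisFun ℝ κ).map_addHaar L.toContinuousLinearEquiv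
  have h3 : (Pi.basisFun ℝ κ).addHaar = (volume : Measure (κ → ℝ)) := by
    rw [Module.Basis.addHaar, Module.Basis.parallelepiped_basisFun, addHaarMeasure_eq_volume_pi]
  rw [h3] at h2
  exact h2.symm

theorem lintegral_sub_pow {a C : ℝ} (ha : 0 < a) (hC : 0 ≤ C) (k : ℕ) :
    ∫⁻ t in Set.Ioo 0 a, ENNReal.ofReal ((a - t) ^ k / k.factorial * C) =
      ENNReal.ofReal (a ^ (k + 1) / (k + 1).factorial * C) := by
  rw [← ofReal_integral_eq_lintegral_ofReal]
  · congr 1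
    rw [← integral_Ioc_eq_integral_Ioo, ← intervalIntegral.integral_of_le ha.le,
      intervalIntegral.integral_comp_sub_left (fun t => t ^ k / k.factorial * C) a,
      intervalIntegral.integral_mul_const, intervalIntegral.integral_div, integral_pow]
    simp only [sub_self, sub_zero, ne_eq, Nat.succ_ne_zero, not_false_eq_true, zero_pow,
      Nat.factorial_succ]
    push_cast
    field_simp
  · have hc : Continuous fun t : ℝ => (a - t) ^ k / k.factorial * C := by fun_prop
    exact (hc.integrableOn_Icc (a := 0) (b := a)).mono_set Set.Ioo_subset_Icc_self
  · refine (ae_restrict_iff' measurableSet_Ioo).2 (.of_forall fun t ht => ?_)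
    have := sub_pos.2 ht.2
    change 0 ≤ (a - t) ^ k / k.factorial * C
    positivity

/-- A product of simplices, whose coordinates are indexed together. -/
def labelledSimplex {m n : ℕ} (c : Fin m → Fin n) (x : Fin n → ℝ) : Set (Fin m → ℝ) :=
  {w | (∀ e, 0 < w e) ∧ ∀ i, ∑ e, (if c e = i then w e else 0) < x i}

theorem isOpen_labelledSimplex {m n : ℕ} (c : Fin m → Fin n) (x : Fin n → ℝ) :
    IsOpen (labelledSimplex c x) := by
  have h : labelledSimplex c x = (⋂ e, {w : Fin m → ℝ | 0 < w e}) ∩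
      ⋂ i, {w : Fin m → ℝ | ∑ e, (if c e = i then w e else 0) < x i} := by
    ext w
    simp [labelledSimplex]
  rw [h]
  refine (isOpen_iInter_of_finite fun e => isOpen_lt continuous_const (continuous_apply e)).inter
    (isOpen_iInter_of_finite fun i => isOpen_lt ?_ continuous_const)
  refine continuous_finsetSum _ fun e _ => ?_
  split_ifs
  · exact continuous_apply e
  · exact continuous_const

/-- Fixing the first coordinate at `t` leaves a product of simplices in which only the side with the
label of that coordinate has shrunk, by `t`. -/
theorem cons_mem_labelledSimplex {m n : ℕ} {c : Fin (m + 1) → Fin n} {x : Fin n → ℝ} {t : ℝ}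
    {w : Fin m → ℝ} : Fin.cons (α := fun _ => ℝ) t w ∈ labelledSimplex c x ↔ 0 < t ∧
      w ∈ labelledSimplex (fun e => c e.succ) (Function.update x (c 0) (x (c 0) - t)) := by
  simp only [labelledSimplex, Set.mem_ofPred_eq, Fin.forall_fin_succ, Fin.cons_zero, Fin.cons_succ,
    Fin.sum_univ_succ, and_assoc]
  refine and_congr_right fun _ => and_congr_right fun _ => forall_congr' fun i => ?_
  by_cases hi : c 0 = i
  · subst hi
    rw [if_pos rfl, Function.update_self, lt_sub_iff_add_lt']
  · rw [if_neg hi, zero_add, Function.update_of_ne (Ne.symm hi)]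

/-- Induction on the total number of coordinates: by Fubini in the first one, the factor of its
label is integrated from `(x - t) ^ k / k!` to `x ^ (k + 1) / (k + 1)!`. Keeping all labels together
avoids decomposing the measure into blocks. -/
theorem volume_labelledSimplex {m n : ℕ} (c : Fin m → Fin n) (x : Fin n → ℝ) (hx : ∀ i, 0 < x i) :
    volume (labelledSimplex c x) = ENNReal.ofReal (∏ i, x i ^ (∑ e, if c e = i then 1 else 0) /
      (∑ e, if c e = i then 1 else 0).factorial) := by
  induction m generalizing x with
  | zero =>
    have h : labelledSimplex c x = Set.univ := by
      ext w
      simp [labelledSimplex, hx]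
    simp [h, volume_pi]
  | succ m ih =>
    set c' : Fin m → Fin n := fun e => c e.succ with hc'
    set j := c 0 with hj
    set k : Fin n → ℕ := fun i => ∑ e, if c' e = i then 1 else 0 with hk
    -- The factors of the other labels are constant along the slicing variable.
    set C : ℝ := ∏ i ∈ Finset.univ.erase j, x i ^ k i / (k i).factorial with hC
    have hC0 : 0 ≤ C := Finset.prod_nonneg fun i _ => by have := hx i; positivity
    have hslice : ∀ t, volume {w | Fin.cons (α := fun _ => ℝ) t w ∈ labelledSimplex c x} =
        (Set.Ioo 0 (x j)).indicator
          (fun t => ENNReal.ofReal ((x j - t) ^ k j / (k j).factorial * C)) t := by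
      intro t
      simp only [cons_mem_labelledSimplex]
      by_cases ht : t ∈ Set.Ioo 0 (x j)
      · rw [Set.indicator_of_mem ht]
        simp only [ht.1, true_and]
        change volume (labelledSimplex c' (Function.update x j (x j - t))) = _
        rw [ih]
        · congr 1
          rw [← Finset.mul_prod_erase _ _ (Finset.mem_univ j), Function.update_self]
          congr 1
          refine Finset.prod_congr rfl fun i hi => ?_
          rw [Function.update_of_ne (Finset.ne_of_mem_erase hi)]
        · intro i
          by_cases hi : i = j
          · subst hi
            rw [Function.update_self]
            exact sub_pos.2 ht.2
          · rw [Function.update_of_ne hi]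
            exact hx i
      · rw [Set.indicator_of_notMem ht]
        convert measure_empty (μ := volume)
        refine Set.eq_empty_of_forall_notMem ?_
        rintro w ⟨h0, hw⟩
        refine ht ⟨h0, ?_⟩
        have h1 := hw.2 j
        rw [← hj, Function.update_self] at h1
        have h2 : 0 ≤ ∑ e, (if c e.succ = j then w e else 0) :=
          Finset.sum_nonneg fun e _ => by
            split_ifs
            · exact (hw.1 e).le
            · exact le_rfl
        linarith
    have hvol := (volume_preserving_piFinSuccAbove (fun _ : Fin (m + 1) => ℝ) 0).symm
    have hmeas := (isOpen_labelledSimplex c x).measurableSet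
    rw [← hvol.measure_preimage_equiv, Measure.volume_eq_prod,
      Measure.prod_apply (hmeas.preimage (MeasurableEquiv.measurable _))]
    have hpre : ∀ t : ℝ, volume (Prod.mk t ⁻¹'
        ((MeasurableEquiv.piFinSuccAbove (fun _ : Fin (m + 1) => ℝ) 0).symm ⁻¹'
          labelledSimplex c x)) =
        (Set.Ioo 0 (x j)).indicator
          (fun t => ENNReal.ofReal ((x j - t) ^ k j / (k j).factorial * C)) t := by
      intro t
      rw [← hslice]
      congr 1
      ext w
      have hcons : (MeasurableEquiv.piFinSuccAbove (fun _ : Fin (m + 1) => ℝ) 0).symm (t, w) =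
          Fin.cons (α := fun _ => ℝ) t w := Fin.insertNth_zero' t w
      rw [Set.mem_preimage, Set.mem_preimage, hcons]
      rfl
    simp only [hpre]
    rw [lintegral_indicator measurableSet_Ioo, lintegral_sub_pow (hx j) hC0]
    congr 1
    have hsum : ∀ i, (∑ e, if c e = i then 1 else 0) = (if j = i then 1 else 0) + k i := fun i =>
      Fin.sum_univ_succ _
    simp only [hsum]
    rw [← Finset.mul_prod_erase _ _ (Finset.mem_univ j), if_pos rfl, add_comm 1]
    congr 1
    refine Finset.prod_congr rfl fun i hi => ?_
    rw [if_neg (Finset.ne_of_mem_erase hi).symm, zero_add]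

/-! ### Products of simplices in an affine subspace -/

section Affine

variable {ι : Type*} [Fintype ι] {n : ℕ}

/-- The sum of the coordinates with a given label. -/
def labelSum {A : Type*} [AddCommMonoid A] (c : ι → Fin n) (y : ι → A) (i : Fin n) : A :=
  ∑ e, if c e = i then y e else 0

theorem labelSum_add {A : Type*} [AddCommMonoid A] (c : ι → Fin n) (y y' : ι → A) (i : Fin n) :
    labelSum c (y + y') i = labelSum c y i + labelSum c y' i := by
  simp only [labelSum, ← Finset.sum_add_distrib]
  refine Finset.sum_congr rfl fun e _ => ?_
  split_ifs <;> simp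

theorem labelSum_smul (c : ι → Fin n) (a : ℝ) (y : ι → ℝ) (i : Fin n) :
    labelSum c (a • y) i = a * labelSum c y i := by
  simp only [labelSum, Finset.mul_sum]
  refine Finset.sum_congr rfl fun e _ => ?_
  split_ifs <;> simp

/-- The volume of a product of simplices, whose coordinates are indexed together. -/
theorem affineVolume_eq_prod {c : ι → Fin n} (hc : Function.Surjective c)
    {K : Submodule ℝ (ι → ℝ)} (hK : ∀ u, u ∈ K ↔ ∀ i, labelSum c u i = 0) {x : Fin n → ℝ}
    (hx : ∀ i, 0 < x i) :
    affineVolume K {y | (∀ e, 0 < y e) ∧ ∀ i, labelSum c y i = x i} =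
      ENNReal.ofReal (∏ i, x i ^ (labelSum c (fun _ => 1) i - 1) /
        (labelSum c (fun _ => 1) i - 1).factorial) := by
  classical
  -- One coordinate `s i` of each label is eliminated by the equation of that label. This accounts
  -- for the exponent: number of coordinates minus one.
  obtain ⟨s, hs⟩ := hc.hasRightInverse
  set m := Fintype.card {e // e ≠ s (c e)} with hm
  let φ : {e // e ≠ s (c e)} ≃ Fin m := Fintype.equivFin _
  let c' : Fin m → Fin n := fun j => c (φ.symm j)
  have hsplit : ∀ {A : Type} [AddCommMonoid A] (u : ι → A) (i : Fin n),
      labelSum c u i = u (s i) + labelSum c' (fun j => u (φ.symm j)) i := by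
    intro A _ u i
    rw [labelSum, ← Fintype.sum_subtype_add_sum_subtype (fun e => e = s (c e))]
    congr 1
    · rw [Finset.sum_eq_single ⟨s i, by rw [hs]⟩]
      · rw [if_pos (hs i)]
      · rintro ⟨e, he⟩ - hne
        refine if_neg fun h => hne (Subtype.ext ?_)
        rw [← h]
        exact he
      · exact fun h => absurd (Finset.mem_univ _) h
    · exact (φ.symm.sum_comp fun e : {e // e ≠ s (c e)} => if c e = i then u e else 0).symm
  -- The eliminated coordinate is minus an integral combination of the free ones, so integral free
  -- coordinates give integral points of `K`.
  let ext : (Fin m → ℝ) → ι → ℝ := fun v e =>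
    if h : e ≠ s (c e) then v (φ ⟨e, h⟩) else - labelSum c' v (c e)
  have hextφ : ∀ v j, ext v (φ.symm j) = v j := by
    intro v j
    simp only [ext]
    rw [dif_pos (φ.symm j).2]
    simp
  have hexts : ∀ v i, ext v (s i) = - labelSum c' v i := by
    intro v i
    simp only [ext]
    rw [dif_neg (by rw [hs]; simp), hs]
  have hcov : ∀ e : ι, (∃ j, e = φ.symm j) ∨ ∃ i, e = s i := by
    intro e
    by_cases h : e = s (c e)
    · exact Or.inr ⟨_, h⟩
    · exact Or.inl ⟨φ ⟨e, h⟩, by simp⟩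
  have hextK : ∀ v, ext v ∈ K := by
    intro v
    rw [hK]
    intro i
    rw [hsplit, hexts]
    simp only [hextφ]
    exact neg_add_cancel _
  have hres : ∀ u ∈ K, ext (fun j => u (φ.symm j)) = u := by
    intro u hu
    funext e
    rcases hcov e with ⟨j, rfl⟩ | ⟨i, rfl⟩
    · exact hextφ _ _
    · refine (hexts _ _).trans ?_
      have := (hK u).1 hu i
      rw [hsplit] at this
      linarith
  let L : (Fin m → ℝ) ≃ₗ[ℝ] K := LinearEquiv.symm
    { toFun := fun u j => (u : ι → ℝ) (φ.symm j)
      map_add' := fun u v => rfl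
      map_smul' := fun a u => rfl
      invFun := fun v => ⟨ext v, hextK v⟩
      left_inv := fun u => Subtype.ext (hres u u.2)
      right_inv := fun v => funext (hextφ v) }
  have hLcoe : ∀ v, (L v : ι → ℝ) = ext v := fun v => rfl
  have hL : ∀ v, L v ∈ integralPoints K ↔ ∀ j, ∃ z : ℤ, v j = z := by
    intro v
    constructor
    · intro h j
      obtain ⟨z, hz⟩ := h (φ.symm j)
      exact ⟨z, by rw [← hz, hLcoe, hextφ]⟩
    · intro h e
      choose z hz using h
      rw [hLcoe]
      rcases hcov e with ⟨j, rfl⟩ | ⟨i, rfl⟩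
      · exact ⟨z j, by rw [hextφ, hz]⟩
      · refine ⟨- labelSum c' z i, ?_⟩
        rw [hexts]
        simp only [labelSum]
        push_cast
        simp only [hz]
  set A : Set (ι → ℝ) := {y | (∀ e, 0 < y e) ∧ ∀ i, labelSum c y i = x i} with hA
  have hexp : ∀ i, labelSum c (fun _ => 1) i - 1 = ∑ j, if c' j = i then 1 else 0 := by
    intro i
    rw [hsplit, add_tsub_cancel_left]
    rfl
  have hconst : ∀ a ∈ A, latticeMeasure K {u : K | a + (u : ι → ℝ) ∈ A} =
      ENNReal.ofReal (∏ i, x i ^ (labelSum c (fun _ => 1) i - 1) /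
        (labelSum c (fun _ => 1) i - 1).factorial) := by
    intro a ha
    simp only [hexp]
    -- In the free coordinates, translated by the base point `a`, positivity of the eliminated
    -- coordinate `s i` is the strict inequality of the labelled simplex; translation invariance
    -- removes `a`.
    rw [← volume_labelledSimplex c' x hx, latticeMeasure_eq_map L hL,
      ← measure_preimage_add volume (fun j => a (φ.symm j)) (labelledSimplex c' x)]
    have hmap : Measure.map L volume {u : K | a + (u : ι → ℝ) ∈ A} =
        volume (L ⁻¹' {u : K | a + (u : ι → ℝ) ∈ A}) :=
      L.toContinuousLinearEquiv.toHomeomorph.toMeasurableEquiv.map_apply _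
    rw [hmap]
    congr 1
    ext v
    have hsum : ∀ i, labelSum c (a + ext v) i = x i := fun i => by
      rw [labelSum_add, (hK _).1 (hextK v), add_zero, ha.2]
    have hsi : ∀ i, (a + ext v) (s i) =
        x i - ∑ j, if c' j = i then a (φ.symm j) + v j else 0 := by
      intro i
      have h := hsum i
      rw [hsplit] at h
      have h2 : labelSum c' (fun j => (a + ext v) (φ.symm j)) i =
          ∑ j, if c' j = i then a (φ.symm j) + v j else 0 := by
        simp only [labelSum, Pi.add_apply, hextφ]
      rw [h2] at h
      linarith
    change ((∀ e, 0 < (a + ext v) e) ∧ ∀ i, labelSum c (a + ext v) i = x i) ↔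
      (∀ j, 0 < a (φ.symm j) + v j) ∧ ∀ i, (∑ j, if c' j = i then a (φ.symm j) + v j else 0) < x i
    simp only [hsum, implies_true, and_true]
    constructor
    · intro h
      refine ⟨fun j => ?_, fun i => ?_⟩
      · have := h (φ.symm j)
        rwa [Pi.add_apply, hextφ] at this
      · have := h (s i)
        rw [hsi] at this
        linarith
    · rintro ⟨h1, h2⟩ e
      rcases hcov e with ⟨j, rfl⟩ | ⟨i, rfl⟩
      · rw [Pi.add_apply, hextφ]
        exact h1 j
      · rw [hsi]
        linarith [h2 i]
  have hne : A.Nonempty := by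
    have hpos : ∀ i, 0 < labelSum c (fun _ => (1 : ℝ)) i := by
      intro i
      rw [hsplit]
      refine add_pos_of_pos_of_nonneg one_pos (Finset.sum_nonneg fun j _ => ?_)
      split_ifs <;> norm_num
    -- Each `x i` is shared equally among the coordinates of label `i`. A point is needed because
    -- the supremum defining `affineVolume` vanishes on the empty set.
    refine ⟨fun e => x (c e) / labelSum c (fun _ => 1) (c e), fun e => div_pos (hx _) (hpos _),
      fun i => ?_⟩
    have h : labelSum c (fun e => x (c e) / labelSum c (fun _ => 1) (c e)) i =
        labelSum c ((x i / labelSum c (fun _ => 1) i) • fun _ => (1 : ℝ)) i := by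
      simp only [labelSum]
      refine Finset.sum_congr rfl fun e _ => ?_
      split_ifs with h
      · subst h; simp
      · rfl
    rw [h, labelSum_smul, div_mul_cancel₀ _ (hpos i).ne']
  rw [affineVolume, iSup_congr fun a => iSup_congr fun ha => hconst a ha]
  exact biSup_const hne

end Affine

theorem simplexVolume_eq {k : ℕ} (hk : 1 ≤ k) {x : ℝ} (hx : 0 < x) :
    simplexVolume k x = ENNReal.ofReal (x ^ (k - 1) / (k - 1).factorial) := by
  have h := affineVolume_eq_prod (c := fun _ : Fin k => (0 : Fin 1))
    (fun i => ⟨⟨0, hk⟩, (Subsingleton.elim _ _)⟩)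
    (K := LinearMap.ker (∑ i : Fin k, LinearMap.proj i : (Fin k → ℝ) →ₗ[ℝ] ℝ))
    (fun u => by simp [labelSum, LinearMap.mem_ker]) (x := fun _ => x) (fun _ => hx)
  simp only [labelSum, Finset.univ_unique, Finset.prod_singleton, Finset.sum_const,
    Finset.card_univ, Fintype.card_fin, smul_eq_mul, mul_one, Fin.forall_fin_one, if_true,
    Fin.default_eq_zero] at h
  exact h

/-! ### The cell of a ribbon graph with one negative boundary -/

namespace OrientedRibbonGraph

variable {n : ℕ} (R : OrientedRibbonGraph n 1)

theorem boundaryLength_posLabel {nm : ℕ} (R : OrientedRibbonGraph n nm) {c : R.PosHalf → Fin n}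
    (hc : ∀ e : R.PosHalf, R.face e = R.posLabel (c e)) (i : Fin n) (u : R.Edge → ℝ) :
    R.boundaryLength (R.posLabel i) u = labelSum (fun a => c (R.posHalfEquivEdge.symm a)) u i := by
  classical
  rw [labelSum, RibbonGraph.boundaryLength, ← R.posHalfEquivEdge.sum_comp]
  simp only [Equiv.symm_apply_apply]
  have h1 : (∑ e : R.PosHalf, if c e = i then u (R.posHalfEquivEdge e) else 0) =
      ∑ x ∈ (Finset.univ.filter fun e => c e = i).map
        (Function.Embedding.subtype fun x => R.ε x = 1), u (R.edge x) := by
    rw [Finset.sum_map, Finset.sum_filter]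
    rfl
  rw [h1]
  refine Finset.sum_congr ?_ fun _ _ => rfl
  ext x
  simp only [Finset.mem_filter, Finset.mem_univ, true_and, Finset.mem_map,
    Function.Embedding.coe_subtype]
  constructor
  · intro hx
    refine ⟨⟨x, (R.posLabel i).2 x hx⟩, ?_, rfl⟩
    exact R.posLabel_injective ((hc _).symm.trans hx)
  · rintro ⟨e, rfl, rfl⟩
    exact hc e

/-- Every edge has exactly one negative half, and all of these lie on the only negative boundary. -/
theorem boundaryLength_negLabel (u : R.Edge → ℝ) (j : Fin 1) :
    R.boundaryLength (R.negLabel j) u = ∑ a, u a := by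
  classical
  rw [RibbonGraph.boundaryLength, ← R.posHalfEquivEdge.sum_comp]
  simp only [posHalfEquivEdge_apply]
  have hedge : ∀ x, R.edge (R.s1 x) = R.edge x := fun x =>
    cell_eq_iff.2 (Equiv.Perm.SameCycle.symm ⟨1, by simp⟩)
  let f : R.PosHalf ↪ R.X := ⟨fun e => R.s1 e, fun e e' h => Subtype.ext (R.s1.injective h)⟩
  have h1 : ∑ e : R.PosHalf, u (R.edge e) = ∑ x ∈ Finset.univ.map f, u (R.edge x) := by
    rw [Finset.sum_map]
    refine Finset.sum_congr rfl fun e _ => ?_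
    exact congrArg u (hedge e).symm
  rw [h1]
  refine Finset.sum_congr ?_ fun _ _ => rfl
  ext x
  simp only [Finset.mem_filter, Finset.mem_univ, true_and, Finset.mem_map]
  constructor
  · intro hx
    refine ⟨⟨R.s1 x, ?_⟩, R.s1_invol x⟩
    rw [R.ε_s1, (R.negLabel j).2 x hx, neg_neg]
  · rintro ⟨e, rfl⟩
    obtain ⟨j', hj'⟩ := R.exists_negLabel e
    rw [Subsingleton.elim j j']
    exact hj'

theorem sum_labelSum {ι : Type*} [Fintype ι] (c : ι → Fin n) (u : ι → ℝ) :
    ∑ i, labelSum c u i = ∑ e, u e := by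
  simp only [labelSum]
  rw [Finset.sum_comm]
  exact Finset.sum_congr rfl fun e _ => by simp

/-- Labelling an edge by the positive boundary through its positive half makes the positive
equations independent, each with its own edges. Their sum is the negative equation, in the cell as
well as in `R.K`. -/
theorem cellVolume_eq {x : Fin n → ℝ} (hx : ∀ i, 0 < x i) :
    R.cellVolume x (fun _ => ∑ i, x i) =
      ENNReal.ofReal (∏ i, x i ^ (R.posDegree i - 1) / (R.posDegree i - 1).factorial) := by
  choose c hc using R.exists_posLabel
  set c' : R.Edge → Fin n := fun a => c (R.posHalfEquivEdge.symm a) with hc'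
  have hb := fun i u => R.boundaryLength_posLabel hc i u
  have hsurj : Function.Surjective c' := by
    intro i
    obtain ⟨e, he⟩ := R.exists_face_eq_posLabel i
    refine ⟨R.posHalfEquivEdge e, ?_⟩
    change c (R.posHalfEquivEdge.symm (R.posHalfEquivEdge e)) = i
    rw [Equiv.symm_apply_apply]
    exact R.posLabel_injective ((hc e).symm.trans he)
  have hK : ∀ u, u ∈ R.K ↔ ∀ i, labelSum c' u i = 0 := by
    intro u
    constructor
    · intro h i
      rw [← hb]
      exact h _
    · intro h b
      obtain ⟨y, rfl⟩ := exists_cell b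
      by_cases hy : R.ε y = 1
      · have h1 := hb (c ⟨y, hy⟩) u
        rw [h, ← hc] at h1
        exact h1
      · obtain ⟨j, hj⟩ := R.exists_negLabel
          ⟨R.s1 y, by rw [R.ε_s1, sign_ne_one_iff.1 hy, neg_neg]⟩
        rw [R.s1_invol] at hj
        change R.boundaryLength (R.face y) u = 0
        rw [hj, R.boundaryLength_negLabel, ← sum_labelSum c']
        exact Finset.sum_eq_zero fun i _ => h i
  have hMet : R.Met x (fun _ => ∑ i, x i) = {y | (∀ e, 0 < y e) ∧ ∀ i, labelSum c' y i = x i} := by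
    ext y
    simp only [Met, Set.mem_ofPred_eq, hb, R.boundaryLength_negLabel]
    refine and_congr_right fun _ => ⟨fun h => h.1, fun h => ⟨h, fun _ => ?_⟩⟩
    rw [← sum_labelSum c']
    exact Finset.sum_congr rfl fun i _ => h i
  have hdeg : ∀ i, R.posDegree i = labelSum c' (fun _ => 1) i := by
    intro i
    classical
    rw [R.posDegree_eq, labelSum, ← R.posHalfEquivEdge.sum_comp, Nat.card_eq_fintype_card,
      Fintype.card_subtype, Finset.card_filter]
    refine Finset.sum_congr rfl fun e _ => ?_
    simp only [hc', Equiv.symm_apply_apply]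
    refine if_congr ?_ rfl rfl
    rw [hc e]
    exact ⟨R.posLabel_injective, fun h => by rw [h]⟩
  simp only [hdeg]
  rw [cellVolume, hMet]
  exact affineVolume_eq_prod hsurj hK hx

theorem one_le_posDegree {nm : ℕ} (R : OrientedRibbonGraph n nm) (i : Fin n) :
    1 ≤ R.posDegree i := by
  rw [R.posDegree_eq]
  obtain ⟨e, he⟩ := R.exists_face_eq_posLabel i
  have : Nonempty {e : R.PosHalf // R.face e = R.posLabel i} := ⟨⟨e, he⟩⟩
  exact Nat.card_pos

theorem cellVolume_eq_prod_simplexVolume {x : Fin n → ℝ} (hx : ∀ i, 0 < x i) :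
    R.cellVolume x (fun _ => ∑ i, x i) = ∏ i, simplexVolume (R.posDegree i) (x i) := by
  rw [R.cellVolume_eq hx, ENNReal.ofReal_prod_of_nonneg fun i _ => by have := hx i; positivity]
  exact Finset.prod_congr rfl fun i _ => (simplexVolume_eq (R.one_le_posDegree i) (hx i)).symm

end OrientedRibbonGraph

/-! ## Volumes of moduli spaces and Hurwitz numbers -/

namespace OrientedRibbonGraph

variable {n np nm : ℕ}

theorem vertexCount_eq_zero_of_odd (R : OrientedRibbonGraph np nm) {i : ℕ} (hi : ¬ Even i) :
    R.vertexCount i = 0 := by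
  have : IsEmpty {v : R.Vertex // cellSize R.s0 v = i} := by
    refine ⟨fun v => hi ?_⟩
    rw [← v.2, R.cellSize_vertex]
    exact even_two_mul _
  exact Nat.card_of_isEmpty

theorem sum_posDegree (R : OrientedRibbonGraph np nm) : ∑ i, R.posDegree i = Nat.card R.PosHalf := by
  choose c hc using R.exists_posLabel
  rw [← Nat.card_congr (Equiv.sigmaFiberEquiv c), Nat.card_sigma]
  refine Finset.sum_congr rfl fun i _ => ?_
  rw [R.posDegree_eq]
  refine Nat.card_congr (Equiv.subtypeEquivRight fun e => ?_)
  rw [hc]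
  exact ⟨R.posLabel_injective, fun h => by rw [h]⟩

theorem negDegree_eq_card (R : OrientedRibbonGraph np 1) (j : Fin 1) :
    R.negDegree j = Nat.card R.PosHalf := by
  rw [R.negDegree_eq]
  refine Nat.card_congr (Equiv.subtypeUnivEquiv fun e => ?_)
  obtain ⟨j', hj'⟩ := R.exists_negLabel e
  rw [Subsingleton.elim j j']
  exact hj'

/-- With `V` vertices, all of degree 4, the Euler relation reads `4V + 4 = 4g + 2(n + 1) + 2V`, so
`V = 2g + n - 1`. -/
theorem hasGenus_and_isGeneric_iff (R : OrientedRibbonGraph n 1) (hn : 1 ≤ n) (g : ℕ) :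
    (R.HasGenus g ∧ R.IsGeneric) ↔
      ∀ i, R.vertexCount i = (Finsupp.single 4 (2 * g + n - 1) : ℕ →₀ ℕ) i := by
  constructor
  · rintro ⟨hg, h⟩
    have hv : ∀ i, R.vertexCount i = (Finsupp.single 4 (Nat.card R.Vertex) : ℕ →₀ ℕ) i := by
      intro i
      rw [Finsupp.single_apply]
      split_ifs with hi
      · subst hi
        exact Nat.card_congr (Equiv.subtypeUnivEquiv h)
      · have : IsEmpty {v : R.Vertex // cellSize R.s0 v = i} :=
          ⟨fun v => hi ((h v).symm.trans v.2)⟩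
        exact Nat.card_of_isEmpty
    have h1 := (R.hasGenus_iff hv g).1 hg
    rw [Finsupp.sum_single_index (by simp), Finsupp.sum_single_index rfl] at h1
    have h2 : Nat.card R.Vertex = 2 * g + n - 1 := by omega
    rwa [h2] at hv
  · intro hv
    refine ⟨(R.hasGenus_iff hv g).2 ?_, fun v => ?_⟩
    · rw [Finsupp.sum_single_index (by simp), Finsupp.sum_single_index rfl]
      omega
    · by_contra hne
      have h1 := hv (cellSize R.s0 v)
      rw [Finsupp.single_eq_of_ne hne] at h1
      have : Nonempty {w : R.Vertex // cellSize R.s0 w = cellSize R.s0 v} := ⟨⟨v, rfl⟩⟩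
      exact Nat.card_pos.ne' h1

theorem card_posHalf_of_isGeneric {R : OrientedRibbonGraph n 1} (hn : 1 ≤ n) {g : ℕ}
    (h : R.HasGenus g ∧ R.IsGeneric) : Nat.card R.PosHalf = 4 * g + 2 * n - 2 := by
  have h1 := (R.card_vertex_fiber ((R.hasGenus_and_isGeneric_iff hn g).1 h)).2
  rw [R.card_X, Finsupp.sum_single_index (by simp)] at h1
  omega

/-- After numbering the half-edges, a graph is coded by functions between finite sets, and equal
codes give isomorphic graphs. The labels are recorded as predicates on half-edges so that the type
of codes does not depend on the graph. -/
theorem finite_of_card_eq {A : Type*} (r : Setoid A) (f : A → OrientedRibbonGraph np nm)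
    (hf : ∀ a b, (∃ φ, IsIso (f a) (f b) φ) → r a b) {N : ℕ} (hN : ∀ a, Nat.card (f a).X = N) :
    Finite (Quotient r) := by
  let e : ∀ a, (f a).X ≃ Fin N := fun a => (Finite.equivFin _).trans (finCongr (hN a))
  let code : A → (Fin N → Fin N) × (Fin N → Fin N) × (Fin N → ℤˣ) × (Fin np → Fin N → Prop) ×
      (Fin nm → Fin N → Prop) := fun a =>
    (fun x => e a ((f a).s0 ((e a).symm x)), fun x => e a ((f a).s1 ((e a).symm x)),
      fun x => (f a).ε ((e a).symm x), fun i x => (f a).face ((e a).symm x) = (f a).posLabel i,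
      fun j x => (f a).face ((e a).symm x) = (f a).negLabel j)
  have key : ∀ a b, code a = code b → IsIso (f a) (f b) ((e a).trans (e b).symm) := by
    intro a b h
    simp only [code, Prod.mk.injEq] at h
    obtain ⟨h0, h1, h2, h3, h4⟩ := h
    refine ⟨fun x => ?_, fun x => ?_, fun x => ?_, fun i x => ?_, fun j x => ?_⟩
    · have := congrFun h0 (e a x)
      simp only [Equiv.symm_apply_apply] at this
      simp [this]
    · have := congrFun h1 (e a x)
      simp only [Equiv.symm_apply_apply] at this
      simp [this]
    · have := congrFun h2 (e a x)
      simp only [Equiv.symm_apply_apply] at this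
      simp [this]
    · have := congrFun (congrFun h3 i) (e a x)
      simp only [Equiv.symm_apply_apply] at this
      simp [this]
    · have := congrFun (congrFun h4 j) (e a x)
      simp only [Equiv.symm_apply_apply] at this
      simp [this]
  refine Finite.of_injective (fun q : Quotient r => code q.out) fun q q' h => ?_
  rw [← Quotient.out_eq q, ← Quotient.out_eq q']
  exact Quotient.sound (hf _ _ ⟨_, key _ _ h⟩)

end OrientedRibbonGraph

variable {g n : ℕ}

theorem finite_genericRibbonClass (hn : 1 ≤ n) : Finite (GenericRibbonClass g n 1) :=
  OrientedRibbonGraph.finite_of_card_eq _ Subtype.val (fun _ _ h => h) fun R => by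
    rw [R.1.card_X, OrientedRibbonGraph.card_posHalf_of_isGeneric hn R.2]

theorem hasRamificationIndex_unique {np nm : ℕ} {D : Dessin np nm} {i : Fin 3} {p : D.S}
    (hp : D.f p = branchPt i) {k k' : ℕ} (h : HasRamificationIndex D.f p k)
    (h' : HasRamificationIndex D.f p k') : k = k' := by
  obtain ⟨n, -, ⟨σ⟩⟩ := D.exists_sheeting
  rw [σ.hasRamificationIndex_eq hp h, σ.hasRamificationIndex_eq hp h']

/-- The dessins of generic ribbon graphs, with given degrees of the positive boundaries. -/
theorem IsModel.isHurwitz_iff {R : OrientedRibbonGraph n 1} {D : Dessin n 1}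
    {σ : Sheeting D.f R.PosHalf R.gluing} (H : IsModel R D σ) (hn : 1 ≤ n) (α : Fin n → ℕ) :
    ((∀ i, HasRamificationIndex D.f (D.zeroLabel i).1 (α i)) ∧
      (∀ k, D.ramificationCount k = (Finsupp.single 2 (2 * g + n - 1) : ℕ →₀ ℕ) k) ∧
      ∀ j, HasRamificationIndex D.f (D.poleLabel j).1 (4 * g + 2 * n - 2)) ↔
    (R.HasGenus g ∧ R.IsGeneric) ∧ ∀ i, R.posDegree i = α i := by
  -- Degree is twice the index, so index 2 corresponds to degree 4; odd degrees do not occur.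
  have hv : (∀ k, D.ramificationCount k = (Finsupp.single 2 (2 * g + n - 1) : ℕ →₀ ℕ) k) ↔
      ∀ i, R.vertexCount i = (Finsupp.single 4 (2 * g + n - 1) : ℕ →₀ ℕ) i := by
    constructor
    · intro h i
      by_cases hi : Even i
      · obtain ⟨k, rfl⟩ := hi
        rw [← two_mul, ← ramificationCount_eq σ, h, Finsupp.single_apply, Finsupp.single_apply]
        exact if_congr (by omega) rfl rfl
      · rw [R.vertexCount_eq_zero_of_odd hi, Finsupp.single_eq_of_ne]
        rintro rfl
        exact hi (by decide)
    · intro h k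
      rw [ramificationCount_eq σ, h, Finsupp.single_apply, Finsupp.single_apply]
      exact if_congr (by omega) rfl rfl
  rw [hv, ← R.hasGenus_and_isGeneric_iff hn]
  constructor
  · rintro ⟨h1, h2, -⟩
    exact ⟨h2, fun i => hasRamificationIndex_unique (i := 0) (D.zeroLabel i).2
      (H.hasRamificationIndex_zeroLabel i) (h1 i)⟩
  · rintro ⟨h2, h1⟩
    refine ⟨fun i => ?_, h2, fun j => ?_⟩
    · rw [← h1]
      exact H.hasRamificationIndex_zeroLabel i
    -- The single negative boundary carries all the edges, so the ramification over ∞ is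
    -- automatically total.
    · rw [← OrientedRibbonGraph.card_posHalf_of_isGeneric hn h2, ← R.negDegree_eq_card j]
      exact H.hasRamificationIndex_poleLabel j

/-- A model transports both the degree conditions and the automorphism group, so the generic classes
with degrees `α` match the Hurwitz classes with equal weights. -/
theorem exists_hurwitzClass_equiv (hn : 1 ≤ n) (α : Fin n → ℕ) :
    ∃ Φ : {q : GenericRibbonClass g n 1 // ∀ i, q.out.1.posDegree i = α i} ≃
      HurwitzClass α (Finsupp.single 2 (2 * g + n - 1)) (fun _ : Fin 1 => 4 * g + 2 * n - 2),
      ∀ q, Nat.card (Φ q).out.1.aut = Nat.card q.1.out.1.aut := by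
  have hD : ∀ q : {q : GenericRibbonClass g n 1 // ∀ i, q.out.1.posDegree i = α i},
      ∃ D : HurwitzDessin α (Finsupp.single 2 (2 * g + n - 1)) (fun _ : Fin 1 => 4 * g + 2 * n - 2),
        ∃ σ, IsModel q.1.out.1 D.1 σ := by
    intro q
    obtain ⟨D, σ, H⟩ := exists_isModel_dessin q.1.out.1
    exact ⟨⟨D, (H.isHurwitz_iff hn α).2 ⟨q.1.out.2, q.2⟩⟩, σ, H⟩
  choose D σ H using hD
  have hbij : Function.Bijective fun q => (Quotient.mk _ (D q) :
      HurwitzClass α (Finsupp.single 2 (2 * g + n - 1)) (fun _ : Fin 1 => 4 * g + 2 * n - 2)) := by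
    constructor
    · intro q q' h
      have h1 : ∃ h, Dessin.IsIso (D q).1 (D q').1 h := Quotient.exact h
      have h2 := ((H q).equiv_iff (H q')).2 h1
      refine Subtype.ext ?_
      rw [← Quotient.out_eq q.1, ← Quotient.out_eq q'.1]
      exact Quotient.sound h2
    · intro y
      induction y using Quotient.inductionOn with | _ E
      obtain ⟨R, τ, hR⟩ := exists_isModel_ribbon E.1
      have hgen := (hR.isHurwitz_iff hn α).1 E.2
      let q : GenericRibbonClass g n 1 := Quotient.mk _ ⟨R, hgen.1⟩
      have hq : ∃ φ, OrientedRibbonGraph.IsIso q.out.1 R φ := Quotient.mk_out (s :=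
        (OrientedRibbonGraph.isoSetoid n 1).comap
          (Subtype.val : GenericRibbon g n 1 → OrientedRibbonGraph n 1)) ⟨R, hgen.1⟩
      -- The chosen representative of the class need not be `R`; its model is carried onto `E`,
      -- which shows that it has the degrees `α`.
      obtain ⟨E', τ', hE'⟩ := exists_isModel_dessin q.out.1
      obtain ⟨h, hh⟩ := (hE'.equiv_iff hR).1 hq
      have hm := hE'.map hh
      have hdeg := ((hm.isHurwitz_iff hn α).1 E.2).2
      refine ⟨⟨q, hdeg⟩, Quotient.sound ?_⟩
      exact ((H ⟨q, hdeg⟩).equiv_iff hm).1 ⟨_, OrientedRibbonGraph.IsIso.refl _⟩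
  refine ⟨Equiv.ofBijective _ hbij, fun q => ?_⟩
  set y := Equiv.ofBijective _ hbij q with hy
  have h1 : ∃ h, Dessin.IsIso (D q).1 y.out.1 h :=
    Quotient.exact ((Quotient.out_eq y).trans hy).symm
  obtain ⟨h, hh⟩ := h1
  obtain ⟨E⟩ := ((H q).map hh).nonempty_aut_mulEquiv
  exact (Nat.card_congr E.toEquiv).symm

theorem finite_hurwitzClass (hn : 1 ≤ n) (α : Fin n → ℕ) :
    Finite (HurwitzClass α (Finsupp.single 2 (2 * g + n - 1))
      (fun _ : Fin 1 => 4 * g + 2 * n - 2)) := by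
  obtain ⟨Φ, -⟩ := exists_hurwitzClass_equiv (g := g) hn α
  have := finite_genericRibbonClass (g := g) hn
  exact Finite.of_equiv _ Φ

theorem maximalHurwitzNumber_eq (hn : 1 ≤ n) (α : Fin n → ℕ) [Fintype (GenericRibbonClass g n 1)] :
    open Classical in maximalHurwitzNumber g α =
      ∑ q : GenericRibbonClass g n 1 with ∀ i, q.out.1.posDegree i = α i,
        (1 : ℚ) / Nat.card q.out.1.aut := by
  classical
  obtain ⟨Φ, hΦ⟩ := exists_hurwitzClass_equiv (g := g) hn α
  rw [maximalHurwitzNumber, hurwitzNumber, ← finsum_comp_equiv Φ]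
  simp only [hΦ]
  rw [finsum_eq_sum_of_fintype, ← Finset.sum_subtype_eq_sum_filter]
  refine Finset.sum_congr ?_ fun _ _ => rfl
  ext q
  simp

/-- The cell volume depends only on the degrees of the positive boundaries. These are positive and
add up to the number of edges, so grouping the classes by them turns each group into one Hurwitz
number. -/
theorem F_eq (hn : 1 ≤ n) {x : Fin n → ℝ} (hx : ∀ i, 0 < x i) :
    F g n x ≠ ⊤ ∧ (F g n x).toReal =
      ∑ α ∈ (Finset.univ.piAntidiag (4 * g + 2 * n - 2) : Finset (Fin n → ℕ)) with ∀ i, 1 ≤ α i,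
        (∏ i, x i ^ (α i - 1) / ((α i - 1).factorial : ℝ)) * (maximalHurwitzNumber g α : ℝ) := by
  classical
  have := finite_genericRibbonClass (g := g) hn
  have : Fintype (GenericRibbonClass g n 1) := Fintype.ofFinite _
  have haut : ∀ q : GenericRibbonClass g n 1, (Nat.card q.out.1.aut : ℝ≥0∞) ≠ 0 := fun q =>
    Nat.cast_ne_zero.2 Nat.card_pos.ne'
  have hterm : ∀ q : GenericRibbonClass g n 1,
      q.out.1.cellVolume x (fun _ => ∑ i, x i) / (Nat.card q.out.1.aut : ℝ≥0∞) ≠ ⊤ := fun q =>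
    ENNReal.div_ne_top (by rw [q.out.1.cellVolume_eq hx]; exact ENNReal.ofReal_ne_top) (haut q)
  have hF : F g n x = ∑ q : GenericRibbonClass g n 1,
      q.out.1.cellVolume x (fun _ => ∑ i, x i) / (Nat.card q.out.1.aut : ℝ≥0∞) := tsum_fintype _
  refine ⟨by rw [hF]; exact ENNReal.sum_ne_top.2 fun q _ => hterm q, ?_⟩
  rw [hF, ENNReal.toReal_sum fun q _ => hterm q]
  have hmaps : ∀ q ∈ (Finset.univ : Finset (GenericRibbonClass g n 1)), q.out.1.posDegree ∈
      (Finset.univ.piAntidiag (4 * g + 2 * n - 2) : Finset (Fin n → ℕ)).filter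
        fun α => ∀ i, 1 ≤ α i := by
    intro q _
    rw [Finset.mem_filter, Finset.mem_piAntidiag]
    refine ⟨⟨?_, fun _ _ => Finset.mem_univ _⟩, q.out.1.one_le_posDegree⟩
    rw [← OrientedRibbonGraph.card_posHalf_of_isGeneric hn q.out.2]
    exact q.out.1.sum_posDegree
  rw [← Finset.sum_fiberwise_of_maps_to hmaps]
  refine Finset.sum_congr rfl fun α _ => ?_
  rw [maximalHurwitzNumber_eq hn, Rat.cast_sum, Finset.mul_sum]
  have hfilter : (Finset.univ : Finset (GenericRibbonClass g n 1)).filter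
      (fun q => q.out.1.posDegree = α) =
      Finset.univ.filter fun q => ∀ i, q.out.1.posDegree i = α i :=
    Finset.filter_congr fun q _ => funext_iff
  rw [hfilter]
  refine Finset.sum_congr rfl fun q hq => ?_
  have hq' := (Finset.mem_filter.1 hq).2
  rw [q.out.1.cellVolume_eq hx, ENNReal.toReal_div, ENNReal.toReal_ofReal, ENNReal.toReal_natCast]
  · simp only [hq']
    push_cast
    ring
  · exact Finset.prod_nonneg fun i _ => by have := hx i; positivity

theorem exists_isHomogeneous_F (hn : 1 ≤ n) : ∃ P : MvPolynomial (Fin n) ℝ,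
    P.IsHomogeneous (4 * g + n - 2) ∧
      ∀ x : Fin n → ℝ, (∀ i, 0 < x i) → (F g n x).toReal = MvPolynomial.eval x P := by
  refine ⟨∑ α ∈ (Finset.univ.piAntidiag (4 * g + 2 * n - 2) : Finset (Fin n → ℕ)) with
    ∀ i, 1 ≤ α i, MvPolynomial.C ((∏ i, ((α i - 1).factorial : ℝ)⁻¹) *
      (maximalHurwitzNumber g α : ℝ)) * ∏ i, MvPolynomial.X i ^ (α i - 1), ?_, fun x hx => ?_⟩
  · refine MvPolynomial.IsHomogeneous.sum _ _ _ fun α hα => ?_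
    rw [Finset.mem_filter, Finset.mem_piAntidiag] at hα
    -- All `α i ≥ 1`, so the truncated subtractions are exact and the degree is the sum of the `α i`
    -- minus `n`.
    have hdeg : 4 * g + n - 2 = 0 + ∑ i, (α i - 1) := by
      have h1 : ∑ i, (α i - 1) + ∑ _i : Fin n, 1 = ∑ i, α i := by
        rw [← Finset.sum_add_distrib]
        exact Finset.sum_congr rfl fun i _ => Nat.sub_add_cancel (hα.2 i)
      have h2 : ∑ i, α i = 4 * g + 2 * n - 2 := hα.1.1
      simp only [Finset.sum_const, Finset.card_univ, Fintype.card_fin, smul_eq_mul, mul_one] at h1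
      omega
    rw [hdeg]
    refine (MvPolynomial.isHomogeneous_C _ _).mul ?_
    refine MvPolynomial.IsHomogeneous.prod _ _ _ fun i _ => ?_
    exact MvPolynomial.isHomogeneous_X_pow _ _
  · rw [(F_eq hn hx).2, map_sum]
    refine Finset.sum_congr rfl fun α _ => ?_
    simp only [map_mul, map_prod, map_pow, MvPolynomial.eval_C, MvPolynomial.eval_X, div_eq_mul_inv,
      Finset.prod_mul_distrib]
    ring

end OrientedRibbon

end

/-! ### The theorem -/

open OrientedRibbon in
theorem mainTheorem10 :
    -- oriented ribbon graphs and dessins d'enfants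
    (∀ (g np nm : ℕ) (μ : ℕ →₀ ℕ), 1 ≤ np → 1 ≤ nm →
      (μ.sum fun i m => i * m) + 4 = 4 * g + 2 * (np + nm) + 2 * (μ.sum fun _ m => m) →
      ∃ Φ : RibbonClass g np nm μ ≃ DessinClass np nm μ,
        ∀ (R : RibbonType g np nm μ) (D : DessinType np nm μ),
          (Φ (Quotient.mk _ R) = Quotient.mk _ D ↔ Dessin.IsPreimageOfCircle R.1 D.1) ∧
          (Φ (Quotient.mk _ R) = Quotient.mk _ D →
            (∀ i, HasRamificationIndex D.1.f (D.1.zeroLabel i).1 (R.1.posDegree i)) ∧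
            (∀ j, HasRamificationIndex D.1.f (D.1.poleLabel j).1 (R.1.negDegree j)) ∧
            Nonempty (R.1.aut ≃* D.1.aut))) ∧
    -- volumes of the cells
    (∀ (n : ℕ) (R : OrientedRibbonGraph n 1) (x : Fin n → ℝ), (∀ i, 0 < x i) →
      R.cellVolume x (fun _ => ∑ i, x i) = ∏ i, simplexVolume (R.posDegree i) (x i) ∧
      R.cellVolume x (fun _ => ∑ i, x i) =
        ENNReal.ofReal (∏ i, x i ^ (R.posDegree i - 1) / (R.posDegree i - 1).factorial)) ∧
    (∀ (k : ℕ) (x : ℝ), 1 ≤ k → 0 < x →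
      simplexVolume k x = ENNReal.ofReal (x ^ (k - 1) / (k - 1).factorial)) ∧
    -- the volumes and the Hurwitz numbers
    (∀ g n : ℕ, 1 ≤ n → 2 ≤ 2 * g + n →
      Finite (GenericRibbonClass g n 1) ∧
      (∀ α : Fin n → ℕ, Finite (HurwitzClass α (Finsupp.single 2 (2 * g + n - 1))
        (fun _ : Fin 1 => 4 * g + 2 * n - 2))) ∧
      (∀ x : Fin n → ℝ, (∀ i, 0 < x i) →
        F g n x ≠ ⊤ ∧
        (F g n x).toReal =
          ∑ α ∈ (Finset.univ.piAntidiag (4 * g + 2 * n - 2) : Finset (Fin n → ℕ)) with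
              ∀ i, 1 ≤ α i,
            (∏ i, x i ^ (α i - 1) / ((α i - 1).factorial : ℝ)) *
              (maximalHurwitzNumber g α : ℝ)) ∧
      ∃ P : MvPolynomial (Fin n) ℝ, P.IsHomogeneous (4 * g + n - 2) ∧
        ∀ x : Fin n → ℝ, (∀ i, 0 < x i) → (F g n x).toReal = MvPolynomial.eval x P) := by
  refine ⟨fun g np nm μ _ _ hμ => exists_ribbonClass_equiv g np nm μ hμ, fun n R x hx =>
    ⟨R.cellVolume_eq_prod_simplexVolume hx, R.cellVolume_eq hx⟩,
    fun k x hk hx => simplexVolume_eq hk hx, fun g n hn _ =>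
    ⟨finite_genericRibbonClass hn, finite_hurwitzClass hn, fun x hx => F_eq hn hx,
      exists_isHomogeneous_F hn⟩⟩
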